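/- **Notation.** Let $\mathbb{L}$ be the completion of an algebraic closure of $\mathbb{C}((t))$ with its $t$-adic absolute value, so that the residue field of $\mathbb{L}$ is $\mathbb{C}$; let $\mathsf{P}^1$ be the Berkovich projective line over $\mathbb{L}$ and $\mathcal{S}_G\in\mathsf{P}^1$ its Gauss point. A direction $v$ at a point $\mathcal S\in\mathsf P^1$ corresponds to a connected component $U_v$ of $\mathsf{P}^1\setminus\{\mathcal{S}\}$. The directions at $\mathcal{S}_G$ are in canonical bijection with $\mathbb{P}^1(\mathbb{C})$; write $U_x$ for the component corresponding to $x\in\mathbb{P}^1(\mathbb{C})$. For $h\in\mathbb{L}(z)$ of degree $>0$, normalize the numerator and denominator so that the maximum of the absolute values of their coefficients is $1$, and reduce the coefficients. Let $H_{\tilde h}$ be the greatest common divisor of the two resulting binary forms of degree $\deg h$ over $\mathbb{C}$, and let $\phi_{\tilde h}$ be the rational function on $\mathbb{P}^1(\mathbb{C})$ obtained by dividing it out. For a probability measure $\mu$ on $\mathbb{P}^1(\mathbb{C})$ set $\tilde h^*\mu=(\phi_{\tilde h})^*\mu+[H_{\tilde h}=0]$, where $(\phi_{\tilde h})^*\mu:=0$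 if $\phi_{\tilde h}$ is constant. For a finite set $\Gamma$ of type II points, $S(\Gamma)$ is the partition of $\mathsf{P}^1$ into the singletons $\{\mathcal{S}\}$, $\mathcal{S}\in\Gamma$, and the components of $\mathsf{P}^1\setminus\Gamma$. Let $M^1(\Gamma)$ be the set of probability measures on $S(\Gamma)$ that are determined by the masses of the elements of $S(\Gamma)$ (these masses have sum $1$), and let $M^1(\Gamma)^\dagger$ be the set of those without mass on the singletons $\{\mathcal{S}\}$, $\mathcal{S}\in\Gamma$. For $\Gamma_0\subset\Gamma$, $((\pi_{\Gamma,\Gamma_0})_*\omega)(U)=\sum_{V\in S(\Gamma),\,V\subset U}\omega(V)$ for $U\in S(\Gamma_0)$. Let $M^1(\mathbb{P}^1(\mathbb{C}))^\dagger$ be the set of purely atomic probability measures on $\mathbb{P}^1(\mathbb{C})$. Put $\Gamma_G=\{\mathcal{S}_G\}$ and $\Gamma_h=\{\mathcal{S}_G,h(\mathcal{S}_G)\}$. For a direction $v$ at $\mathcal{S}_G$, let $h_*v$ be its image direction at $h(\mathcal{S}_G)$. The surplus degree $s_v(h)$ is the number of preimages in $U_v$ (with multiplicity) of any point of $\mathbb{P}^1(\mathbb{L})$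 outside $U_{h_*v}$. If $B$ is a Möbius transformation with $(B\circ h)(\mathcal{S}_G)=\mathcal{S}_G$, the directional degree $m_v(h)$ is the local degree of $\phi_{\widetilde{B\circ h}}$ at the point of $\mathbb{P}^1(\mathbb{C})$ corresponding to $v$, and $\deg_{\mathcal{S}_G}h=\deg\phi_{\widetilde{B\circ h}}$. For $V\in S(\Gamma_h)$ set $m_{V,U_v}(h)=m_v(h)+s_v(h)$ if $V\subset U_{h_*v}$ and $m_{V,U_v}(h)=s_v(h)$ otherwise; set $m_{V,\{\mathcal{S}_G\}}(h)=\deg_{\mathcal{S}_G}h$ if $V=\{h(\mathcal{S}_G)\}$ and $0$ otherwise. The quantized pullback is $((h_{\Gamma_G,\Gamma_h})^*\omega)(U)=\sum_{V\in S(\Gamma_h)}m_{V,U}(h)\,\omega(V)$ for $U\in S(\Gamma_G)$, and $\omega\in M^1(\Gamma_h)$ is called *quantized $h$-balanced* if $(h_{\Gamma_G,\Gamma_h})^*\omega=\deg h\cdot(\pi_{\Gamma_h,\Gamma_G})_*\omega$. **Setting.** Let $f\in(\mathcal{O}(\mathbb{D})[t^{-1}])(z)\subset\mathbb{L}(z)$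 be a meromorphic family, over the unit disk $\mathbb D$, of rational functions of degree $d>1$ (every specialization at $t\in\mathbb{D}\setminus\{0\}$ has degree $d$) with $f^{-1}(\mathcal{S}_G)\neq\{\mathcal{S}_G\}$. For every $n\ge1$ let $A_n\in(\mathcal{O}(\mathbb{D})[t^{-1}])(z)$ be a meromorphic family of Möbius transformations with $(A_n\circ f^n)(\mathcal{S}_G)=\mathcal{S}_G$. Let $(h,B)$ be $(f^n,A_n)$ for some $n\ge1$. If $\Gamma_h\ne\Gamma_G$, let $h_B$ be the unique zero of $H_{\tilde B}$ and $a_B$ the constant value of $\phi_{\tilde B}$. A pair $\mu=(\mu_C,\mu_E)$ of probability measures on $\mathbb{P}^1(\mathbb{C})$ is called *$(h,B)$-admissible* if $\tilde B^*\mu_E=\mu_C$ when $\Gamma_h=\Gamma_G$, and $\mu_C(\{h_B\})+\mu_E(\{a_B\})\ge1$ when $\Gamma_h\neq\Gamma_G$. For a purely atomic admissible pair $\mu$, $\omega_\mu\in M^1(\Gamma_h)^\dagger$ is given as follows. If $\Gamma_h=\Gamma_G$, then $\omega_\mu(B^{-1}(U_y))=\mu_E(\{y\})$ for all $y\in\mathbb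 P^1(\mathbb C)$. If $\Gamma_h\ne\Gamma_G$, then $\omega_\mu(U_x)=\mu_C(\{x\})$ for $x\ne h_B$, $\omega_\mu(B^{-1}(U_y))=\mu_E(\{y\})$ for $y\neq a_B$, and $\omega_\mu(U_{h_B}\cap B^{-1}(U_{a_B}))=\mu_C(\{h_B\})+\mu_E(\{a_B\})-1$. Conversely, for $\omega\in M^1(\Gamma_h)^\dagger$, $\mu_\omega=(\mu_{\omega,C},\mu_{\omega,E})$ is the pair of purely atomic measures with $\mu_{\omega,C}(\{x\})=\sum_{V\subset U_x}\omega(V)$ and with $\mu_{\omega,E}=(\phi_{\tilde B})_*\mu_{\omega,C}$ if $\Gamma_h=\Gamma_G$, and $\mu_{\omega,E}(\{y\})=\sum_{V\subset B^{-1}(U_y)}\omega(V)$ if $\Gamma_h\ne\Gamma_G$. **Proposition.** (1) With $A=A_1$, the map $\mu\mapsto\omega_\mu$ is a bijection from $$\{\mu=(\mu_C,\mu_E)\in(M^1(\mathbb{P}^1(\mathbb{C}))^\dagger)^2:\ \mu\text{ is }(f,A)\text{-admissible and }(\widetilde{A\circ f})^*\mu_E=d\cdot\mu_C\}$$ onto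 $$\{\omega\in M^1(\Gamma_f)^\dagger:\ (f_{\Gamma_G,\Gamma_f})^*\omega=d\cdot(\pi_{\Gamma_f,\Gamma_G})_*\omega\},$$ and its inverse is $\omega\mapsto\mu_\omega$. (2) Let $\Delta_0^\dagger$ be the set of $\mu_C\in M^1(\mathbb{P}^1(\mathbb{C}))^\dagger$ such that for all sufficiently large $n$ there is $\mu_E^{(n)}\in M^1(\mathbb{P}^1(\mathbb{C}))^\dagger$ for which $(\mu_C,\mu_E^{(n)})$ is $(f^n,A_n)$-admissible and $(\widetilde{A_n\circ f^n})^*\mu_E^{(n)}=d^n\cdot\mu_C$. Let $\Delta_f^\dagger$ be the set of $\omega\in M^1(\Gamma_G)^\dagger$ such that for all sufficiently large $n$ there is a quantized $f^n$-balanced $\omega_n\in M^1(\Gamma_{f^n})$ with $(\pi_{\Gamma_{f^n},\Gamma_G})_*\omega_n=\omega$. Then $$\Delta_0^\dagger\ni\mu_C\mapsto(\pi_{\Gamma_{f^n},\Gamma_G})_*\,\omega_{(\mu_C,\mu_E^{(n)})}\in\Delta_f^\dagger$$ is a well-defined bijection: the value does not depend on $n$ or on the choice of $\mu_E^{(n)}$,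 for all $n\ge1$ for which such a $\mu_E^{(n)}$ exists. -/

import Mathlib

open Set Filter Topology MeasureTheory Polynomial
open scoped NNReal ENNReal Classical

noncomputable section

namespace DegLimit

/-! ### The field `𝕃` of formal Puiseux series -/

/-- The field `ℂ((t))`. -/
abbrev Laurent := LaurentSeries ℂ

/-- Normalization of the `t`-adic absolute value of `ℂ((t))`: `|t| = e⁻¹`. -/
instance laurentRankOne : Valuation.RankOne (Valued.v : Valuation Laurent (WithZero (Multiplicative ℤ))) where
  hom' := (WithZeroMulInt.toNNReal (e := Real.nnabs (Real.exp 1))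
      (by simp [Real.exp_ne_zero])).comp MonoidWithZeroHom.ValueGroup₀.embedding
  strictMono' := by
    have h : (1 : ℝ≥0) < Real.nnabs (Real.exp 1) := by
      rw [← NNReal.coe_lt_coe]
      simp
    exact (WithZeroMulInt.toNNReal_strictMono h).comp
      MonoidWithZeroHom.ValueGroup₀.embedding_strictMono
  exists_val_nontrivial := by
    refine ⟨HahnSeries.single 1 1, ?_⟩
    have := LaurentSeries.valuation_single_zpow ℂ 1
    rw [this]
    constructor
    · simp
    · decide

instance laurentNormed : NontriviallyNormedField Laurent :=
  Valued.toNontriviallyNormedField Laurent (WithZero (Multiplicative ℤ))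

instance laurentUltrametric : IsUltrametricDist Laurent :=
  IsUltrametricDist.isUltrametricDist_of_forall_norm_add_le_max_norm
    (Valuation.norm_add_le (Valued.v : Valuation Laurent (WithZero (Multiplicative ℤ))))

instance laurentComplete : CompleteSpace Laurent := LaurentSeries.instLaurentSeriesComplete

/-- The field of Puiseux series: an algebraic closure of `ℂ((t))`. -/
abbrev Puiseux := AlgebraicClosure Laurent

/-- `Puiseux` carries the unique extension of the absolute value of `ℂ((t))`. -/
instance puiseuxNormed : NormedField Puiseux := spectralNorm.normedField Laurent Puiseux

instance puiseuxUltrametric : IsUltrametricDist Puiseux :=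
  IsUltrametricDist.isUltrametricDist_of_forall_norm_add_le_max_norm
    (isNonarchimedean_spectralNorm (K := Laurent) (L := Puiseux))

/-- The completion `𝕃` of the field of Puiseux series. -/
abbrev PuiseuxC := UniformSpace.Completion Puiseux

notation "𝕃" => PuiseuxC

instance puiseuxCUltrametric : IsUltrametricDist 𝕃 := by
  refine IsUltrametricDist.isUltrametricDist_of_forall_norm_add_le_max_norm fun x y => ?_
  induction x, y using UniformSpace.Completion.induction_on₂ with
  | hp => exact isClosed_le (by fun_prop) (by fun_prop)
  | ih a b =>
    rw [← UniformSpace.Completion.coe_add]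
    simpa using IsUltrametricDist.norm_add_le_max a b

/-- The inclusion `ℂ((t)) ⊂ 𝕃`. -/
def ofLaurent : Laurent →+* 𝕃 :=
  (UniformSpace.Completion.coeRingHom : Puiseux →+* 𝕃).comp (algebraMap Laurent Puiseux)

/-- The inclusion `ℂ ⊂ 𝕃`. -/
def ofComplex : ℂ →+* 𝕃 := ofLaurent.comp HahnSeries.C

/-- The residue map `𝒪_𝕃 → k_𝕃 = ℂ`: for `|a| ≤ 1`, the unique `c ∈ ℂ` with `|a - c| < 1`. -/
def residue (a : 𝕃) : ℂ := Classical.epsilon fun c : ℂ => ‖a - ofComplex c‖ < 1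

/-! ### Rational functions on the projective line over a field -/

section RationalMaps

variable {F : Type} [Field F]

/-- The degree of `p / q` (for coprime `p`, `q`). -/
def pairDegree (p q : F[X]) : ℕ := max p.natDegree q.natDegree

/-- The action of `p / q` (for coprime `p`, `q`) on `ℙ¹(F) = F ∪ {∞}`. -/
def pairEval (p q : F[X]) (x : OnePoint F) : OnePoint F :=
  x.elim
    (if q.coeff (pairDegree p q) = 0 then OnePoint.infty
      else ((p.coeff (pairDegree p q) / q.coeff (pairDegree p q) : F) : OnePoint F))
    fun a => if q.eval a = 0 then OnePoint.infty else ((p.eval a / q.eval a : F) : OnePoint F)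

/-- The order of vanishing at `x ∈ ℙ¹(F)` of the binary form of degree `n`
whose dehomogenization is `g`. -/
def formOrder (n : ℕ) (g : F[X]) (x : OnePoint F) : ℕ :=
  x.elim (n - g.natDegree) fun a => g.rootMultiplicity a

/-- The multiplicity of `x` as a solution of `p / q = b` on `ℙ¹(F)`: the local degree of `p / q`
at `x` if `x` is mapped to `b`, and `0` otherwise (and `0` if `p / q` is constant). -/
def fibreMult (p q : F[X]) (b x : OnePoint F) : ℕ :=
  formOrder (pairDegree p q) (b.elim q fun c => p - C c * q) x

/-- The local degree of `p / q` at `x ∈ ℙ¹(F)`. -/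
def localDegree (p q : F[X]) (x : OnePoint F) : ℕ := fibreMult p q (pairEval p q x) x

/-- The degree of a rational function. -/
def ratDegree (h : RatFunc F) : ℕ := pairDegree h.num h.denom

/-- The composition `g ∘ h` of rational functions (`h` non-constant). -/
def ratComp (g h : RatFunc F) : RatFunc F := RatFunc.eval RatFunc.C h g

/-- The `n`-th iterate of `f`. -/
def ratIter (f : RatFunc F) : ℕ → RatFunc F
  | 0 => RatFunc.X
  | n + 1 => ratComp f (ratIter f n)

end RationalMaps

/-! ### The Berkovich projective line -/

section Berkovich

variable (K : Type) [NormedField K] [IsUltrametricDist K]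

/-- The Berkovich affine line over `K`: multiplicative seminorms on `K[z]` which extend the
absolute value of `K` (they are automatically non-archimedean). -/
structure BerkovichLine : Type where
  /-- the seminorm -/
  val : Valuation K[X] ℝ≥0
  map_C : ∀ c : K, val (C c) = ‖c‖₊

/-- The Gel'fand topology, that is, the topology of pointwise convergence. -/
instance : TopologicalSpace (BerkovichLine K) :=
  TopologicalSpace.induced (fun v (g : K[X]) => v.1 g) inferInstance

/-- The Berkovich projective line `𝖯¹(K)`. -/
abbrev BerkovichP1 : Type := OnePoint (BerkovichLine K)

variable {K}

/-- The point of the Berkovich affine line given by `a ∈ K`, i.e. `g ↦ |g(a)|`. -/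
def linePoint (a : K) : BerkovichLine K :=
  ⟨(NormedField.valuation (K := K)).comap (evalRingHom a), fun c => by simp⟩

/-- The inclusion `ℙ¹(K) ⊂ 𝖯¹(K)`. -/
def classical (x : OnePoint K) : BerkovichP1 K := x.map linePoint

theorem isNonarchimedean_abs : IsNonarchimedean (NormedField.toAbsoluteValue K) :=
  fun x y => IsUltrametricDist.norm_add_le_max x y

variable (K) in
/-- The Gauss norm on `K[z]`, the maximum of the absolute values of the coefficients. -/
def gaussValuation : Valuation K[X] ℝ≥0 where
  toFun g := ⟨g.gaussNorm (NormedField.toAbsoluteValue K) 1,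
    g.gaussNorm_nonneg _ zero_le_one⟩
  map_zero' := by
    ext
    exact gaussNorm_zero (NormedField.toAbsoluteValue K) 1
  map_one' := by
    ext
    change gaussNorm (NormedField.toAbsoluteValue K) 1 1 = 1
    rw [← C_1, gaussNorm_C]
    exact map_one _
  map_mul' p q := by
    ext
    exact gaussNorm_mul isNonarchimedean_abs one_pos p q
  map_add_le_max' p q := by
    have := isNonarchimedean_gaussNorm (NormedField.toAbsoluteValue K) isNonarchimedean_abs
      zero_le_one p q
    exact this

variable (K) in
/-- The Gauss point `𝒮_G` of `𝖯¹(K)`. -/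
def gaussPoint : BerkovichP1 K :=
  OnePoint.some ⟨gaussValuation K, fun c => by
    ext
    exact gaussNorm_C (NormedField.toAbsoluteValue K) 1 c⟩

theorem powers_le_primeCompl {K : Type} [Field K] (v : Valuation K[X] ℝ≥0) (q : K[X]) (hq : v q ≠ 0) :
    Submonoid.powers q ≤ v.supp.primeCompl := by
  rintro _ ⟨n, rfl⟩ h
  exact pow_ne_zero n hq (by simpa using (Valuation.mem_supp_iff v _).1 h)

/-- For a point `v` at which `q` does not vanish, the seminorm `g ↦ v (g ∘ (p / q))`. -/
def lineMap (p q : K[X]) (v : BerkovichLine K) (hq : v.1 q ≠ 0) : BerkovichLine K :=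
  ⟨(v.1.extendToLocalization (powers_le_primeCompl v.1 q hq) (Localization.Away q)).comap
      (aeval (R := K) (IsLocalization.mk' (Localization.Away q) p
        (⟨q, Submonoid.mem_powers q⟩ : Submonoid.powers q))).toRingHom, fun c => by
    have : (aeval (R := K) (IsLocalization.mk' (Localization.Away q) p
        (⟨q, Submonoid.mem_powers q⟩ : Submonoid.powers q))) (C c) =
        algebraMap K[X] (Localization.Away q) (C c) := by
      rw [aeval_C, IsScalarTower.algebraMap_apply K K[X] (Localization.Away q)]
      rfl
    simp only [Valuation.comap_apply, AlgHom.toRingHom_eq_coe, RingHom.coe_coe, this,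
      Valuation.extendToLocalization_apply_map_apply, v.map_C c]⟩

/-- The action of a non-constant rational function `h` on `𝖯¹(K)`. -/
def berkMap (h : RatFunc K) (S : BerkovichP1 K) : BerkovichP1 K :=
  S.elim (classical (pairEval h.num h.denom OnePoint.infty)) fun v =>
    if hq : v.1 h.denom = 0 then OnePoint.infty else OnePoint.some (lineMap h.num h.denom v hq)

/-- The partition `S(Γ)` of `𝖯¹(K)` into the singletons `{𝒮}`, `𝒮 ∈ Γ`, and the connected
components of `𝖯¹(K) ∖ Γ`. -/
def cells (Γ : Set (BerkovichP1 K)) : Set (Set (BerkovichP1 K)) :=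
  {U | (∃ S ∈ Γ, U = {S}) ∨ ∃ S ∉ Γ, U = connectedComponentIn Γᶜ S}

/-- `M¹(Γ)`: the probability measures on the set `S(Γ)`, given by the masses of its elements. -/
def M1 (Γ : Set (BerkovichP1 K)) : Set (cells Γ → ℝ≥0∞) := {ω | ∑' V, ω V = 1}

/-- `M¹(Γ)^†`: the elements of `M¹(Γ)` without mass on the points of `Γ`. -/
def M1dag (Γ : Set (BerkovichP1 K)) : Set (cells Γ → ℝ≥0∞) :=
  {ω | ω ∈ M1 Γ ∧ ∀ V : cells Γ, (∃ S ∈ Γ, V.1 = {S}) → ω V = 0}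

/-- The mass `∑_{V ⊂ U} ω(V)` given by `ω` to a union `U` of elements of `S(Γ)`. For `Γ₀ ⊂ Γ` and
`U ∈ S(Γ₀)` this is `((π_{Γ,Γ₀})_* ω)(U)`. -/
def mass {Γ : Set (BerkovichP1 K)} (ω : cells Γ → ℝ≥0∞) (U : Set (BerkovichP1 K)) : ℝ≥0∞ :=
  ∑' V : cells Γ, if V.1 ⊆ U then ω V else 0

/-- The projection `(π_{Γ,Γ₀})_*`, for `Γ₀ ⊂ Γ`. -/
def proj (Γ Γ₀ : Set (BerkovichP1 K)) (ω : cells Γ → ℝ≥0∞) : cells Γ₀ → ℝ≥0∞ := fun U => mass ω U.1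

/-- The vertex set `Γ_h = {𝒮_G, h(𝒮_G)}`. -/
def vertices (h : RatFunc K) : Set (BerkovichP1 K) := {gaussPoint K, berkMap h (gaussPoint K)}

/-- The tangent map of `h` at `𝒮_G`. A direction at `𝒮` is identified with the corresponding
connected component of `𝖯¹ ∖ {𝒮}`; the direction `U` at `𝒮_G` is mapped to the direction at
`h(𝒮_G)` which contains `h(𝒮)` for all `𝒮 ∈ U` close enough to `𝒮_G`. -/
def tangentMap (h : RatFunc K) (U : Set (BerkovichP1 K)) : Set (BerkovichP1 K) :=
  {T | T ≠ berkMap h (gaussPoint K) ∧ ∀ᶠ S in 𝓝[U] (gaussPoint K),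
    berkMap h S ∈ connectedComponentIn {berkMap h (gaussPoint K)}ᶜ T}

/-- `(h^* δ_b)(U)` for `b ∈ ℙ¹(K)`: the number of preimages of `b` in `U`, with multiplicity. -/
def preimageCount (h : RatFunc K) (U : Set (BerkovichP1 K)) (b : OnePoint K) : ℕ :=
  ∑ᶠ x ∈ {x : OnePoint K | classical x ∈ U}, fibreMult h.num h.denom b x

/-- The surplus local degree of `h` on the direction `U` at `𝒮_G`: the value of `(h^* δ_b)(U)` for
the `b` outside the image direction (it does not depend on `b`). -/
def surplus (h : RatFunc K) (U : Set (BerkovichP1 K)) : ℕ :=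
  sInf {n | ∃ b : OnePoint K, classical b ∉ tangentMap h U ∧ n = preimageCount h U b}

end Berkovich

/-! ### Reduction -/

/-- A scalar making the maximum of the absolute values of the coefficients of the numerator and
the denominator of `h` equal to `1`. -/
def scaling (h : RatFunc 𝕃) : 𝕃 :=
  Classical.epsilon fun c : 𝕃 =>
    max (gaussValuation 𝕃 (C c * h.num)) (gaussValuation 𝕃 (C c * h.denom)) = 1

/-- Coefficientwise reduction of a polynomial with coefficients in `𝒪_𝕃`. -/
def reducePoly (p : 𝕃[X]) : ℂ[X] := ∑ j ∈ Finset.range (p.natDegree + 1), monomial j (residue (p.coeff j))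

/-- The numerator `P̃` of `h̃`. -/
def redNum (h : RatFunc 𝕃) : ℂ[X] := reducePoly (C (scaling h) * h.num)

/-- The denominator `Q̃` of `h̃`. -/
def redDenom (h : RatFunc 𝕃) : ℂ[X] := reducePoly (C (scaling h) * h.denom)

/-- The dehomogenization `H_{h̃}(1, ζ)` of the greatest common divisor `H_{h̃}`. -/
def redGcd (h : RatFunc 𝕃) : ℂ[X] := EuclideanDomain.gcd (redNum h) (redDenom h)

/-- The numerator of the reduction `φ_{h̃}`. -/
def phiNum (h : RatFunc 𝕃) : ℂ[X] := redNum h / redGcd h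

/-- The denominator of the reduction `φ_{h̃}`. -/
def phiDenom (h : RatFunc 𝕃) : ℂ[X] := redDenom h / redGcd h

/-- The reduction `φ_{h̃}`, acting on `ℙ¹(ℂ)`. -/
def phi (h : RatFunc 𝕃) : OnePoint ℂ → OnePoint ℂ := pairEval (phiNum h) (phiDenom h)

/-- `ord_x [H_{h̃} = 0]` for `x ∈ ℙ¹(ℂ)`. -/
def ordH (h : RatFunc 𝕃) (x : OnePoint ℂ) : ℕ :=
  x.elim (ratDegree h - pairDegree (redNum h) (redDenom h)) fun a => (redGcd h).rootMultiplicity a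

/-! ### Directions at the Gauss point, and quantized local degrees -/

/-- The Gauss point of `𝖯¹(𝕃)`. -/
abbrev gauss : BerkovichP1 𝕃 := gaussPoint 𝕃

/-- The direction at the Gauss point corresponding to `x ∈ ℙ¹(ℂ) = ℙ¹(k_𝕃)`, as a subset of
`𝖯¹(𝕃)`. -/
def dir (x : OnePoint ℂ) : Set (BerkovichP1 𝕃) :=
  connectedComponentIn {gauss}ᶜ (classical (x.map ofComplex))

/-- The inverse of `dir`. -/
def dirCoord (U : Set (BerkovichP1 𝕃)) : OnePoint ℂ := Classical.epsilon fun x => dir x = U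

/-- A Möbius transformation `A` with `(A ∘ h)(𝒮_G) = 𝒮_G`. -/
def rescaling (h : RatFunc 𝕃) : RatFunc 𝕃 :=
  Classical.epsilon fun A => ratDegree A = 1 ∧ berkMap (ratComp A h) gauss = gauss

/-- The directional local degree of `h` on the direction `U` at the Gauss point. -/
def dirDegree (h : RatFunc 𝕃) (U : Set (BerkovichP1 𝕃)) : ℕ :=
  localDegree (phiNum (ratComp (rescaling h) h)) (phiDenom (ratComp (rescaling h) h)) (dirCoord U)

/-- The local degree of `h` at the Gauss point. -/
def gaussDegree (h : RatFunc 𝕃) : ℕ :=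
  pairDegree (phiNum (ratComp (rescaling h) h)) (phiDenom (ratComp (rescaling h) h))

/-- The quantized local degree `m_{V,U}(h)`, for `V ∈ S(Γ_h)` and `U ∈ S(Γ_G)`. -/
def quantizedDegree (h : RatFunc 𝕃) (V U : Set (BerkovichP1 𝕃)) : ℕ :=
  if U = {gauss} then
    if V = {berkMap h gauss} then gaussDegree h else 0
  else if V ⊆ tangentMap h U then dirDegree h U + surplus h U
  else surplus h U

/-- The quantized pullback `(h_{Γ_G,Γ_h})^*`. -/
def quantizedPullback (h : RatFunc 𝕃) (ω : cells (vertices h) → ℝ≥0∞) :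
    cells {gauss} → ℝ≥0∞ :=
  fun U => ∑' V : cells (vertices h), (quantizedDegree h V.1 U.1 : ℝ≥0∞) * ω V

/-- The relation `(h_{Γ_G,Γ_h})^* ω = deg h · (π_{Γ_h,Γ_G})_* ω`. -/
def QuantizedBalanced (h : RatFunc 𝕃) (ω : cells (vertices h) → ℝ≥0∞) : Prop :=
  quantizedPullback h ω = fun U => (ratDegree h : ℝ≥0∞) * proj (vertices h) {gauss} ω U

/-- `Δ_f`. -/
def Delta (f : RatFunc 𝕃) : Set (cells {gauss} → ℝ≥0∞) :=
  {ω | ω ∈ M1 {gauss} ∧ ∀ᶠ n in atTop, ∃ ωn ∈ M1 (vertices (ratIter f n)),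
    QuantizedBalanced (ratIter f n) ωn ∧ proj (vertices (ratIter f n)) {gauss} ωn = ω}

/-- `Δ_f^†`. -/
def DeltaDag (f : RatFunc 𝕃) : Set (cells {gauss} → ℝ≥0∞) := Delta f ∩ M1dag {gauss}

/-! ### Measures on `ℙ¹(ℂ)` -/

instance : MeasurableSpace (OnePoint ℂ) := borel _

instance : BorelSpace (OnePoint ℂ) := ⟨rfl⟩

/-- `M¹(ℙ¹(ℂ))^†`: the probability measures on `ℙ¹(ℂ)` which are sums of at most countably many
atoms. -/
def AtomicProb (μ : Measure (OnePoint ℂ)) : Prop :=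
  IsProbabilityMeasure μ ∧ ∃ s : Set (OnePoint ℂ), s.Countable ∧ μ sᶜ = 0

/-- The total mass of the non-atomic part of `μ`. -/
def diffuseMass (μ : Measure (OnePoint ℂ)) : ℝ≥0∞ := μ univ - ∑' x, μ {x}

/-- The value at a Borel set `s` of the pullback `h̃^* μ = (φ_{h̃})^* μ + [H_{h̃} = 0]`. -/
def redPullback (h : RatFunc 𝕃) (μ : Measure (OnePoint ℂ)) (s : Set (OnePoint ℂ)) : ℝ≥0∞ :=
  ∫⁻ z, (∑' w, if w ∈ s then (fibreMult (phiNum h) (phiDenom h) z w : ℝ≥0∞) else 0) ∂μ +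
    ∑' w, if w ∈ s then (ordH h w : ℝ≥0∞) else 0

/-- The point `h_A` with `supp [H_Ã = 0] = {h_A}`, when `deg H_Ã > 0`. -/
def hPoint (A : RatFunc 𝕃) : OnePoint ℂ := Classical.epsilon fun x => 0 < ordH A x

/-- The constant value `a_A` of `φ_Ã`, when `deg H_Ã > 0`. -/
def aPoint (A : RatFunc 𝕃) : OnePoint ℂ := phi A OnePoint.infty

/-- The admissibility of a pair `μ = (μ_C, μ_E)` with respect to `f` and `A`. -/
def Admissible (f A : RatFunc 𝕃) (μ : Measure (OnePoint ℂ) × Measure (OnePoint ℂ)) : Prop :=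
  if berkMap f gauss = gauss then ∀ s, MeasurableSet s → redPullback A μ.2 s = μ.1 s
  else 1 ≤ μ.1 {hPoint A} + μ.2 {aPoint A}

/-- The relation `(A ∘ f)~^* μ_E = deg f · μ_C`. -/
def ReducedBalanced (f A : RatFunc 𝕃) (μ : Measure (OnePoint ℂ) × Measure (OnePoint ℂ)) : Prop :=
  ∀ s, MeasurableSet s → redPullback (ratComp A f) μ.2 s = (ratDegree f : ℝ≥0∞) * μ.1 s

/-- The set of the pairs `(μ_C, μ_E)` of purely atomic probability measures which are admissible
and satisfy `(A ∘ f)~^* μ_E = deg f · μ_C`. -/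
def balancedPairs (f A : RatFunc 𝕃) : Set (Measure (OnePoint ℂ) × Measure (OnePoint ℂ)) :=
  {μ | AtomicProb μ.1 ∧ AtomicProb μ.2 ∧ Admissible f A μ ∧ ReducedBalanced f A μ}

/-- The set of the `ω ∈ M¹(Γ_f)^†` satisfying the quantized balanced relation. -/
def balancedQuantized (f : RatFunc 𝕃) : Set (cells (vertices f) → ℝ≥0∞) :=
  {ω | ω ∈ M1dag (vertices f) ∧ QuantizedBalanced f ω}

/-- `Δ_0`, with respect to `f` and the sequence `A` of rescalings. -/
def DeltaZero (f : RatFunc 𝕃) (A : ℕ → RatFunc 𝕃) : Set (Measure (OnePoint ℂ)) :=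
  {μC | IsProbabilityMeasure μC ∧ ∀ᶠ n in atTop, ∃ μE, AtomicProb μE ∧
    Admissible (ratIter f n) (A n) (μC, μE) ∧ ReducedBalanced (ratIter f n) (A n) (μC, μE)}

/-- `Δ_0^†`. -/
def DeltaZeroDag (f : RatFunc 𝕃) (A : ℕ → RatFunc 𝕃) : Set (Measure (OnePoint ℂ)) :=
  {μC | μC ∈ DeltaZero f A ∧ AtomicProb μC}

/-- The direction `(A⁻¹)_* (dir y)` at `A⁻¹(𝒮_G)`, as a subset of `𝖯¹(𝕃)`. -/
def dirVia (A : RatFunc 𝕃) (y : OnePoint ℂ) : Set (BerkovichP1 𝕃) := berkMap A ⁻¹' dir y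

/-- The measure `ω_μ` on `S(Γ_f)`. In the last case, `V` is the intersection of the directions
from `𝒮_G` to `f(𝒮_G)` and from `f(𝒮_G)` to `𝒮_G`. -/
def omegaOf (f A : RatFunc 𝕃) (μ : Measure (OnePoint ℂ) × Measure (OnePoint ℂ)) :
    cells (vertices f) → ℝ≥0∞ := fun V =>
  if berkMap f gauss = gauss then
    if V.1 = {gauss} then diffuseMass μ.2
    else μ.2 {Classical.epsilon fun y => V.1 = dirVia A y}
  else
    if V.1 = {gauss} then diffuseMass μ.1
    else if V.1 = {berkMap f gauss} then diffuseMass μ.2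
    else if ∃ x, x ≠ hPoint A ∧ V.1 = dir x then μ.1 {Classical.epsilon fun x => V.1 = dir x}
    else if ∃ y, y ≠ aPoint A ∧ V.1 = dirVia A y then
      μ.2 {Classical.epsilon fun y => V.1 = dirVia A y}
    else μ.1 {hPoint A} + μ.2 {aPoint A} - 1

/-- The purely atomic measure on `ℙ¹(ℂ)` with the given masses of points. -/
def atomicMeasure (m : OnePoint ℂ → ℝ≥0∞) : Measure (OnePoint ℂ) :=
  Measure.sum fun x => m x • Measure.dirac x

/-- The pair `μ_ω = (μ_{ω,C}, μ_{ω,E})`. -/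
def muOf (f A : RatFunc 𝕃) (ω : cells (vertices f) → ℝ≥0∞) :
    Measure (OnePoint ℂ) × Measure (OnePoint ℂ) :=
  if berkMap f gauss = gauss then
    (atomicMeasure fun x => mass ω (dir x), (atomicMeasure fun x => mass ω (dir x)).map (phi A))
  else
    (atomicMeasure fun x => mass ω (dir x), atomicMeasure fun y => mass ω (dirVia A y))

/-! ### Meromorphic families -/

/-- `s ∈ 𝒪(𝔻)[t⁻¹] ⊂ ℂ((t))`: the Laurent series converges on the punctured unit disk. -/
def ConvergesOnDisk (s : Laurent) : Prop :=
  ∀ t : ℂ, t ≠ 0 → ‖t‖ < 1 → Summable fun n : ℤ => s.coeff n * t ^ n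

/-- The value of a convergent Laurent series at `t`. -/
def laurentEval (s : Laurent) (t : ℂ) : ℂ := ∑' n : ℤ, s.coeff n * t ^ n

/-- The specialization at `t` of a polynomial over `𝒪(𝔻)[t⁻¹]`. -/
def specialize (P : Laurent[X]) (t : ℂ) : ℂ[X] :=
  ∑ j ∈ Finset.range (P.natDegree + 1), monomial j (laurentEval (P.coeff j) t)

/-- `f ∈ (𝒪(𝔻)[t⁻¹])(z) ⊂ 𝕃(z)` is a meromorphic family of rational functions of degree `d`:
`f = P / Q` with `P`, `Q` over `𝒪(𝔻)[t⁻¹]`, whose specialization at each `t ∈ 𝔻 ∖ {0}` is a rational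
function of degree `d`. -/
def IsMeromorphicFamily (d : ℕ) (f : RatFunc 𝕃) : Prop :=
  ∃ P Q : Laurent[X], (∀ j, ConvergesOnDisk (P.coeff j)) ∧ (∀ j, ConvergesOnDisk (Q.coeff j)) ∧
    f = algebraMap 𝕃[X] (RatFunc 𝕃) (P.map ofLaurent) /
      algebraMap 𝕃[X] (RatFunc 𝕃) (Q.map ofLaurent) ∧
    ∀ t : ℂ, t ≠ 0 → ‖t‖ < 1 → IsCoprime (specialize P t) (specialize Q t) ∧
      pairDegree (specialize P t) (specialize Q t) = d

end DegLimit

end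

open DegLimit

noncomputable section

namespace DegLimit

set_option linter.unusedSectionVars false

/-! ### The residue field of `𝕃` -/

/-! The two balance relations are the same system of equations, indexed by `x ∈ ℙ¹(ℂ)`. Let `B`
rescale `h`, so that `g = B ∘ h` fixes the Gauss point. Then the reductions of the normalized
numerator and denominator `P`, `Q` of `g` are linearly independent. Counting the zeros of `aP + bQ`
in a residue disc (`preimageCount_eq`) shows that a point of `ℙ¹(𝕃)` has `ord_x H_g̃` preimages
under `g` in `U_x`, plus the local degree `m_x` of `φ_g̃` at `x` when its reduction is `φ_g̃(x)`.
Hence `h` sends the direction `x` to `B⁻¹(U_{φ_g̃(x)})`, with surplus degree `ord_x H_g̃` and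
directional degree `m_x` (`Rescales.tangentMap_eq`, `Rescales.surplus_eq`, `Rescales.dirDegree_eq`).
For `ω` without mass at the vertices, quantized balance therefore reads `m_x · ω(B⁻¹(U_{φ_g̃(x)})) +
ord_x H_g̃ = deg h · ω(U_x)` for all `x`. For atomic measures, reduced balance is the same equation
with `μ_E{φ_g̃(x)}` and `μ_C{x}` as the two masses.

It remains to match `M¹(Γ_h)^†` with the admissible pairs through `μ_C{x} = ω(U_x)` and `μ_E{y} =
ω(B⁻¹(U_y))`. If `h` fixes the Gauss point, so does `B`; then `φ_B̃` is a bijection relabelling the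
directions, and admissibility says that `μ_E` is the image of `μ_C`. Otherwise the reduction of `B`
is degenerate, and `separation` shows that `U_{h_B}` and `B⁻¹(U_{a_B})` cover `𝖯¹` and meet in an
annulus. The cells are the two vertices, the remaining directions at each vertex, and this annulus.
Inclusion–exclusion (`Rescales.mass_add_mass`) gives `ω(U_{h_B}) + ω(B⁻¹(U_{a_B})) = 1 +
ω(annulus)`: admissibility is exactly the nonnegativity of the mass left for the annulus, and this
mass is determined by the pair.

For the limit sets, the projection of `ω_μ` to `Γ_G` has masses `μ_C{x}`, so it depends on `μ_C`
only and determines it. For surjectivity, the `ω_n` are not assumed to avoid the vertices; but the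
balance relation at `{𝒮_G}` equates a nonzero multiple of the mass at `fⁿ(𝒮_G)` with a multiple of
the mass at `𝒮_G`, which vanishes, and the first part applies to each `n`.

The geometry of `𝖯¹` is expressed through the absolute values `lin S a b` of linear forms, which
treat `∞` like any other point and determine `S` up to a common scalar. Residue discs become
inequalities between such values, and connectedness comes from the explicit paths `thicken`. -/

theorem norm_sub_le_max_norm {E : Type*} [SeminormedAddGroup E] [IsUltrametricDist E] (x y : E) :
    ‖x - y‖ ≤ max ‖x‖ ‖y‖ := by
  simpa [sub_eq_add_neg] using IsUltrametricDist.norm_add_le_max x (-y)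

theorem laurent_norm_le_one_iff (a : Laurent) : ‖a‖ ≤ 1 ↔ Valued.v a ≤ (1 : WithZero (Multiplicative ℤ)) :=
  Valued.toNormedField.norm_le_one_iff

theorem laurent_norm_lt_one_iff (a : Laurent) : ‖a‖ < 1 ↔ Valued.v a < (1 : WithZero (Multiplicative ℤ)) :=
  Valued.toNormedField.norm_lt_one_iff

theorem laurent_norm_C (c : ℂ) (hc : c ≠ 0) : ‖(HahnSeries.C c : Laurent)‖ = 1 := by
  have key : ∀ c : ℂ, ‖(HahnSeries.C c : Laurent)‖ ≤ 1 := by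
    intro c
    rw [laurent_norm_le_one_iff, LaurentSeries.val_le_one_iff_eq_coe]
    exact ⟨PowerSeries.C c, by simp⟩
  refine le_antisymm (key c) ?_
  have h1 : (HahnSeries.C c : Laurent) * HahnSeries.C c⁻¹ = 1 := by
    rw [← map_mul, mul_inv_cancel₀ hc, map_one]
  have h2 := congrArg norm h1
  rw [norm_mul, norm_one] at h2
  nlinarith [key c⁻¹, key c, norm_nonneg (HahnSeries.C c : Laurent)]

/-- An integral Laurent series is a power series; subtracting its constant term leaves positive
order. -/
theorem exists_residue_laurent (a : Laurent) (ha : ‖a‖ ≤ 1) :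
    ∃ c : ℂ, ‖a - HahnSeries.C c‖ < 1 := by
  rw [laurent_norm_le_one_iff, LaurentSeries.val_le_one_iff_eq_coe] at ha
  obtain ⟨p, rfl⟩ := ha
  refine ⟨PowerSeries.constantCoeff p, ?_⟩
  have h : (HahnSeries.ofPowerSeries ℤ ℂ p : Laurent) - HahnSeries.C (PowerSeries.constantCoeff p)
      = HahnSeries.ofPowerSeries ℤ ℂ (p - PowerSeries.C (PowerSeries.constantCoeff p)) := by
    simp
  rw [h, laurent_norm_lt_one_iff]
  have h2 : Valued.v (HahnSeries.ofPowerSeries ℤ ℂ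
      (p - PowerSeries.C (PowerSeries.constantCoeff p)) : Laurent) ≤ WithZero.exp (-(1 : ℤ)) := by
    rw [LaurentSeries.valuation_le_iff_coeff_lt_eq_zero]
    intro n hn
    rw [PowerSeries.coeff_coe]
    split_ifs with h0
    · rfl
    · have : n = 0 := by omega
      subst this
      simp
  exact lt_of_le_of_lt h2 (by decide)

theorem norm_coe_puiseux (a : Puiseux) : ‖(a : 𝕃)‖ = ‖a‖ := UniformSpace.Completion.norm_coe a

theorem norm_algebraMap_puiseux (a : Laurent) : ‖algebraMap Laurent Puiseux a‖ = ‖a‖ :=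
  spectralNorm_extends a

theorem norm_ofLaurent (a : Laurent) : ‖ofLaurent a‖ = ‖a‖ :=
  (norm_coe_puiseux _).trans (norm_algebraMap_puiseux a)

theorem norm_ofComplex {c : ℂ} (hc : c ≠ 0) : ‖ofComplex c‖ = 1 :=
  (norm_ofLaurent _).trans (laurent_norm_C c hc)

theorem norm_ofComplex_le (c : ℂ) : ‖ofComplex c‖ ≤ 1 := by
  by_cases hc : c = 0
  · simp [hc]
  · exact (norm_ofComplex hc).le

/-- The residue field is algebraic over `ℂ`, hence equal to it. Since the norm is the spectral value
of the minimal polynomial, `‖a‖ ≤ 1` makes its coefficients integral; replacing them by their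
residues gives a monic complex polynomial `r` with `|r(a)| < 1`. As `r` splits over `ℂ`, some factor
`a - c` has norm less than one. -/
theorem exists_residue_puiseux (a : Puiseux) (ha : ‖a‖ ≤ 1) :
    ∃ c : ℂ, ‖a - algebraMap Laurent Puiseux (HahnSeries.C c)‖ < 1 := by
  have ha_int : IsIntegral Laurent a := Algebra.IsIntegral.isIntegral a
  set m := minpoly Laurent a with hm
  have hmon : m.Monic := minpoly.monic ha_int
  have hco : ∀ n, ‖m.coeff n‖ ≤ 1 := (spectralValue_le_one_iff hmon).1 ha
  choose c hc using fun n => exists_residue_laurent (m.coeff n) (hco n)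
  have hn : 0 < m.natDegree := minpoly.natDegree_pos ha_int
  set φ : ℂ →+* Puiseux := (algebraMap Laurent Puiseux).comp HahnSeries.C with hφ
  set r : ℂ[X] := X ^ m.natDegree + ∑ j ∈ Finset.range m.natDegree, C (c j) * X ^ j with hr
  have hrm : r.Monic := monic_X_pow_add (by
    refine lt_of_le_of_lt (degree_sum_le _ _) ?_
    rw [Finset.sup_lt_iff (WithBot.bot_lt_coe _)]
    intro j hj
    refine (degree_C_mul_X_pow_le _ _).trans_lt ?_
    exact_mod_cast Finset.mem_range.1 hj)
  have hev : ‖r.eval₂ φ a‖ < 1 := by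
    have h0 : ∑ j ∈ Finset.range (m.natDegree + 1),
        algebraMap Laurent Puiseux (m.coeff j) * a ^ j = 0 := by
      rw [← eval₂_eq_sum_range]
      exact minpoly.aeval Laurent a
    rw [Finset.sum_range_succ, hmon.coeff_natDegree, map_one, one_mul, add_comm] at h0
    have h1 : r.eval₂ φ a = ∑ j ∈ Finset.range m.natDegree,
        (φ (c j) - algebraMap Laurent Puiseux (m.coeff j)) * a ^ j := by
      rw [← sub_zero (r.eval₂ φ a), ← h0, hr]
      simp only [eval₂_add, eval₂_pow, eval₂_X, eval₂_finsetSum, eval₂_mul, eval₂_C, sub_mul,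
        Finset.sum_sub_distrib]
      ring
    rw [h1]
    obtain ⟨j, -, hjle⟩ := IsUltrametricDist.exists_norm_finsetSum_le_of_nonempty
      (Finset.nonempty_range_iff.2 hn.ne')
      fun j => (φ (c j) - algebraMap Laurent Puiseux (m.coeff j)) * a ^ j
    refine hjle.trans_lt ?_
    rw [norm_mul, norm_pow]
    have hj : ‖φ (c j) - algebraMap Laurent Puiseux (m.coeff j)‖ < 1 := by
      rw [hφ, RingHom.comp_apply, ← map_sub, norm_algebraMap_puiseux, norm_sub_rev]
      exact hc j
    calc _ ≤ ‖φ (c j) - algebraMap Laurent Puiseux (m.coeff j)‖ * 1 := by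
          gcongr
          exact pow_le_one₀ (norm_nonneg _) ha
      _ < 1 := by simpa using hj
  by_contra! hcon
  have hsp := (IsAlgClosed.splits r).eq_prod_roots
  rw [hrm.leadingCoeff, C_1, one_mul] at hsp
  rw [hsp] at hev
  have : ∀ s : Multiset ℂ, 1 ≤ ‖((s.map (X - C ·)).prod : ℂ[X]).eval₂ φ a‖ := by
    intro s
    induction s using Multiset.induction_on with
    | empty => simp
    | cons b s ih =>
      rw [Multiset.map_cons, Multiset.prod_cons, eval₂_mul, norm_mul]
      refine one_le_mul_of_one_le_of_one_le ?_ ih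
      simpa [hφ] using hcon b
  exact absurd hev (not_lt.2 (this _))

/-- An element of the dense subfield at distance less than one from `a` has the same residue. -/
theorem exists_residue (a : 𝕃) (ha : ‖a‖ ≤ 1) : ∃ c : ℂ, ‖a - ofComplex c‖ < 1 := by
  obtain ⟨b, hb⟩ := (UniformSpace.Completion.denseRange_coe (α := Puiseux)).exists_dist_lt a
    (zero_lt_one' ℝ)
  rw [dist_eq_norm] at hb
  have hb1 : ‖b‖ ≤ 1 := by
    rw [← norm_coe_puiseux]
    have : (b : 𝕃) = a - (a - b) := by ring
    rw [this]
    exact (norm_sub_le_max_norm _ _).trans (max_le ha hb.le)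
  obtain ⟨c, hc⟩ := exists_residue_puiseux b hb1
  refine ⟨c, ?_⟩
  have h2 : ‖(b : 𝕃) - ofComplex c‖ < 1 := by
    rw [← norm_coe_puiseux] at hc
    convert hc using 2
    exact (UniformSpace.Completion.coe_sub _ _).symm
  have : a - ofComplex c = (a - b) + (b - ofComplex c) := by ring
  rw [this]
  exact (IsUltrametricDist.norm_add_le_max _ _).trans_lt (max_lt hb h2)

theorem norm_sub_residue_lt {a : 𝕃} (ha : ‖a‖ ≤ 1) : ‖a - ofComplex (residue a)‖ < 1 :=
  Classical.epsilon_spec (exists_residue a ha)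

/-- Distinct complex constants are at distance exactly one, so at most one of them is closer than
one to `a`. This pins down the choice made by `epsilon`. -/
theorem residue_eq {a : 𝕃} {c : ℂ} (h : ‖a - ofComplex c‖ < 1) : residue a = c := by
  have ha : ‖a‖ ≤ 1 := by
    have : a = (a - ofComplex c) + ofComplex c := by ring
    rw [this]
    exact (IsUltrametricDist.norm_add_le_max _ _).trans (max_le h.le (norm_ofComplex_le c))
  by_contra hne
  have h1 := norm_ofComplex (sub_ne_zero.2 hne)
  have h2 : ofComplex (residue a - c) = (a - ofComplex c) - (a - ofComplex (residue a)) := by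
    rw [map_sub]; ring
  rw [h2] at h1
  exact absurd ((norm_sub_le_max_norm _ _).trans_lt
    (max_lt h (norm_sub_residue_lt ha))) h1.not_lt

theorem residue_ofComplex (c : ℂ) : residue (ofComplex c) = c := residue_eq (by simp)

theorem residue_zero : residue 0 = 0 := residue_eq (by simp)

theorem residue_one : residue 1 = 1 := residue_eq (by simp)

theorem residue_eq_zero_iff {a : 𝕃} (ha : ‖a‖ ≤ 1) : residue a = 0 ↔ ‖a‖ < 1 := by
  constructor
  · intro h
    simpa [h] using norm_sub_residue_lt ha
  · intro h
    exact residue_eq (by simpa using h)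

theorem residue_add {a b : 𝕃} (ha : ‖a‖ ≤ 1) (hb : ‖b‖ ≤ 1) :
    residue (a + b) = residue a + residue b := by
  apply residue_eq
  have : a + b - ofComplex (residue a + residue b) =
      (a - ofComplex (residue a)) + (b - ofComplex (residue b)) := by rw [map_add]; ring
  rw [this]
  exact (IsUltrametricDist.norm_add_le_max _ _).trans_lt
    (max_lt (norm_sub_residue_lt ha) (norm_sub_residue_lt hb))

theorem residue_mul {a b : 𝕃} (ha : ‖a‖ ≤ 1) (hb : ‖b‖ ≤ 1) :
    residue (a * b) = residue a * residue b := by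
  apply residue_eq
  have : a * b - ofComplex (residue a * residue b) =
      a * (b - ofComplex (residue b)) + (a - ofComplex (residue a)) * ofComplex (residue b) := by
    rw [map_mul]; ring
  rw [this]
  refine (IsUltrametricDist.norm_add_le_max _ _).trans_lt (max_lt ?_ ?_)
  · rw [norm_mul]
    exact (mul_le_of_le_one_left (norm_nonneg _) ha).trans_lt (norm_sub_residue_lt hb)
  · rw [norm_mul]
    exact (mul_le_of_le_one_right (norm_nonneg _) (norm_ofComplex_le _)).trans_lt
      (norm_sub_residue_lt ha)

theorem residue_sum {ι : Type*} (s : Finset ι) (a : ι → 𝕃) (ha : ∀ i ∈ s, ‖a i‖ ≤ 1) :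
    ‖∑ i ∈ s, a i‖ ≤ 1 ∧ residue (∑ i ∈ s, a i) = ∑ i ∈ s, residue (a i) := by
  induction s using Finset.induction_on with
  | empty => simp [residue_zero]
  | insert i s hi ih =>
    have ih := ih fun j hj => ha j (Finset.mem_insert_of_mem hj)
    have hi' := ha i (Finset.mem_insert_self _ _)
    rw [Finset.sum_insert hi, Finset.sum_insert hi, residue_add hi' ih.1, ih.2]
    exact ⟨(IsUltrametricDist.norm_add_le_max _ _).trans (max_le hi' ih.1), rfl⟩

instance puiseuxC_isAlgClosed : IsAlgClosed 𝕃 := by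
  let : NontriviallyNormedField 𝕃 :=
    { (inferInstance : NormedField 𝕃) with
      non_trivial := by
        obtain ⟨x, hx⟩ := NormedField.exists_one_lt_norm Laurent
        exact ⟨ofLaurent x, by rw [norm_ofLaurent]; exact hx⟩ }
  have : CharZero 𝕃 := charZero_of_injective_ringHom ofComplex.injective
  let : Algebra Puiseux 𝕃 := (UniformSpace.Completion.coeRingHom : Puiseux →+* 𝕃).toAlgebra
  exact IsAlgClosed.of_denseRange (K := Puiseux) UniformSpace.Completion.denseRange_coe

/-! ### Linear forms at points of the Berkovich projective line -/

section Linear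

variable {K : Type} [NormedField K] [IsUltrametricDist K]

/-- The absolute value at `S` of the binary form of degree `n` with dehomogenization `F`. -/
def formVal (n : ℕ) (S : BerkovichP1 K) (F : K[X]) : ℝ≥0 := S.elim ‖F.coeff n‖₊ fun v => v.1 F

/-- The absolute value at `S` of the linear form `a X + b`. -/
def lin (S : BerkovichP1 K) (a b : K) : ℝ≥0 := formVal 1 S (C a * X + C b)

/-- The maximum of the absolute values at `S` of the two coordinate forms. -/
def size (S : BerkovichP1 K) : ℝ≥0 := max (lin S 1 0) (lin S 0 1)

theorem formVal_add_le (n : ℕ) (S : BerkovichP1 K) (F G : K[X]) :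
    formVal n S (F + G) ≤ max (formVal n S F) (formVal n S G) := by
  induction S using OnePoint.rec with
  | infty => simpa [formVal] using IsUltrametricDist.nnnorm_add_le_max (F.coeff n) (G.coeff n)
  | coe v => exact v.1.map_add F G

theorem formVal_C_mul (n : ℕ) (S : BerkovichP1 K) (c : K) (F : K[X]) :
    formVal n S (C c * F) = ‖c‖₊ * formVal n S F := by
  induction S using OnePoint.rec with
  | infty => simp [formVal]
  | coe v => simp [formVal, v.map_C]

theorem lin_infty (a b : K) : lin (OnePoint.infty : BerkovichP1 K) a b = ‖a‖₊ := by
  simp [lin, formVal]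

theorem lin_coe (v : BerkovichLine K) (a b : K) :
    lin (v : BerkovichP1 K) a b = v.1 (C a * X + C b) := rfl

theorem lin_mul (S : BerkovichP1 K) (c a b : K) : lin S (c * a) (c * b) = ‖c‖₊ * lin S a b := by
  rw [lin, lin, ← formVal_C_mul]
  congr 1
  simp only [C_mul]
  ring

theorem lin_add_le (S : BerkovichP1 K) (a b a' b' : K) :
    lin S (a + a') (b + b') ≤ max (lin S a b) (lin S a' b') := by
  refine le_trans (le_of_eq ?_) (formVal_add_le 1 S _ _)
  rw [lin]
  congr 1
  simp only [C_add]
  ring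

theorem lin_neg (S : BerkovichP1 K) (a b : K) : lin S (-a) (-b) = lin S a b := by
  simpa using lin_mul S (-1) a b

theorem lin_sub_le (S : BerkovichP1 K) (a b a' b' : K) :
    lin S (a - a') (b - b') ≤ max (lin S a b) (lin S a' b') := by
  rw [← lin_neg S a' b', sub_eq_add_neg, sub_eq_add_neg]
  exact lin_add_le _ _ _ _ _

theorem size_pos (S : BerkovichP1 K) : 0 < size S := by
  induction S using OnePoint.rec with
  | infty => simp [size, lin_infty]
  | coe v => simp [size, lin_coe]

theorem lin_le (S : BerkovichP1 K) (a b : K) : lin S a b ≤ max ‖a‖₊ ‖b‖₊ * size S := by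
  have h := lin_add_le S (a * 1) (a * 0) (b * 0) (b * 1)
  rw [lin_mul, lin_mul] at h
  simp only [mul_one, mul_zero, add_zero, zero_add] at h
  refine h.trans (max_le ?_ ?_)
  · exact mul_le_mul' (le_max_left _ _) (le_max_left _ _)
  · exact mul_le_mul' (le_max_right _ _) (le_max_right _ _)

theorem lin_le_size (S : BerkovichP1 K) {a b : K} (ha : ‖a‖ ≤ 1) (hb : ‖b‖ ≤ 1) :
    lin S a b ≤ size S :=
  (lin_le S a b).trans (mul_le_of_le_one_left (zero_le) (max_le ha hb))

theorem lin_lt_size (S : BerkovichP1 K) {a b : K} (ha : ‖a‖ < 1) (hb : ‖b‖ < 1) :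
    lin S a b < size S :=
  (lin_le S a b).trans_lt (mul_lt_of_lt_one_left (size_pos S) (max_lt ha hb))

/-- A point of the Berkovich line over an algebraically closed field is determined by its values
on the monic linear polynomials. -/
theorem BerkovichLine.ext_linear [IsAlgClosed K] {v w : BerkovichLine K}
    (h : ∀ c, v.1 (X - C c) = w.1 (X - C c)) : v = w := by
  have hval : v.1 = w.1 := by
    ext1 g
    rw [(IsAlgClosed.splits g).eq_prod_roots, map_mul, map_mul, v.map_C, w.map_C]
    congr 1
    induction g.roots using Multiset.induction_on with
    | empty => simp
    | cons b s ih => simp [h, ih]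
  cases v
  cases w
  simpa using hval

/-- A point of the Berkovich projective line is determined by the values of linear forms, up to
scaling. -/
theorem eq_of_lin_eq_mul [IsAlgClosed K] {S T : BerkovichP1 K} {N : ℝ≥0} (hN : N ≠ 0)
    (h : ∀ a b, lin S a b = N * lin T a b) : S = T := by
  induction S using OnePoint.rec with
  | infty =>
    induction T using OnePoint.rec with
    | infty => rfl
    | coe w =>
      have := h 0 1
      simp only [lin_infty, lin_coe, nnnorm_zero, C_0, zero_mul, map_one, zero_add, mul_one] at this
      exact absurd this.symm hN
  | coe v =>
    induction T using OnePoint.rec with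
    | infty =>
      have := h 0 1
      simp [lin_infty, lin_coe] at this
    | coe w =>
      have h1 := h 0 1
      simp only [lin_coe, C_0, zero_mul, zero_add, map_one, mul_one] at h1
      subst h1
      congr 1
      refine BerkovichLine.ext_linear fun c => ?_
      simpa [lin_coe, sub_eq_add_neg] using h 1 (-c)

/-- Clears the denominator in `g ↦ v (g ∘ (p / q))`. The leftover factor `v q` is the homogeneous
scalar that becomes `N` in `lin_berkMap`. -/
theorem lineMap_linear (p q : K[X]) (v : BerkovichLine K) (hq : v.1 q ≠ 0) (a b : K) :
    v.1 q * (lineMap p q v hq).1 (C a * X + C b) = v.1 (C a * p + C b * q) := by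
  set L := Localization.Away q
  set y : Submonoid.powers q := ⟨q, Submonoid.mem_powers q⟩
  set E := v.1.extendToLocalization (powers_le_primeCompl v.1 q hq) L
  have hE : ∀ g, E (algebraMap K[X] L g) = v.1 g :=
    fun g => Valuation.extendToLocalization_apply_map_apply _ _ _ _
  have hC : ∀ c : K, algebraMap K L c = algebraMap K[X] L (C c) := fun c =>
    IsScalarTower.algebraMap_apply K K[X] L c
  change v.1 q * E (aeval (R := K) (IsLocalization.mk' L p y) (C a * X + C b)) = _
  rw [← hE q, ← map_mul, ← hE]
  congr 1
  simp only [map_add, map_mul, aeval_C, aeval_X, hC]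
  have := IsLocalization.mk'_spec L p y
  rw [← this]
  change _ = _ * (_ * algebraMap K[X] L q) + _
  ring

end Linear

/-! ### Rational functions as pairs of polynomials -/

section Rep

variable {K : Type} [Field K]

/-- `p / q` is the rational function `h` in lowest terms. -/
def IsRep (h : RatFunc K) (p q : K[X]) : Prop := ∃ u : K, u ≠ 0 ∧ h.num = C u * p ∧ h.denom = C u * q

theorem isRep_num_denom (h : RatFunc K) : IsRep h h.num h.denom := ⟨1, one_ne_zero, by simp, by simp⟩

theorem IsRep.C_mul {h : RatFunc K} {p q : K[X]} (H : IsRep h p q) {c : K} (hc : c ≠ 0) :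
    IsRep h (C c * p) (C c * q) := by
  obtain ⟨u, hu, h1, h2⟩ := H
  refine ⟨u * c⁻¹, mul_ne_zero hu (inv_ne_zero hc), ?_, ?_⟩
  · rw [h1, ← mul_assoc, ← Polynomial.C_mul, mul_assoc, inv_mul_cancel₀ hc, mul_one]
  · rw [h2, ← mul_assoc, ← Polynomial.C_mul, mul_assoc, inv_mul_cancel₀ hc, mul_one]

theorem isRep_div {p q : K[X]} (hpq : IsCoprime p q) (hq : q ≠ 0) :
    IsRep (algebraMap K[X] (RatFunc K) p / algebraMap K[X] (RatFunc K) q) p q := by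
  have hgcd : gcd p q = 1 := by
    rw [← normalize_gcd, normalize_eq_one, gcd_isUnit_iff]
    exact hpq
  refine ⟨q.leadingCoeff⁻¹, inv_ne_zero (leadingCoeff_ne_zero.2 hq), ?_, ?_⟩
  · rw [RatFunc.num_div, hgcd]
    simp
  · rw [RatFunc.denom_div _ hq, hgcd]
    simp

theorem IsRep.isCoprime {h : RatFunc K} {p q : K[X]} (H : IsRep h p q) : IsCoprime p q := by
  obtain ⟨u, hu, h1, h2⟩ := H
  have := RatFunc.isCoprime_num_denom h
  rw [h1, h2] at this
  exact this.of_mul_left_right.of_mul_right_right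

theorem IsRep.denom_ne_zero {h : RatFunc K} {p q : K[X]} (H : IsRep h p q) : q ≠ 0 := by
  obtain ⟨u, hu, h1, h2⟩ := H
  rintro rfl
  exact RatFunc.denom_ne_zero h (by simp [h2])

theorem IsRep.eq_div {h : RatFunc K} {p q : K[X]} (H : IsRep h p q) :
    h = algebraMap K[X] (RatFunc K) p / algebraMap K[X] (RatFunc K) q := by
  obtain ⟨u, hu, h1, h2⟩ := H
  rw [← RatFunc.num_div_denom h, h1, h2, map_mul, map_mul]
  exact mul_div_mul_left _ _ (by simpa using hu)

theorem pairDegree_C_mul {u : K} (hu : u ≠ 0) (p q : K[X]) :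
    pairDegree (C u * p) (C u * q) = pairDegree p q := by
  rw [pairDegree, natDegree_C_mul hu, natDegree_C_mul hu, pairDegree]

theorem IsRep.ratDegree_eq {h : RatFunc K} {p q : K[X]} (H : IsRep h p q) :
    ratDegree h = pairDegree p q := by
  obtain ⟨u, hu, h1, h2⟩ := H
  rw [ratDegree, h1, h2, pairDegree_C_mul hu]

/-- If `p / q` is non-constant and in lowest terms, then `p` and `q` are linearly independent. -/
theorem eq_zero_of_linear_relation {p q : K[X]} (hpq : IsCoprime p q) (hd : pairDegree p q ≠ 0)
    {a b : K} (h : C a * p + C b * q = 0) : a = 0 ∧ b = 0 := by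
  have key : ∀ {p q : K[X]} {a b : K}, IsCoprime p q → pairDegree p q ≠ 0 →
      C a * p + C b * q = 0 → a = 0 := by
    intro p q a b hpq hd h
    by_contra ha
    have hp : p = C (-(a⁻¹ * b)) * q := by
      have h1 : C a⁻¹ * (C a * p + C b * q) = 0 := by rw [h, mul_zero]
      rw [mul_add, ← mul_assoc, ← C_mul, inv_mul_cancel₀ ha, C_1, one_mul, ← mul_assoc,
        ← C_mul] at h1
      rw [C_neg, neg_mul]
      exact eq_neg_of_add_eq_zero_left h1
    have hu : IsUnit q := by
      rw [hp] at hpq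
      exact isCoprime_self.1 hpq.of_mul_left_right
    have hq0 := natDegree_eq_zero_of_isUnit hu
    refine hd ?_
    rw [pairDegree, hq0, hp]
    have := natDegree_C_mul_le (-(a⁻¹ * b)) q
    omega
  refine ⟨key hpq hd h, key hpq.symm ?_ (by rw [add_comm]; exact h)⟩
  rwa [pairDegree, max_comm]

theorem natDegree_linear_comb_le (p q : K[X]) (a b : K) :
    (C a * p + C b * q).natDegree ≤ pairDegree p q :=
  (natDegree_add_le _ _).trans
    (max_le_max (natDegree_C_mul_le _ _) (natDegree_C_mul_le _ _))

theorem isCoprime_linear_comb {p q : K[X]} (hpq : IsCoprime p q) {a b c d : K}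
    (hdet : a * d - b * c ≠ 0) : IsCoprime (C a * p + C b * q) (C c * p + C d * q) := by
  obtain ⟨r, s, hrs⟩ := hpq
  set D := a * d - b * c with hD
  refine ⟨C D⁻¹ * (C d * r - C c * s), C D⁻¹ * (C a * s - C b * r), ?_⟩
  have h1 : C D⁻¹ * C D = (1 : K[X]) := by rw [← C_mul, inv_mul_cancel₀ hdet, C_1]
  have h2 : (C D : K[X]) = C a * C d - C b * C c := by rw [hD]; simp
  calc _ = C D⁻¹ * (C a * C d - C b * C c) * (r * p + s * q) := by ring
    _ = 1 := by rw [← h2, h1, hrs, one_mul]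

/-- Passing to linear combinations cannot raise the degree, and neither can the way back through the
inverse matrix, written below as the adjugate divided by `D`. -/
theorem pairDegree_linear_comb (p q : K[X]) {a b c d : K} (hdet : a * d - b * c ≠ 0) :
    pairDegree (C a * p + C b * q) (C c * p + C d * q) = pairDegree p q := by
  refine le_antisymm (max_le (natDegree_linear_comb_le _ _ _ _) (natDegree_linear_comb_le _ _ _ _)) ?_
  set D := a * d - b * c with hD
  have h1 : C D⁻¹ * C D = (1 : K[X]) := by rw [← C_mul, inv_mul_cancel₀ hdet, C_1]
  have h2 : (C D : K[X]) = C a * C d - C b * C c := by rw [hD]; simp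
  have hp : p = C (D⁻¹ * d) * (C a * p + C b * q) + C (-(D⁻¹ * b)) * (C c * p + C d * q) := by
    rw [C_neg, C_mul, C_mul]
    calc p = C D⁻¹ * (C a * C d - C b * C c) * p := by rw [← h2, h1, one_mul]
      _ = _ := by ring
  have hq : q = C (-(D⁻¹ * c)) * (C a * p + C b * q) + C (D⁻¹ * a) * (C c * p + C d * q) := by
    rw [C_neg, C_mul, C_mul]
    calc q = C D⁻¹ * (C a * C d - C b * C c) * q := by rw [← h2, h1, one_mul]
      _ = _ := by ring
  refine max_le ?_ ?_
  · conv_lhs => rw [hp]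
    exact natDegree_linear_comb_le _ _ _ _
  · conv_lhs => rw [hq]
    exact natDegree_linear_comb_le _ _ _ _

/-- The matrix of a Möbius transformation. -/
structure IsMobius (B : RatFunc K) (a b c d : K) : Prop where
  isRep : IsRep B (C a * X + C b) (C c * X + C d)
  det_ne_zero : a * d - b * c ≠ 0

theorem pairDegree_linear {a b c d : K} (hdet : a * d - b * c ≠ 0) :
    pairDegree (C a * X + C b) (C c * X + C d) = 1 := by
  have := pairDegree_linear_comb (X : K[X]) 1 hdet
  simpa [pairDegree] using this

theorem IsMobius.ratDegree_eq {B : RatFunc K} {a b c d : K} (H : IsMobius B a b c d) :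
    ratDegree B = 1 := by
  rw [H.isRep.ratDegree_eq, pairDegree_linear H.det_ne_zero]

theorem isMobius_div {a b c d : K} (hdet : a * d - b * c ≠ 0) :
    IsMobius (algebraMap K[X] (RatFunc K) (C a * X + C b) /
      algebraMap K[X] (RatFunc K) (C c * X + C d)) a b c d := by
  refine ⟨isRep_div ?_ ?_, hdet⟩
  · simpa using isCoprime_linear_comb (isCoprime_one_right (x := (X : K[X]))) hdet
  · intro h
    have h1 : c = 0 := by simpa using congrArg (coeff · 1) h
    have h0 : d = 0 := by simpa using congrArg (coeff · 0) h
    simp [h0, h1] at hdet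

/-- If the determinant vanished, `(c, -a)` and `(d, -b)` would be linear relations between numerator
and denominator, forcing `c = d = 0` and a zero denominator. -/
theorem exists_isMobius {B : RatFunc K} (hB : ratDegree B = 1) : ∃ a b c d, IsMobius B a b c d := by
  have hn : B.num.natDegree ≤ 1 := hB ▸ le_max_left _ _
  have hm : B.denom.natDegree ≤ 1 := hB ▸ le_max_right _ _
  obtain ⟨a, b, h1⟩ := exists_eq_X_add_C_of_natDegree_le_one hn
  obtain ⟨c, d, h2⟩ := exists_eq_X_add_C_of_natDegree_le_one hm
  refine ⟨a, b, c, d, ⟨by rw [← h1, ← h2]; exact isRep_num_denom B, fun h0 => ?_⟩⟩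
  have hcop := RatFunc.isCoprime_num_denom B
  have hne : pairDegree B.num B.denom ≠ 0 := by rw [← ratDegree, hB]; exact one_ne_zero
  have e1 := eq_zero_of_linear_relation hcop hne (a := c) (b := -a) (by
    rw [h1, h2]
    have : C b * C c = (C a * C d : K[X]) := by
      rw [← C_mul, ← C_mul, sub_eq_zero.1 h0]
    rw [C_neg]
    linear_combination this)
  have e2 := eq_zero_of_linear_relation hcop hne (a := d) (b := -b) (by
    rw [h1, h2]
    have : C b * C c = (C a * C d : K[X]) := by
      rw [← C_mul, ← C_mul, sub_eq_zero.1 h0]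
    rw [C_neg]
    linear_combination - this * X)
  refine RatFunc.denom_ne_zero B ?_
  rw [h2, e1.1, e2.1]
  simp

/-- Post-composition with a Möbius map only changes the basis of the span of `p` and `q`.
Non-constancy of `h` keeps the new denominator nonzero. -/
theorem IsMobius.comp {B h : RatFunc K} {a b c d : K} (H : IsMobius B a b c d) {p q : K[X]}
    (hh : IsRep h p q) (hd : ratDegree h ≠ 0) :
    IsRep (ratComp B h) (C a * p + C b * q) (C c * p + C d * q) := by
  have hne : C c * p + C d * q ≠ 0 := fun h0 => by
    have := eq_zero_of_linear_relation hh.isCoprime (hh.ratDegree_eq ▸ hd) h0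
    have hdet := H.det_ne_zero
    simp [this.1, this.2] at hdet
  have hq0 : algebraMap K[X] (RatFunc K) q ≠ 0 := by simpa using hh.denom_ne_zero
  obtain ⟨u, hu, h1, h2⟩ := H.isRep
  have : ratComp B h = algebraMap K[X] (RatFunc K) (C a * p + C b * q) /
      algebraMap K[X] (RatFunc K) (C c * p + C d * q) := by
    rw [ratComp, RatFunc.eval, h1, h2, hh.eq_div]
    simp only [eval₂_mul, eval₂_add, eval₂_C, eval₂_X, map_add, map_mul, RatFunc.algebraMap_C]
    have hu' : RatFunc.C u ≠ 0 := by simpa using hu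
    rw [mul_div_mul_left _ _ hu', ← mul_div_mul_right _ _ hq0]
    congr 1
    · field_simp
    · field_simp
  rw [this]
  exact isRep_div (isCoprime_linear_comb hh.isCoprime H.det_ne_zero) hne

end Rep

/-! ### The action of rational functions in terms of linear forms -/

section Action

variable {K : Type} [NormedField K] [IsUltrametricDist K]

theorem pairEval_infty_cases {p q : K[X]} (hq : q ≠ 0) :
    p.coeff (pairDegree p q) ≠ 0 ∨ q.coeff (pairDegree p q) ≠ 0 := by
  by_cases hle : p.natDegree ≤ q.natDegree
  · right
    rw [pairDegree, max_eq_right hle]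
    exact leadingCoeff_ne_zero.2 hq
  · left
    rw [pairDegree, max_eq_left (not_le.1 hle).le]
    refine leadingCoeff_ne_zero.2 ?_
    rintro rfl
    simp at hle

/-- In homogeneous coordinates, `h` acts by pulling linear forms back to combinations of numerator
and denominator; `N` is the scalar lost in choosing an affine coordinate. It is the value at `S` of
the denominator, or of the numerator when `S` is mapped to `∞`, and is nonzero because the two have
no common zero. -/
theorem lin_berkMap_num_denom (h : RatFunc K) (S : BerkovichP1 K) : ∃ N : ℝ≥0, N ≠ 0 ∧ ∀ a b,
    formVal (ratDegree h) S (C a * h.num + C b * h.denom) = N * lin (berkMap h S) a b := by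
  induction S using OnePoint.rec with
  | infty =>
    set n := ratDegree h with hn
    have hform : ∀ a b, formVal n (OnePoint.infty : BerkovichP1 K) (C a * h.num + C b * h.denom) =
        ‖a * h.num.coeff n + b * h.denom.coeff n‖₊ := fun a b => by simp [formVal]
    have hcases := pairEval_infty_cases (p := h.num) (RatFunc.denom_ne_zero h)
    change h.num.coeff n ≠ 0 ∨ h.denom.coeff n ≠ 0 at hcases
    by_cases hq : h.denom.coeff n = 0
    · have hB : berkMap h (OnePoint.infty : BerkovichP1 K) = OnePoint.infty := by
        simp only [berkMap, OnePoint.elim_infty, pairEval]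
        rw [← ratDegree, ← hn, if_pos hq]
        rfl
      refine ⟨‖h.num.coeff n‖₊, by simpa using hcases.resolve_right (not_not.2 hq), fun a b => ?_⟩
      rw [hform, hB, lin_infty, hq]
      simp [mul_comm]
    · have hB : berkMap h (OnePoint.infty : BerkovichP1 K) =
          (linePoint (h.num.coeff n / h.denom.coeff n) : BerkovichP1 K) := by
        simp only [berkMap, OnePoint.elim_infty, pairEval]
        rw [← ratDegree, ← hn, if_neg hq]
        rfl
      refine ⟨‖h.denom.coeff n‖₊, by simpa using hq, fun a b => ?_⟩
      rw [hform, hB, lin_coe]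
      have : (linePoint (h.num.coeff n / h.denom.coeff n)).1 (C a * X + C b) =
          ‖a * (h.num.coeff n / h.denom.coeff n) + b‖₊ := by
        ext
        simp [linePoint]
      rw [this, ← nnnorm_mul]
      congr 1
      field_simp
  | coe v =>
    by_cases hq : v.1 h.denom = 0
    · have hB : berkMap h (v : BerkovichP1 K) = OnePoint.infty := by
        simp only [berkMap, OnePoint.elim_some]
        rw [dif_pos hq]
      refine ⟨v.1 h.num, fun hp => ?_, fun a b => ?_⟩
      · obtain ⟨r, s, hrs⟩ := RatFunc.isCoprime_num_denom h
        have h1 := v.1.map_add (r * h.num) (s * h.denom)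
        rw [hrs] at h1
        simp [hp, hq] at h1
      · have h0 : v.1 (C b * h.denom) = 0 := by simp [hq]
        rw [hB, lin_infty]
        change v.1 _ = _
        refine le_antisymm ((v.1.map_add _ _).trans ?_) ?_
        · simp [hq, v.map_C, mul_comm]
        · have h1 := v.1.map_sub (C a * h.num + C b * h.denom) (C b * h.denom)
          rw [add_sub_cancel_right, h0] at h1
          simpa [v.map_C, mul_comm] using h1
    · have hB : berkMap h (v : BerkovichP1 K) = (lineMap h.num h.denom v hq : BerkovichP1 K) := by
        simp only [berkMap, OnePoint.elim_some]
        rw [dif_neg hq]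
      exact ⟨v.1 h.denom, hq, fun a b => by rw [hB, lin_coe, lineMap_linear]; rfl⟩

theorem lin_berkMap {h : RatFunc K} {p q : K[X]} (hh : IsRep h p q) (S : BerkovichP1 K) :
    ∃ N : ℝ≥0, N ≠ 0 ∧ ∀ a b,
      formVal (ratDegree h) S (C a * p + C b * q) = N * lin (berkMap h S) a b := by
  obtain ⟨u, hu, h1, h2⟩ := hh
  obtain ⟨N, hN, hf⟩ := lin_berkMap_num_denom h S
  have hu' : ‖u‖₊ ≠ 0 := by simpa using hu
  refine ⟨‖u‖₊⁻¹ * N, mul_ne_zero (inv_ne_zero hu') hN, fun a b => ?_⟩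
  have : C a * h.num + C b * h.denom = C u * (C a * p + C b * q) := by rw [h1, h2]; ring
  rw [mul_assoc, ← hf, this, formVal_C_mul, inv_mul_cancel_left₀ hu']

theorem IsMobius.lin_berkMap {B : RatFunc K} {a b c d : K} (H : IsMobius B a b c d)
    (S : BerkovichP1 K) : ∃ N : ℝ≥0, N ≠ 0 ∧ ∀ x y,
      lin S (x * a + y * c) (x * b + y * d) = N * lin (berkMap B S) x y := by
  obtain ⟨N, hN, h⟩ := DegLimit.lin_berkMap H.isRep S
  refine ⟨N, hN, fun x y => ?_⟩
  rw [← h, H.ratDegree_eq, lin]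
  congr 1
  simp only [C_add, C_mul]
  ring

variable [IsAlgClosed K]

/-- The action on the Berkovich line is compatible with composition with Möbius maps. -/
theorem berkMap_ratComp {B h : RatFunc K} (hB : ratDegree B = 1) (hd : ratDegree h ≠ 0)
    (S : BerkovichP1 K) : berkMap (ratComp B h) S = berkMap B (berkMap h S) := by
  obtain ⟨a, b, c, d, H⟩ := exists_isMobius hB
  have hrep := H.comp (isRep_num_denom h) hd
  have hdeg : ratDegree (ratComp B h) = ratDegree h := by
    rw [hrep.ratDegree_eq, pairDegree_linear_comb _ _ H.det_ne_zero, ratDegree]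
  obtain ⟨N₁, hN₁, h₁⟩ := lin_berkMap hrep S
  obtain ⟨N₂, hN₂, h₂⟩ := lin_berkMap (isRep_num_denom h) S
  obtain ⟨N₃, hN₃, h₃⟩ := H.lin_berkMap (berkMap h S)
  refine eq_of_lin_eq_mul (N := N₁⁻¹ * (N₂ * N₃))
    (mul_ne_zero (inv_ne_zero hN₁) (mul_ne_zero hN₂ hN₃)) fun x y => ?_
  rw [mul_assoc, mul_assoc, ← h₃, ← h₂, eq_inv_mul_iff_mul_eq₀ hN₁, ← h₁, hdeg]
  congr 1
  simp only [C_add, C_mul]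
  ring

/-- The adjugate matrix inverts up to the determinant, and a common scalar on all linear forms does
not change the point. -/
theorem berkMap_mobius_inverse {B B' : RatFunc K} {a b c d : K} (H : IsMobius B a b c d)
    (H' : IsMobius B' d (-b) (-c) a) (S : BerkovichP1 K) : berkMap B (berkMap B' S) = S := by
  obtain ⟨N₁, hN₁, h₁⟩ := H.lin_berkMap (berkMap B' S)
  obtain ⟨N₂, hN₂, h₂⟩ := H'.lin_berkMap S
  set D := a * d - b * c with hD
  have hD0 : ‖D‖₊ ≠ 0 := by simpa using H.det_ne_zero
  refine eq_of_lin_eq_mul (N := N₁⁻¹ * (N₂⁻¹ * ‖D‖₊))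
    (mul_ne_zero (inv_ne_zero hN₁) (mul_ne_zero (inv_ne_zero hN₂) hD0)) fun x y => ?_
  rw [mul_assoc, mul_assoc, eq_inv_mul_iff_mul_eq₀ hN₁, ← h₁, eq_inv_mul_iff_mul_eq₀ hN₂, ← h₂,
    ← lin_mul]
  congr 1 <;> rw [hD] <;> ring

theorem IsMobius.adjugate {B : RatFunc K} {a b c d : K} (H : IsMobius B a b c d) :
    IsMobius (algebraMap K[X] (RatFunc K) (C d * X + C (-b)) /
      algebraMap K[X] (RatFunc K) (C (-c) * X + C a)) d (-b) (-c) a :=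
  isMobius_div (by have := H.det_ne_zero; convert this using 1; ring)

theorem berkMap_bijective {B : RatFunc K} (hB : ratDegree B = 1) :
    Function.Bijective (berkMap B : BerkovichP1 K → BerkovichP1 K) := by
  obtain ⟨a, b, c, d, H⟩ := exists_isMobius hB
  have h2 := berkMap_mobius_inverse (B' := B) H.adjugate (by simpa using H)
  exact ⟨Function.LeftInverse.injective h2,
    Function.RightInverse.surjective (berkMap_mobius_inverse H H.adjugate)⟩

end Action

/-! ### The topology of the Berkovich projective line -/

section Topology

variable {K : Type} [NormedField K] [IsUltrametricDist K]

theorem continuous_val (g : K[X]) : Continuous fun v : BerkovichLine K => v.1 g :=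
  (continuous_apply g).comp continuous_induced_dom

/-- Stated for a bare function satisfying the seminorm axioms, because the compactness proof applies
it to elements of a product space. -/
theorem BerkovichLine.val_le_sum (v : K[X] → ℝ≥0) (h0 : v 0 = 0)
    (hadd : ∀ p q, v (p + q) ≤ max (v p) (v q)) (hmul : ∀ p q, v (p * q) = v p * v q)
    (h1 : v 1 = 1) (hC : ∀ c, v (C c) = ‖c‖₊) {R : ℝ≥0} (hR : v X ≤ R) (g : K[X]) :
    v g ≤ ∑ i ∈ Finset.range (g.natDegree + 1), ‖g.coeff i‖₊ * R ^ i := by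
  have hpow : ∀ i : ℕ, v (X ^ i) ≤ R ^ i := by
    intro i
    induction i with
    | zero => simp [h1]
    | succ i ih => rw [pow_succ, pow_succ, hmul]; exact mul_le_mul' ih hR
  conv_lhs => rw [g.as_sum_range_C_mul_X_pow]
  induction (Finset.range (g.natDegree + 1)) using Finset.induction_on with
  | empty => simp [h0]
  | insert i s hi ih =>
    rw [Finset.sum_insert hi, Finset.sum_insert hi]
    refine (hadd _ _).trans (max_le ?_ ?_)
    · rw [hmul, hC]
      exact le_add_right (mul_le_mul' le_rfl (hpow i))
    · exact le_add_left ih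

/-- Tychonoff: the axioms of a seminorm are closed conditions in the product over all polynomials,
and the bound on `|X|` confines each coordinate to a compact interval. -/
theorem isCompact_disc (R : ℝ≥0) : IsCompact {v : BerkovichLine K | v.1 X ≤ R} := by
  have hind : IsInducing (fun (v : BerkovichLine K) (g : K[X]) => v.1 g) := ⟨rfl⟩
  rw [hind.isCompact_iff]
  set Z : Set (K[X] → ℝ≥0) := {v | v 0 = 0 ∧ v 1 = 1 ∧ (∀ p q, v (p * q) = v p * v q) ∧
    (∀ p q, v (p + q) ≤ max (v p) (v q)) ∧ (∀ c, v (C c) = ‖c‖₊) ∧ v X ≤ R} with hZ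
  have himg : (fun (v : BerkovichLine K) (g : K[X]) => v.1 g) '' {v | v.1 X ≤ R} = Z := by
    ext φ
    constructor
    · rintro ⟨v, hv, rfl⟩
      exact ⟨map_zero _, map_one _, map_mul _, v.1.map_add, v.map_C, hv⟩
    · rintro ⟨h0, h1, hm, ha, hC, hX⟩
      exact ⟨⟨⟨⟨⟨φ, h0⟩, h1, hm⟩, ha⟩, hC⟩, hX, rfl⟩
  rw [himg]
  have hclosed : IsClosed Z := by
    have e : ∀ g : K[X], Continuous fun v : K[X] → ℝ≥0 => v g := fun g => continuous_apply g
    simp only [hZ, ofPred_and, ofPred_forall]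
    refine (isClosed_eq (e 0) continuous_const).inter ((isClosed_eq (e 1) continuous_const).inter
      (IsClosed.inter ?_ (IsClosed.inter ?_ (IsClosed.inter ?_ (isClosed_le (e X) continuous_const)))))
    · exact isClosed_iInter fun p => isClosed_iInter fun q => isClosed_eq (e _) ((e p).mul (e q))
    · exact isClosed_iInter fun p => isClosed_iInter fun q => isClosed_le (e _) ((e p).max (e q))
    · exact isClosed_iInter fun c => isClosed_eq (e _) continuous_const
  refine (isCompact_univ_pi fun g : K[X] => isCompact_Icc (a := (0 : ℝ≥0))
    (b := ∑ i ∈ Finset.range (g.natDegree + 1), ‖g.coeff i‖₊ * R ^ i)).of_isClosed_subset hclosed ?_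
  rintro v ⟨h0, h1, hm, ha, hC, hX⟩ g -
  exact ⟨zero_le, BerkovichLine.val_le_sum v h0 ha hm h1 hC hX g⟩

theorem lt_val_X_mem_coclosedCompact (R : ℝ≥0) :
    {v : BerkovichLine K | R < v.1 X} ∈ coclosedCompact (BerkovichLine K) := by
  have : {v : BerkovichLine K | R < v.1 X} = {v : BerkovichLine K | v.1 X ≤ R}ᶜ := by
    ext v; simp
  rw [this]
  exact (isCompact_disc R).compl_mem_coclosedCompact_of_isClosed
    (isClosed_le (continuous_val X) continuous_const)

/-- The values of linear forms at `S`, normalized. -/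
def coords (S : BerkovichP1 K) (p : K × K) : ℝ≥0 := lin S p.1 p.2 / size S

/-- Dividing by `size` removes the homogeneous scaling, so the values extend over `∞`: where `|X|`
is large, `size` is `|X|`, and `|aX + b| / |X|` tends to `|a|`. -/
theorem coords_continuous : Continuous (coords : BerkovichP1 K → K × K → ℝ≥0) := by
  rw [continuous_pi_iff]
  rintro ⟨a, b⟩
  rw [continuous_iff_continuousAt]
  intro S
  induction S using OnePoint.rec with
  | coe v =>
    rw [OnePoint.continuousAt_coe]
    refine Continuous.continuousAt ?_
    refine (continuous_val _).div₀ ((continuous_val _).max (continuous_val _)) fun w => ?_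
    exact (size_pos (w : BerkovichP1 K)).ne'
  | infty =>
    rw [OnePoint.continuousAt_infty']
    have h0 : coords (OnePoint.infty : BerkovichP1 K) (a, b) = ‖a‖₊ := by
      simp [coords, size, lin_infty]
    rw [h0]
    have hsz : ∀ v : BerkovichLine K, 1 < v.1 X → size (v : BerkovichP1 K) = v.1 X := by
      intro v hv
      simp [size, lin_coe, hv.le]
    by_cases ha : a = 0
    · subst ha
      rw [nnnorm_zero]
      refine tendsto_order.2 ⟨fun c hc => absurd hc (not_lt.2 zero_le), fun ε hε => ?_⟩
      filter_upwards [lt_val_X_mem_coclosedCompact 1, lt_val_X_mem_coclosedCompact (‖b‖₊ / ε)]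
        with v h1 h2
      simp only [Function.comp_apply, coords, hsz v h1, lin_coe, C_0, zero_mul, zero_add, v.map_C]
      rw [div_lt_iff₀ (lt_trans one_pos h1)]
      rwa [div_lt_iff₀ hε, mul_comm] at h2
    · refine tendsto_nhds_of_eventually_eq ?_
      have ha' : 0 < ‖a‖₊ := by simpa [pos_iff_ne_zero] using ha
      filter_upwards [lt_val_X_mem_coclosedCompact 1, lt_val_X_mem_coclosedCompact (‖b‖₊ / ‖a‖₊)]
        with v h1 h2
      simp only [Function.comp_apply, coords, hsz v h1, lin_coe]
      rw [div_lt_iff₀ ha', mul_comm] at h2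
      rw [Valuation.map_add_eq_of_lt_left, map_mul, v.map_C,
        mul_div_cancel_right₀ _ (lt_trans one_pos h1).ne']
      rw [map_mul, v.map_C, v.map_C]
      exact h2

variable [IsAlgClosed K]

/-- A continuous injection from a compact space to a Hausdorff one; injectivity is the determination
of a point by linear forms up to scaling. -/
theorem coords_isClosedEmbedding : IsClosedEmbedding (coords : BerkovichP1 K → K × K → ℝ≥0) := by
  refine coords_continuous.isClosedEmbedding fun S T h => ?_
  have hT := (size_pos T).ne'
  have hS := (size_pos S).ne'
  refine eq_of_lin_eq_mul (N := size S / size T) (div_ne_zero hS hT) fun a b => ?_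
  have := congrFun h (a, b)
  simp only [coords] at this
  rw [div_eq_div_iff hS hT] at this
  rw [div_mul_eq_mul_div, eq_div_iff hT, this, mul_comm]

theorem isOpen_lin_lt (a b c d : K) : IsOpen {S : BerkovichP1 K | lin S a b < lin S c d} := by
  have : {S : BerkovichP1 K | lin S a b < lin S c d} =
      {S | coords S (a, b) < coords S (c, d)} := by
    ext S
    simp only [mem_ofPred_eq, coords]
    exact (div_lt_div_iff_of_pos_right (size_pos S)).symm
  rw [this]
  have e : ∀ p, Continuous fun S : BerkovichP1 K => coords S p :=
    fun p => (continuous_apply p).comp coords_continuous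
  exact isOpen_lt (e _) (e _)

theorem isOpen_lin_lt_size (a b : K) : IsOpen {S : BerkovichP1 K | lin S a b < size S} := by
  have : {S : BerkovichP1 K | lin S a b < size S} =
      {S | lin S a b < lin S 1 0} ∪ {S | lin S a b < lin S 0 1} := by
    ext S
    simp [size]
  rw [this]
  exact (isOpen_lin_lt _ _ _ _).union (isOpen_lin_lt _ _ _ _)

/-- In the coordinates `coords`, a Möbius map is a quotient of coordinate functions whose
denominator is a nonzero multiple of the size of the image point. -/
theorem continuous_berkMap {B : RatFunc K} (hB : ratDegree B = 1) :
    Continuous (berkMap B : BerkovichP1 K → BerkovichP1 K) := by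
  obtain ⟨a, b, c, d, H⟩ := exists_isMobius hB
  rw [coords_isClosedEmbedding.isInducing.continuous_iff, continuous_pi_iff]
  rintro ⟨x, y⟩
  have e : ∀ p, Continuous fun S : BerkovichP1 K => coords S p :=
    fun p => (continuous_apply p).comp coords_continuous
  have key : ∀ S : BerkovichP1 K, (coords ∘ berkMap B) S (x, y) =
      coords S (x * a + y * c, x * b + y * d) / max (coords S (a, b)) (coords S (c, d)) ∧
      max (coords S (a, b)) (coords S (c, d)) ≠ 0 := by
    intro S
    obtain ⟨N, hN, h⟩ := H.lin_berkMap S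
    have h1 : lin S a b = N * lin (berkMap B S) 1 0 := by simpa using h 1 0
    have h2 : lin S c d = N * lin (berkMap B S) 0 1 := by simpa using h 0 1
    have hS := (size_pos S).ne'
    have h3 : max (coords S (a, b)) (coords S (c, d)) = N * size (berkMap B S) / size S := by
      simp only [coords, h1, h2]
      rw [max_div_div_right (zero_le), ← mul_max_of_nonneg _ _ (zero_le)]
      rfl
    rw [h3]
    refine ⟨?_, div_ne_zero (mul_ne_zero hN (size_pos _).ne') hS⟩
    simp only [Function.comp_apply, coords, h]
    rw [div_div_div_cancel_right₀ hS, mul_div_mul_left _ _ hN]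
  have : (fun S : BerkovichP1 K => (coords ∘ berkMap B) S (x, y)) = fun S =>
      coords S (x * a + y * c, x * b + y * d) / max (coords S (a, b)) (coords S (c, d)) :=
    funext fun S => (key S).1
  rw [this]
  exact (e _).div₀ ((e _).max (e _)) fun S => (key S).2

/-- A Möbius transformation is a homeomorphism of the Berkovich projective line. -/
theorem exists_homeomorph {B : RatFunc K} (hB : ratDegree B = 1) :
    ∃ e : BerkovichP1 K ≃ₜ BerkovichP1 K, ⇑e = berkMap B := by
  obtain ⟨a, b, c, d, H⟩ := exists_isMobius hB
  exact ⟨⟨⟨berkMap B, _, berkMap_mobius_inverse H.adjugate (by simpa using H),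
    berkMap_mobius_inverse H H.adjugate⟩, continuous_berkMap hB,
    continuous_berkMap H.adjugate.ratDegree_eq⟩, rfl⟩

end Topology

/-! ### Connectedness of discs and annuli -/

section Connected

variable {K : Type} [NormedField K] [IsUltrametricDist K]

/-- The maximum of the absolute values of `g` at the points at distance at most `t` from `v`. -/
def thickenVal (v : BerkovichLine K) (t : ℝ≥0) (g : K[X]) : ℝ≥0 :=
  (Finset.range (g.natDegree + 1)).sup fun i => v.1 (hasseDeriv i g) * t ^ i

theorem le_thickenVal (v : BerkovichLine K) (t : ℝ≥0) (g : K[X]) (i : ℕ) :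
    v.1 (hasseDeriv i g) * t ^ i ≤ thickenVal v t g := by
  by_cases hi : i < g.natDegree + 1
  · exact Finset.le_sup (f := fun i => v.1 (hasseDeriv i g) * t ^ i) (Finset.mem_range.2 hi)
  · rw [hasseDeriv_eq_zero_of_lt_natDegree _ _ (by omega)]
    simp

theorem thickenVal_le {v : BerkovichLine K} {t : ℝ≥0} {g : K[X]} {M : ℝ≥0}
    (h : ∀ i, v.1 (hasseDeriv i g) * t ^ i ≤ M) : thickenVal v t g ≤ M :=
  Finset.sup_le fun i _ => h i

theorem exists_eq_thickenVal (v : BerkovichLine K) (t : ℝ≥0) (g : K[X]) :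
    ∃ i, v.1 (hasseDeriv i g) * t ^ i = thickenVal v t g := by
  obtain ⟨i, -, hi⟩ := Finset.exists_mem_eq_sup (Finset.range (g.natDegree + 1)) (by simp)
    fun i => v.1 (hasseDeriv i g) * t ^ i
  exact ⟨i, hi.symm⟩

theorem thickenVal_C_mul (v : BerkovichLine K) (t : ℝ≥0) (c : K) (g : K[X]) :
    thickenVal v t (C c * g) = ‖c‖₊ * thickenVal v t g := by
  have h : ∀ i, v.1 (hasseDeriv i (C c * g)) * t ^ i =
      ‖c‖₊ * (v.1 (hasseDeriv i g) * t ^ i) := by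
    intro i
    rw [← smul_eq_C_mul, map_smul, smul_eq_C_mul, map_mul, v.map_C, mul_assoc]
  refine le_antisymm (thickenVal_le fun i => ?_) ?_
  · rw [h]
    exact mul_le_mul' le_rfl (le_thickenVal v t g i)
  · obtain ⟨i, hi⟩ := exists_eq_thickenVal v t g
    rw [← hi, ← h]
    exact le_thickenVal v t _ i

theorem thickenVal_one (v : BerkovichLine K) (t : ℝ≥0) : thickenVal v t 1 = 1 := by
  simp [thickenVal]

theorem hasseDeriv_X_sub_C_mul_succ (c : K) (g : K[X]) (i : ℕ) :
    hasseDeriv (i + 1) ((X - C c) * g) = (X - C c) * hasseDeriv (i + 1) g + hasseDeriv i g := by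
  have hz : ∀ k, hasseDeriv (k + 2) (X - C c) = 0 := fun k =>
    hasseDeriv_eq_zero_of_lt_natDegree _ _ (by rw [natDegree_X_sub_C]; omega)
  rw [hasseDeriv_mul, Finset.Nat.sum_antidiagonal_succ]
  cases i with
  | zero => simp
  | succ i =>
    rw [Finset.Nat.sum_antidiagonal_succ]
    simp [hz]

/-- This is the argument of Gauss's lemma. By the Leibniz rule, the Taylor coefficient of order `i +
1` of the product is `(X - c) g_{i+1} + g_i`; the lower bound is found at an index where one summand
strictly dominates the other. -/
theorem thickenVal_X_sub_C_mul (v : BerkovichLine K) (t : ℝ≥0) (c : K) (g : K[X]) :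
    thickenVal v t ((X - C c) * g) = max (v.1 (X - C c)) t * thickenVal v t g := by
  set s := v.1 (X - C c) with hs
  set M := thickenVal v t g with hM
  have hle := le_thickenVal v t g
  rw [← hM] at hle
  refine le_antisymm (thickenVal_le fun i => ?_) ?_
  · cases i with
    | zero =>
      have := hle 0
      simp only [hasseDeriv_zero', pow_zero, mul_one, map_mul] at this ⊢
      exact mul_le_mul' (le_max_left _ _) this
    | succ i =>
      rw [hasseDeriv_X_sub_C_mul_succ]
      have h1 : s * v.1 (hasseDeriv (i + 1) g) * t ^ (i + 1) ≤ max s t * M := by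
        rw [mul_assoc]
        exact mul_le_mul' (le_max_left _ _) (hle _)
      have h2 : v.1 (hasseDeriv i g) * t ^ (i + 1) ≤ max s t * M := by
        calc _ = t * (v.1 (hasseDeriv i g) * t ^ i) := by ring
          _ ≤ _ := mul_le_mul' (le_max_right _ _) (hle _)
      have h3 := v.1.map_add ((X - C c) * hasseDeriv (i + 1) g) (hasseDeriv i g)
      rw [map_mul, ← hs] at h3
      refine (mul_le_mul_left h3 _).trans ?_
      rw [max_mul_of_nonneg _ _ (zero_le)]
      exact max_le h1 h2
  · by_cases hM0 : M = 0
    · simp [hM0]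
    obtain ⟨i, hi⟩ := exists_eq_thickenVal v t g
    rw [← hM] at hi
    -- If `s < t`, any index where `g` attains its maximum works: the summand `g_i` dominates in
    -- order `i + 1`.
    rcases lt_or_ge s t with hst | hst
    · rw [max_eq_right hst.le]
      have ht : 0 < t := lt_of_le_of_lt (zero_le) hst
      have h1 : s * v.1 (hasseDeriv (i + 1) g) * t ^ (i + 1) < t * M := by
        rw [mul_assoc]
        exact (mul_le_mul' le_rfl (hle _)).trans_lt
          (mul_lt_mul_of_pos_right hst (pos_iff_ne_zero.2 hM0))
      have h2 : v.1 (hasseDeriv i g) * t ^ (i + 1) = t * M := by rw [← hi]; ring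
      refine le_trans (le_of_eq ?_) (le_thickenVal v t _ (i + 1))
      rw [hasseDeriv_X_sub_C_mul_succ, Valuation.map_add_eq_of_lt_right, h2]
      rw [map_mul, ← hs]
      rw [← h2] at h1
      exact lt_of_mul_lt_mul_right h1 (zero_le)
    · rw [max_eq_left hst]
      classical
      -- If `t ≤ s`, the least maximizing index `j` is needed: the preceding term is then strictly
      -- smaller, so that `(X - c) g_j` dominates in order `j`. For `j = 0` there is no second
      -- summand.
      have hex : ∃ i, v.1 (hasseDeriv i g) * t ^ i = M := ⟨i, hi⟩
      set j := Nat.find hex with hj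
      have hjM : v.1 (hasseDeriv j g) * t ^ j = M := Nat.find_spec hex
      refine le_trans ?_ (le_thickenVal v t _ j)
      rcases Nat.eq_zero_or_eq_succ_pred j with h0 | h0
      · rw [h0] at hjM ⊢
        simp only [hasseDeriv_zero', pow_zero, mul_one, map_mul] at hjM ⊢
        rw [hjM]
      · set k := j.pred
        have hk : v.1 (hasseDeriv k g) * t ^ k < M :=
          lt_of_le_of_ne (hle k) (Nat.find_min hex (by omega))
        rw [h0] at hjM ⊢
        have h2 : s * v.1 (hasseDeriv (k + 1) g) * t ^ (k + 1) = s * M := by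
          rw [mul_assoc, hjM]
        by_cases hs0 : s = 0
        · simp [hs0]
        have h1 : v.1 (hasseDeriv k g) * t ^ (k + 1) < s * M := by
          calc _ = t * (v.1 (hasseDeriv k g) * t ^ k) := by ring
            _ ≤ s * (v.1 (hasseDeriv k g) * t ^ k) := mul_le_mul' hst le_rfl
            _ < s * M := mul_lt_mul_of_pos_left hk (pos_iff_ne_zero.2 hs0)
        refine le_of_eq ?_
        rw [hasseDeriv_X_sub_C_mul_succ, Valuation.map_add_eq_of_lt_left, map_mul, ← hs, h2]
        rw [map_mul, ← hs]
        rw [← h2] at h1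
        exact lt_of_mul_lt_mul_right h1 (zero_le)

theorem thickenVal_X_sub_C (v : BerkovichLine K) (t : ℝ≥0) (c : K) :
    thickenVal v t (X - C c) = max (v.1 (X - C c)) t := by
  simpa [thickenVal_one] using thickenVal_X_sub_C_mul v t c 1

variable [IsAlgClosed K]

/-- Polynomials split, so multiplicativity on linear factors suffices: `key` strips off the roots of
`f`, once in front of `g` and once in front of `1`. -/
theorem thickenVal_mul (v : BerkovichLine K) (t : ℝ≥0) (f g : K[X]) :
    thickenVal v t (f * g) = thickenVal v t f * thickenVal v t g := by
  have key : ∀ (s : Multiset K) (g : K[X]), thickenVal v t ((s.map (X - C ·)).prod * g) =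
      (s.map fun c => max (v.1 (X - C c)) t).prod * thickenVal v t g := by
    intro s
    induction s using Multiset.induction_on with
    | empty => simp
    | cons b s ih =>
      intro g
      simp only [Multiset.map_cons, Multiset.prod_cons]
      rw [mul_assoc, thickenVal_X_sub_C_mul, ih, mul_assoc]
  rw [(IsAlgClosed.splits f).eq_prod_roots, mul_assoc, thickenVal_C_mul, thickenVal_C_mul, key,
    ← mul_one (f.roots.map (X - C ·)).prod, key, thickenVal_one, mul_one, mul_assoc]

/-- The point of the Berkovich line above `v` at distance `t`. -/
def thicken (v : BerkovichLine K) (t : ℝ≥0) : BerkovichLine K where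
  val :=
    { toFun := thickenVal v t
      map_zero' := by simp [thickenVal]
      map_one' := thickenVal_one v t
      map_mul' := thickenVal_mul v t
      map_add_le_max' := fun f g => thickenVal_le fun i => by
        rw [map_add]
        refine (mul_le_mul_left (v.1.map_add _ _) _).trans ?_
        rw [max_mul_of_nonneg _ _ (zero_le)]
        exact max_le_max (le_thickenVal v t f i) (le_thickenVal v t g i) }
  map_C c := by
    change thickenVal v t (C c) = _
    rw [← mul_one (C c), thickenVal_C_mul, thickenVal_one, mul_one]

theorem thicken_X_sub_C (v : BerkovichLine K) (t : ℝ≥0) (c : K) :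
    (thicken v t).1 (X - C c) = max (v.1 (X - C c)) t := thickenVal_X_sub_C v t c

theorem thicken_X (v : BerkovichLine K) (t : ℝ≥0) : (thicken v t).1 X = max (v.1 X) t := by
  simpa using thicken_X_sub_C v t 0

theorem thicken_zero (v : BerkovichLine K) : thicken v 0 = v :=
  BerkovichLine.ext_linear fun c => by simp [thicken_X_sub_C]

theorem continuous_thicken (v : BerkovichLine K) : Continuous (thicken v) := by
  rw [continuous_induced_rng, continuous_pi_iff]
  intro g
  change Continuous fun t => thickenVal v t g
  exact Continuous.finset_sup_apply fun i _ => by fun_prop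

theorem val_linePoint (a : K) (g : K[X]) : (linePoint a).1 g = ‖g.eval a‖₊ := by
  ext
  simp [linePoint]

/-- The point of the Berkovich line corresponding to the closed disc of radius `t` centered at the
origin. -/
def discPoint (t : ℝ≥0) : BerkovichLine K := thicken (linePoint 0) t

theorem discPoint_X_sub_C (t : ℝ≥0) (c : K) :
    (discPoint t : BerkovichLine K).1 (X - C c) = max ‖c‖₊ t := by
  rw [discPoint, thicken_X_sub_C, val_linePoint]
  simp

theorem discPoint_X (t : ℝ≥0) : (discPoint t : BerkovichLine K).1 X = t := by
  simpa using discPoint_X_sub_C (K := K) t 0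

/-- At distance `|X|` the disc around `v` contains the origin, so the path rising from `v` meets the
path of discs centered at the origin. -/
theorem thicken_val_X (v : BerkovichLine K) : thicken v (v.1 X) = discPoint (v.1 X) := by
  refine BerkovichLine.ext_linear fun c => ?_
  rw [thicken_X_sub_C, discPoint_X_sub_C]
  rcases le_or_gt ‖c‖₊ (v.1 X) with h | h
  · rw [max_eq_right h, max_eq_right]
    refine (v.1.map_sub _ _).trans ?_
    rw [v.map_C]
    exact max_le le_rfl h
  · rw [Valuation.map_sub_eq_of_lt_right, v.map_C]
    rwa [v.map_C]

/-- Discs and annuli centered at the origin are connected. -/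
theorem isPreconnected_val_X_mem {I : Set ℝ≥0} (hI : I.OrdConnected) :
    IsPreconnected {v : BerkovichLine K | v.1 X ∈ I} := by
  rcases eq_empty_or_nonempty {v : BerkovichLine K | v.1 X ∈ I} with h | ⟨w, hw⟩
  · rw [h]
    exact isPreconnected_empty
  have hR : IsPreconnected ((discPoint : ℝ≥0 → BerkovichLine K) '' I) :=
    hI.isPreconnected.image _ (continuous_thicken _).continuousOn
  refine isPreconnected_of_forall (discPoint (w.1 X)) fun v hv => ?_
  -- Rise from `v` to the disc of radius `|X|` around the origin, which keeps `|X|` constant, then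
  -- move along the discs centered at the origin with radii in `I`.
  refine ⟨thicken v '' Icc 0 (v.1 X) ∪ discPoint '' I, ?_, ?_, ?_, ?_⟩
  · rintro _ (⟨t, ht, rfl⟩ | ⟨t, ht, rfl⟩)
    · change (thicken v t).1 X ∈ I
      rw [thicken_X, max_eq_left ht.2]
      exact hv
    · change (discPoint t).1 X ∈ I
      rwa [discPoint_X]
  · exact Or.inr ⟨_, hw, rfl⟩
  · exact Or.inl ⟨0, ⟨le_rfl, zero_le⟩, thicken_zero v⟩
  · exact (isPreconnected_Icc.image _ (continuous_thicken v).continuousOn).union (discPoint (v.1 X))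
      ⟨v.1 X, ⟨zero_le, le_rfl⟩, thicken_val_X v⟩ ⟨v.1 X, hv, rfl⟩ hR

/-- For independent linear forms `m = a X + b` and `n = c X + d`, the locus where `|m / n|` lies
in an interval is connected. -/
theorem isPreconnected_lin_div_mem {a b c d : K} (hdet : a * d - b * c ≠ 0) {I : Set ℝ≥0}
    (hI : I.OrdConnected) :
    IsPreconnected {S : BerkovichP1 K | lin S c d ≠ 0 ∧ lin S a b / lin S c d ∈ I} := by
  have H := isMobius_div hdet
  obtain ⟨e, he⟩ := exists_homeomorph H.ratDegree_eq
  -- The Möbius map `m / n` carries the locus to the set `|X| ∈ I` of the affine line; the condition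
  -- `n ≠ 0` removes the preimage of `∞`.
  have : {S : BerkovichP1 K | lin S c d ≠ 0 ∧ lin S a b / lin S c d ∈ I} =
      e ⁻¹' ((↑) '' {v : BerkovichLine K | v.1 X ∈ I}) := by
    ext S
    obtain ⟨N, hN, h⟩ := H.lin_berkMap S
    have h1 := h 1 0
    have h2 := h 0 1
    simp only [one_mul, zero_mul, add_zero, zero_add] at h1 h2
    rw [mem_ofPred_eq, mem_preimage, he, h1, h2]
    generalize berkMap _ S = T
    induction T using OnePoint.rec with
    | infty => simp [lin_infty]
    | coe w =>
      simp only [lin_coe]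
      simp [hN]
  rw [this]
  exact (e.isPreconnected_preimage).2
    ((isPreconnected_val_X_mem hI).image _ OnePoint.continuous_coe.continuousOn)

/-- The locus where the linear form `m` is smaller than `n` is connected. -/
theorem isPreconnected_lin_lt {a b c d : K} (hdet : a * d - b * c ≠ 0) :
    IsPreconnected {S : BerkovichP1 K | lin S a b < lin S c d} := by
  have := isPreconnected_lin_div_mem hdet (ordConnected_Iio (a := (1 : ℝ≥0)))
  convert this using 1
  ext S
  simp only [mem_ofPred_eq, mem_Iio]
  constructor
  · intro h
    have h0 : 0 < lin S c d := lt_of_le_of_lt (zero_le) h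
    exact ⟨h0.ne', (div_lt_one h0).2 h⟩
  · rintro ⟨h0, h⟩
    exact (div_lt_one (pos_iff_ne_zero.2 h0)).1 h

end Connected

/-! ### The Gauss norm -/

section Gauss

variable {K : Type} [NormedField K] [IsUltrametricDist K]

theorem nnnorm_coeff_le_gauss (F : K[X]) (i : ℕ) : ‖F.coeff i‖₊ ≤ gaussValuation K F := by
  have := F.le_gaussNorm (NormedField.toAbsoluteValue K) zero_le_one i
  rw [one_pow, mul_one] at this
  exact this

theorem exists_eq_gauss (F : K[X]) : ∃ i, gaussValuation K F = ‖F.coeff i‖₊ := by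
  obtain ⟨i, hi⟩ := F.exists_eq_gaussNorm (NormedField.toAbsoluteValue K) 1
  refine ⟨i, ?_⟩
  rw [one_pow, mul_one] at hi
  exact NNReal.eq hi

theorem gauss_le_iff (F : K[X]) (r : ℝ≥0) : gaussValuation K F ≤ r ↔ ∀ i, ‖F.coeff i‖₊ ≤ r := by
  refine ⟨fun h i => (nnnorm_coeff_le_gauss F i).trans h, fun h => ?_⟩
  obtain ⟨i, hi⟩ := exists_eq_gauss F
  rw [hi]
  exact h i

theorem gauss_C_mul (c : K) (F : K[X]) :
    gaussValuation K (C c * F) = ‖c‖₊ * gaussValuation K F := by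
  rw [map_mul]
  congr 1
  ext
  exact gaussNorm_C (NormedField.toAbsoluteValue K) 1 c

theorem formVal_gauss (n : ℕ) (F : K[X]) : formVal n (gaussPoint K) F = gaussValuation K F := rfl

theorem lin_gauss (a b : K) : lin (gaussPoint K) a b = max ‖a‖₊ ‖b‖₊ := by
  rw [lin, formVal_gauss]
  refine le_antisymm ((gauss_le_iff _ _).2 fun i => ?_) (max_le ?_ ?_)
  · match i with
    | 0 => simp
    | 1 => simp
    | i + 2 => simp
  · refine le_trans (le_of_eq ?_) (nnnorm_coeff_le_gauss (C a * X + C b) 1)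
    simp
  · refine le_trans (le_of_eq ?_) (nnnorm_coeff_le_gauss (C a * X + C b) 0)
    simp

theorem size_gauss : size (gaussPoint K) = 1 := by simp [size, lin_gauss]

theorem lin_classical_coe (x a b : K) : lin (classical (x : OnePoint K)) a b = ‖a * x + b‖₊ := by
  change (linePoint x).1 _ = _
  ext
  simp [linePoint]

theorem lin_classical_infty (a b : K) :
    lin (classical (OnePoint.infty : OnePoint K)) a b = ‖a‖₊ := lin_infty a b

end Gauss

/-! ### Directions at the Gauss point -/

theorem nnnorm_ofComplex_le (c : ℂ) : ‖ofComplex c‖₊ ≤ 1 := norm_ofComplex_le c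

/-- The coefficients of a linear form on `ℙ¹(ℂ)` which vanishes at `x`. -/
def ell (x : OnePoint ℂ) : ℂ × ℂ := x.elim (0, 1) fun c => (1, -c)

/-- The zero of the linear form `a X + b` on `ℙ¹(ℂ)`. -/
def rootPt (a b : ℂ) : OnePoint ℂ := if a = 0 then OnePoint.infty else ((-b / a : ℂ) : OnePoint ℂ)

theorem exists_smul_ell_rootPt {a b : ℂ} (h : ¬(a = 0 ∧ b = 0)) :
    ∃ u : ℂ, u ≠ 0 ∧ a = u * (ell (rootPt a b)).1 ∧ b = u * (ell (rootPt a b)).2 := by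
  by_cases ha : a = 0
  · refine ⟨b, fun hb => h ⟨ha, hb⟩, ?_, ?_⟩ <;> simp [rootPt, ha, ell]
  · refine ⟨a, ha, ?_, ?_⟩
    · simp [rootPt, ha, ell]
    · simp [rootPt, ha, ell]
      field_simp

theorem ell_ne_zero (x : OnePoint ℂ) : ¬((ell x).1 = 0 ∧ (ell x).2 = 0) := by
  induction x using OnePoint.rec with
  | infty => simp [ell]
  | coe c => simp [ell]

theorem det_ell_ne_zero {x y : OnePoint ℂ} (h : x ≠ y) :
    (ell x).1 * (ell y).2 - (ell x).2 * (ell y).1 ≠ 0 := by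
  induction x using OnePoint.rec with
  | infty =>
    induction y using OnePoint.rec with
    | infty => exact absurd rfl h
    | coe c => simp [ell]
  | coe b =>
    induction y using OnePoint.rec with
    | infty => simp [ell]
    | coe c =>
      have : b ≠ c := fun hbc => h (by rw [hbc])
      simp only [ell, OnePoint.elim_some]
      intro h0
      exact this (by linear_combination h0)

theorem rootPt_mul_ell {u : ℂ} (hu : u ≠ 0) (x : OnePoint ℂ) :
    rootPt (u * (ell x).1) (u * (ell x).2) = x := by
  by_contra hne
  have h0 : ¬(u * (ell x).1 = 0 ∧ u * (ell x).2 = 0) := by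
    simpa [hu] using ell_ne_zero x
  obtain ⟨w, hw, h1, h2⟩ := exists_smul_ell_rootPt h0
  refine mul_ne_zero hw (det_ell_ne_zero hne) ?_
  linear_combination h2 * (ell x).1 - h1 * (ell x).2

/-- The open set of the points of `𝖯¹` whose reduction is `x`. -/
def residueDisc (x : OnePoint ℂ) : Set (BerkovichP1 𝕃) :=
  {S | lin S (ofComplex (ell x).1) (ofComplex (ell x).2) < size S}

theorem lin_lt_size_of_sub {S : BerkovichP1 𝕃} {a b a' b' : 𝕃} (ha : ‖a - a'‖ < 1)
    (hb : ‖b - b'‖ < 1) (h : lin S a' b' < size S) : lin S a b < size S := by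
  have := lin_add_le S (a - a') (b - b') a' b'
  rw [sub_add_cancel, sub_add_cancel] at this
  exact this.trans_lt (max_lt (lin_lt_size S ha hb) h)

theorem lin_ofComplex_mul (S : BerkovichP1 𝕃) {u : ℂ} (hu : u ≠ 0) (a b : ℂ) :
    lin S (ofComplex (u * a)) (ofComplex (u * b)) = lin S (ofComplex a) (ofComplex b) := by
  rw [map_mul, map_mul, lin_mul]
  have : ‖ofComplex u‖₊ = 1 := NNReal.eq (norm_ofComplex hu)
  rw [this, one_mul]

/-- Changing the coefficients by elements of norm less than one changes the value by less than
`size`, so the inequality only sees the reduced form, which is a multiple of `ell` at its root. -/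
theorem lin_lt_size_iff {S : BerkovichP1 𝕃} {a b : 𝕃} (ha : ‖a‖ ≤ 1) (hb : ‖b‖ ≤ 1)
    (h : ¬(residue a = 0 ∧ residue b = 0)) :
    lin S a b < size S ↔ S ∈ residueDisc (rootPt (residue a) (residue b)) := by
  obtain ⟨u, hu, h1, h2⟩ := exists_smul_ell_rootPt h
  have key : S ∈ residueDisc (rootPt (residue a) (residue b)) ↔
      lin S (ofComplex (residue a)) (ofComplex (residue b)) < size S := by
    have := lin_ofComplex_mul S hu (ell (rootPt (residue a) (residue b))).1
      (ell (rootPt (residue a) (residue b))).2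
    rw [← h1, ← h2] at this
    rw [this]
    rfl
  rw [key]
  have ha' := norm_sub_residue_lt ha
  have hb' := norm_sub_residue_lt hb
  exact ⟨lin_lt_size_of_sub (by rwa [norm_sub_rev]) (by rwa [norm_sub_rev]),
    lin_lt_size_of_sub ha' hb'⟩

/-- For `x ≠ y` the forms `ell x` and `ell y` are a basis over `ℂ`, so both coordinate forms would
be smaller than their own maximum. -/
theorem residueDisc_disjoint {S : BerkovichP1 𝕃} {x y : OnePoint ℂ} (hx : S ∈ residueDisc x)
    (hy : S ∈ residueDisc y) : x = y := by
  by_contra hne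
  have hD := det_ell_ne_zero hne
  set D := (ell x).1 * (ell y).2 - (ell x).2 * (ell y).1 with hDdef
  have key : ∀ s t : ℂ, lin S (ofComplex (s * (ell x).1 + t * (ell y).1))
      (ofComplex (s * (ell x).2 + t * (ell y).2)) < size S := by
    intro s t
    rw [map_add, map_add, map_mul, map_mul, map_mul, map_mul]
    refine (lin_add_le _ _ _ _ _).trans_lt (max_lt ?_ ?_)
    · rw [lin_mul]
      exact (mul_le_of_le_one_left (zero_le) (nnnorm_ofComplex_le s)).trans_lt hx
    · rw [lin_mul]
      exact (mul_le_of_le_one_left (zero_le) (nnnorm_ofComplex_le t)).trans_lt hy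
  have h1 := key ((ell y).2 / D) (-(ell x).2 / D)
  have h2 := key (-(ell y).1 / D) ((ell x).1 / D)
  have e1 : (ell y).2 / D * (ell x).1 + -(ell x).2 / D * (ell y).1 = 1 := by
    field_simp
    rw [hDdef]; ring
  have e2 : (ell y).2 / D * (ell x).2 + -(ell x).2 / D * (ell y).2 = 0 := by ring
  have e3 : -(ell y).1 / D * (ell x).1 + (ell x).1 / D * (ell y).1 = 0 := by ring
  have e4 : -(ell y).1 / D * (ell x).2 + (ell x).1 / D * (ell y).2 = 1 := by
    field_simp
    rw [hDdef]; ring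
  rw [e1, e2, map_one, map_zero] at h1
  rw [e3, e4, map_one, map_zero] at h2
  exact absurd (max_lt h1 h2) (lt_irrefl (size S))

theorem gauss_notMem_residueDisc (x : OnePoint ℂ) : gauss ∉ residueDisc x := by
  intro h
  have h' : lin gauss _ _ < size gauss := h
  rw [size_gauss, lin_gauss] at h'
  refine ell_ne_zero x ⟨?_, ?_⟩
  · by_contra h0
    exact absurd ((le_max_left _ _).trans_lt h') (not_lt.2 (norm_ofComplex h0).ge)
  · by_contra h0
    exact absurd ((le_max_right _ _).trans_lt h') (not_lt.2 (norm_ofComplex h0).ge)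

theorem norm_residue_ne_zero {a : 𝕃} (ha : ‖a‖ = 1) : residue a ≠ 0 := fun h =>
  absurd ((residue_eq_zero_iff ha.le).1 h) ha.not_lt

/-- Outside all residue discs every linear form with coefficients of maximal norm one has value
`size S`. By scaling, `S` is then proportional to the Gauss point on all linear forms. -/
theorem exists_mem_residueDisc {S : BerkovichP1 𝕃} (hS : S ≠ gauss) : ∃ x, S ∈ residueDisc x := by
  by_contra! hcon
  refine hS (eq_of_lin_eq_mul (size_pos S).ne' fun a b => ?_)
  rw [lin_gauss]
  have key : ∀ a b : 𝕃, max ‖a‖₊ ‖b‖₊ = 1 → lin S a b = size S := by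
    intro a b hab
    have ha : ‖a‖ ≤ 1 := (le_max_left ‖a‖₊ ‖b‖₊).trans hab.le
    have hb : ‖b‖ ≤ 1 := (le_max_right ‖a‖₊ ‖b‖₊).trans hab.le
    refine le_antisymm (lin_le_size S ha hb) (not_lt.1 fun hlt => ?_)
    refine hcon _ ((lin_lt_size_iff ha hb ?_).1 hlt)
    rintro ⟨h1, h2⟩
    rw [residue_eq_zero_iff ha] at h1
    rw [residue_eq_zero_iff hb] at h2
    exact absurd (max_lt (show ‖a‖₊ < 1 from h1) (show ‖b‖₊ < 1 from h2)) hab.not_lt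
  by_cases h0 : max ‖a‖₊ ‖b‖₊ = 0
  · rw [h0, mul_zero]
    have := lin_le S a b
    rw [h0, zero_mul] at this
    exact le_antisymm this (zero_le)
  · obtain ⟨c, hc⟩ : ∃ c : 𝕃, ‖c‖₊ = max ‖a‖₊ ‖b‖₊ := by
      rcases max_choice ‖a‖₊ ‖b‖₊ with h | h
      · exact ⟨a, h.symm⟩
      · exact ⟨b, h.symm⟩
    have hc0 : c ≠ 0 := by
      rintro rfl
      exact h0 (by rw [← hc, nnnorm_zero])
    have := key (c⁻¹ * a) (c⁻¹ * b) (by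
      rw [nnnorm_mul, nnnorm_mul, ← mul_max_of_nonneg _ _ (zero_le), ← hc, ← nnnorm_mul,
        inv_mul_cancel₀ hc0, nnnorm_one])
    rw [← this, ← hc, mul_comm, ← lin_mul, mul_inv_cancel_left₀ hc0, mul_inv_cancel_left₀ hc0]

theorem isOpen_residueDisc (x : OnePoint ℂ) : IsOpen (residueDisc x) := isOpen_lin_lt_size _ _

theorem mem_residueDisc_coe {S : BerkovichP1 𝕃} {c : ℂ} :
    S ∈ residueDisc (c : OnePoint ℂ) ↔ lin S 1 (-ofComplex c) < lin S 0 1 := by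
  change lin S (ofComplex 1) (ofComplex (-c)) < size S ↔ _
  rw [map_one, map_neg]
  refine ⟨fun h => ?_, fun h => h.trans_le (le_max_right _ _)⟩
  by_contra! hle
  refine absurd h (not_lt.2 (max_le ?_ hle))
  have h1 := lin_add_le S 1 (-ofComplex c) (ofComplex c * 0) (ofComplex c * 1)
  rw [lin_mul, mul_zero, mul_one, add_zero, neg_add_cancel] at h1
  refine h1.trans (max_le le_rfl ?_)
  exact (mul_le_of_le_one_left (zero_le) (nnnorm_ofComplex_le c)).trans hle

theorem mem_residueDisc_infty {S : BerkovichP1 𝕃} :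
    S ∈ residueDisc OnePoint.infty ↔ lin S 0 1 < lin S 1 0 := by
  change lin S (ofComplex 0) (ofComplex 1) < size S ↔ _
  rw [map_one, map_zero]
  simp [size]

theorem isPreconnected_residueDisc (x : OnePoint ℂ) : IsPreconnected (residueDisc x) := by
  induction x using OnePoint.rec with
  | infty =>
    have : residueDisc OnePoint.infty = {S | lin S 0 1 < lin S 1 0} :=
      Set.ext fun S => mem_residueDisc_infty
    rw [this]
    exact isPreconnected_lin_lt (by simp)
  | coe c =>
    have : residueDisc (c : OnePoint ℂ) = {S | lin S 1 (-ofComplex c) < lin S 0 1} :=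
      Set.ext fun S => mem_residueDisc_coe
    rw [this]
    exact isPreconnected_lin_lt (by simp)

/-- The reduction map `ℙ¹(𝕃) → ℙ¹(ℂ)`. -/
def redPt (b : OnePoint 𝕃) : OnePoint ℂ :=
  b.elim OnePoint.infty fun b => if ‖b‖ ≤ 1 then (residue b : OnePoint ℂ) else OnePoint.infty

theorem classical_mem_residueDisc (b : OnePoint 𝕃) : classical b ∈ residueDisc (redPt b) := by
  induction b using OnePoint.rec with
  | infty =>
    change _ ∈ residueDisc OnePoint.infty
    rw [mem_residueDisc_infty, lin_classical_infty, lin_classical_infty]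
    simp
  | coe b =>
    simp only [redPt, OnePoint.elim_some]
    split_ifs with h
    · rw [mem_residueDisc_coe, lin_classical_coe, lin_classical_coe]
      simpa [← sub_eq_add_neg, ← NNReal.coe_lt_coe] using norm_sub_residue_lt h
    · rw [mem_residueDisc_infty, lin_classical_coe, lin_classical_coe]
      simpa [← NNReal.coe_lt_coe] using h

theorem classical_mem_residueDisc_iff {b : OnePoint 𝕃} {x : OnePoint ℂ} :
    classical b ∈ residueDisc x ↔ redPt b = x :=
  ⟨fun h => residueDisc_disjoint (classical_mem_residueDisc b) h,
    fun h => h ▸ classical_mem_residueDisc b⟩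

theorem redPt_map_ofComplex (x : OnePoint ℂ) : redPt (x.map ofComplex) = x := by
  induction x using OnePoint.rec with
  | infty => rfl
  | coe c =>
    change (if ‖ofComplex c‖ ≤ 1 then _ else _) = _
    rw [if_pos (norm_ofComplex_le c), residue_ofComplex]

theorem connectedComponentIn_eq_of_isOpen {X : Type*} [TopologicalSpace X] {F U V : Set X} {p : X}
    (hp : p ∈ U) (hUF : U ⊆ F) (hU : IsOpen U) (hUc : IsPreconnected U) (hV : IsOpen V)
    (hF : F ⊆ U ∪ V) (hUV : Disjoint U V) : connectedComponentIn F p = U := by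
  refine Subset.antisymm ?_ (hUc.subset_connectedComponentIn hp hUF)
  exact isPreconnected_connectedComponentIn.subset_left_of_subset_union hU hV hUV
    ((connectedComponentIn_subset F p).trans hF)
    ⟨p, mem_connectedComponentIn (hUF hp), hp⟩

/-- The residue discs are open, connected and pairwise disjoint, and they cover the complement of
the Gauss point, so they are its components. -/
theorem connectedComponentIn_gauss {S : BerkovichP1 𝕃} {x : OnePoint ℂ} (hS : S ∈ residueDisc x) :
    connectedComponentIn {gauss}ᶜ S = residueDisc x := by
  refine connectedComponentIn_eq_of_isOpen (V := ⋃ y ≠ x, residueDisc y) hS ?_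
    (isOpen_residueDisc x) (isPreconnected_residueDisc x)
    (isOpen_biUnion fun y _ => isOpen_residueDisc y) ?_ ?_
  · rintro T hT rfl
    exact gauss_notMem_residueDisc x hT
  · intro T hT
    obtain ⟨y, hy⟩ := exists_mem_residueDisc hT
    by_cases hyx : y = x
    · exact Or.inl (hyx ▸ hy)
    · exact Or.inr (mem_biUnion (x := y) hyx hy)
  · rw [Set.disjoint_left]
    intro T hT hT'
    simp only [mem_iUnion] at hT'
    obtain ⟨y, hy, hTy⟩ := hT'
    exact hy (residueDisc_disjoint hTy hT)

theorem dir_eq_residueDisc (x : OnePoint ℂ) : dir x = residueDisc x :=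
  connectedComponentIn_gauss (classical_mem_residueDisc_iff.2 (redPt_map_ofComplex x))

theorem residueDisc_nonempty (x : OnePoint ℂ) : (residueDisc x).Nonempty :=
  ⟨_, classical_mem_residueDisc_iff.2 (redPt_map_ofComplex x)⟩

theorem residueDisc_injective : Function.Injective residueDisc := fun x y h => by
  obtain ⟨S, hS⟩ := residueDisc_nonempty x
  exact residueDisc_disjoint hS (h ▸ hS)

theorem dirCoord_residueDisc (x : OnePoint ℂ) : dirCoord (residueDisc x) = x := by
  have : ∃ y, dir y = residueDisc x := ⟨x, dir_eq_residueDisc x⟩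
  have h := Classical.epsilon_spec this
  rw [dir_eq_residueDisc] at h
  exact residueDisc_injective h

theorem thicken_linePoint_one {c : 𝕃} (hc : ‖c‖ ≤ 1) :
    ((thicken (linePoint c) 1 : BerkovichLine 𝕃) : BerkovichP1 𝕃) = gauss := by
  change _ = OnePoint.some _
  congr 1
  refine BerkovichLine.ext_linear fun e => ?_
  have h : lin gauss 1 (-e) = _ := lin_gauss 1 (-e)
  have h' : lin gauss 1 (-e) = gaussValuation 𝕃 (X - C e) := by
    rw [lin, formVal_gauss]
    simp [sub_eq_add_neg]
  rw [h', nnnorm_neg, nnnorm_one] at h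
  change _ = gaussValuation 𝕃 (X - C e)
  rw [thicken_X_sub_C, val_linePoint, h, eval_sub, eval_X, eval_C, max_comm]
  have hc' : ‖c‖₊ ≤ 1 := hc
  rcases le_or_gt ‖e‖₊ 1 with he | he
  · have hce : ‖c - e‖₊ ≤ 1 := (norm_sub_le_max_norm c e).trans (max_le hc he)
    rw [max_eq_left he, max_eq_left hce]
  · congr 1
    have hlt : ‖c‖₊ < ‖e‖₊ := hc'.trans_lt he
    rw [sub_eq_add_neg, IsUltrametricDist.nnnorm_add_eq_max_of_nnnorm_ne_nnnorm, nnnorm_neg,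
      max_eq_right hlt.le]
    rw [nnnorm_neg]
    exact hlt.ne

/-- The Gauss point is the limit of discs around `c` with radius increasing to one, and, in the
direction of `∞`, of discs around `0` with radius decreasing to one. This makes the filters
`𝓝[residueDisc x] gauss` nontrivial, so that a tangent direction is unique. -/
theorem gauss_mem_closure_residueDisc (x : OnePoint ℂ) : gauss ∈ closure (residueDisc x) := by
  have hcont : ∀ c : 𝕃, Continuous fun t : ℝ≥0 =>
      ((thicken (linePoint c) t : BerkovichLine 𝕃) : BerkovichP1 𝕃) := fun c =>
    OnePoint.continuous_coe.comp (continuous_thicken _)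
  induction x using OnePoint.rec with
  | infty =>
    rw [← thicken_linePoint_one (c := 0) (by simp)]
    refine mem_closure_of_tendsto (b := 𝓝[>] (1 : ℝ≥0))
      ((hcont 0).continuousAt.tendsto.mono_left nhdsWithin_le_nhds) ?_
    filter_upwards [self_mem_nhdsWithin] with t ht
    rw [mem_residueDisc_infty, lin_coe, lin_coe]
    simpa [thicken_X, val_linePoint] using ht
  | coe c =>
    rw [← thicken_linePoint_one (norm_ofComplex_le c)]
    have : (𝓝[<] (1 : ℝ≥0)).NeBot := nhdsLT_neBot_of_exists_lt ⟨0, zero_lt_one⟩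
    refine mem_closure_of_tendsto (b := 𝓝[<] (1 : ℝ≥0))
      ((hcont _).continuousAt.tendsto.mono_left nhdsWithin_le_nhds) ?_
    filter_upwards [self_mem_nhdsWithin] with t ht
    rw [mem_residueDisc_coe, lin_coe, lin_coe]
    have := thicken_X_sub_C (linePoint (ofComplex c)) t (ofComplex c)
    rw [val_linePoint] at this
    simp only [eval_sub, eval_X, eval_C, sub_self, nnnorm_zero, zero_max] at this
    simpa [← sub_eq_add_neg, this] using ht

/-! ### Coefficientwise reduction -/

theorem coeff_reducePoly (p : 𝕃[X]) (j : ℕ) : (reducePoly p).coeff j = residue (p.coeff j) := by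
  rw [reducePoly, finsetSum_coeff]
  simp only [coeff_monomial]
  rw [Finset.sum_ite_eq' (Finset.range (p.natDegree + 1)) j]
  split_ifs with h
  · rfl
  · rw [coeff_eq_zero_of_natDegree_lt (by simpa [Nat.lt_succ_iff] using h), residue_zero]

theorem natDegree_reducePoly_le (p : 𝕃[X]) : (reducePoly p).natDegree ≤ p.natDegree := by
  refine natDegree_le_iff_coeff_eq_zero.2 fun j hj => ?_
  rw [coeff_reducePoly, coeff_eq_zero_of_natDegree_lt hj, residue_zero]

theorem norm_coeff_le_one {p : 𝕃[X]} (hp : gaussValuation 𝕃 p ≤ 1) (j : ℕ) : ‖p.coeff j‖ ≤ 1 :=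
  (gauss_le_iff p 1).1 hp j

theorem reducePoly_add {p q : 𝕃[X]} (hp : gaussValuation 𝕃 p ≤ 1) (hq : gaussValuation 𝕃 q ≤ 1) :
    reducePoly (p + q) = reducePoly p + reducePoly q := by
  ext j
  simp only [coeff_reducePoly, coeff_add]
  exact residue_add (norm_coeff_le_one hp j) (norm_coeff_le_one hq j)

theorem reducePoly_mul {p q : 𝕃[X]} (hp : gaussValuation 𝕃 p ≤ 1) (hq : gaussValuation 𝕃 q ≤ 1) :
    reducePoly (p * q) = reducePoly p * reducePoly q := by
  ext j
  simp only [coeff_reducePoly, coeff_mul]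
  rw [(residue_sum _ _ fun x _ => ?_).2]
  · exact Finset.sum_congr rfl fun x _ =>
      residue_mul (norm_coeff_le_one hp _) (norm_coeff_le_one hq _)
  · rw [norm_mul]
    exact mul_le_one₀ (norm_coeff_le_one hp _) (norm_nonneg _) (norm_coeff_le_one hq _)

theorem reducePoly_C_mul {c : 𝕃} {p : 𝕃[X]} (hc : ‖c‖ ≤ 1) (hp : gaussValuation 𝕃 p ≤ 1) :
    reducePoly (C c * p) = C (residue c) * reducePoly p := by
  ext j
  simp only [coeff_reducePoly, coeff_C_mul]
  exact residue_mul hc (norm_coeff_le_one hp j)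

theorem reducePoly_eq_zero_iff {p : 𝕃[X]} (hp : gaussValuation 𝕃 p ≤ 1) :
    reducePoly p = 0 ↔ gaussValuation 𝕃 p < 1 := by
  constructor
  · intro h
    obtain ⟨i, hi⟩ := exists_eq_gauss p
    rw [hi]
    have := coeff_reducePoly p i
    rw [h, coeff_zero] at this
    exact (residue_eq_zero_iff (norm_coeff_le_one hp i)).1 this.symm
  · intro h
    ext j
    rw [coeff_reducePoly, coeff_zero, residue_eq_zero_iff (norm_coeff_le_one hp j)]
    exact (nnnorm_coeff_le_gauss p j).trans_lt h

theorem gauss_X_sub_C (r : 𝕃) : gaussValuation 𝕃 (X - C r) = max 1 ‖r‖₊ := by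
  have h : lin gauss 1 (-r) = _ := lin_gauss 1 (-r)
  rw [lin, formVal_gauss, nnnorm_one, nnnorm_neg] at h
  simpa [sub_eq_add_neg] using h

theorem reducePoly_X_sub_C {r : 𝕃} (hr : ‖r‖ ≤ 1) : reducePoly (X - C r) = X - C (residue r) := by
  ext j
  rw [coeff_reducePoly]
  match j with
  | 0 =>
    simp only [coeff_sub, coeff_X_zero, coeff_C_zero, zero_sub]
    refine residue_eq ?_
    rw [map_neg, ← neg_sub', norm_neg]
    exact norm_sub_residue_lt hr
  | 1 => simp [residue_one]
  | j + 2 => simp [coeff_X, residue_zero]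

theorem reducePoly_inv_mul_X_sub_C {r : 𝕃} (hr : 1 < ‖r‖) :
    reducePoly (C r⁻¹ * (X - C r)) = C (-1) := by
  have hr0 : r ≠ 0 := by
    rintro rfl
    simp at hr
    linarith
  ext j
  rw [coeff_reducePoly, coeff_C_mul]
  match j with
  | 0 =>
    simp only [coeff_sub, coeff_X_zero, coeff_C_zero, zero_sub, mul_neg, inv_mul_cancel₀ hr0]
    exact residue_eq (by simp)
  | 1 =>
    refine residue_eq ?_
    simpa [coeff_one] using inv_lt_one_of_one_lt₀ hr
  | j + 2 => simp [coeff_X, coeff_one, residue_zero]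

/-- An integral root `r` contributes the factor `X - r̃`. For any other root the factor is
normalized by `r⁻¹` and reduces to the constant `-1`. -/
theorem exists_reducePoly_prod (s : Multiset 𝕃) : ∃ u : 𝕃, u ≠ 0 ∧
    gaussValuation 𝕃 (C u * (s.map (X - C ·)).prod) = 1 ∧ ∃ w : ℂ, w ≠ 0 ∧
      reducePoly (C u * (s.map (X - C ·)).prod) =
        C w * (((s.filter (‖·‖ ≤ 1)).map residue).map (X - C ·)).prod := by
  induction s using Multiset.induction_on with
  | empty =>
    refine ⟨1, one_ne_zero, by simp, 1, one_ne_zero, ?_⟩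
    ext j
    simp [coeff_reducePoly, coeff_one]
    split_ifs <;> simp [residue_one, residue_zero]
  | cons b s ih =>
    obtain ⟨u, hu, hg, w, hw, hr⟩ := ih
    by_cases hb : ‖b‖ ≤ 1
    · have e : C u * ((b ::ₘ s).map (X - C ·)).prod = (X - C b) * (C u * (s.map (X - C ·)).prod) := by
        rw [Multiset.map_cons, Multiset.prod_cons]
        ring
      have h1 : gaussValuation 𝕃 (X - C b) = 1 := by
        rw [gauss_X_sub_C]
        exact max_eq_left hb
      refine ⟨u, hu, by rw [e, map_mul, hg, h1, one_mul], w, hw, ?_⟩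
      rw [e, reducePoly_mul h1.le hg.le, hr, reducePoly_X_sub_C hb, Multiset.filter_cons_of_pos (p := fun r : 𝕃 => ‖r‖ ≤ 1) _ hb,
        Multiset.map_cons, Multiset.map_cons, Multiset.prod_cons]
      ring
    · have hb' : 1 < ‖b‖ := not_le.1 hb
      have hb0 : b ≠ 0 := by
        rintro rfl
        simp at hb
      have e : C (u * b⁻¹) * ((b ::ₘ s).map (X - C ·)).prod =
          (C b⁻¹ * (X - C b)) * (C u * (s.map (X - C ·)).prod) := by
        rw [Multiset.map_cons, Multiset.prod_cons, C_mul]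
        ring
      have h1 : gaussValuation 𝕃 (C b⁻¹ * (X - C b)) = 1 := by
        rw [gauss_C_mul, gauss_X_sub_C, max_eq_right (show 1 ≤ ‖b‖₊ from hb'.le), ← nnnorm_mul,
          inv_mul_cancel₀ hb0, nnnorm_one]
      refine ⟨u * b⁻¹, mul_ne_zero hu (inv_ne_zero hb0), by rw [e, map_mul, hg, h1, one_mul],
        -1 * w, mul_ne_zero (by simp) hw, ?_⟩
      rw [e, reducePoly_mul h1.le hg.le, hr, reducePoly_inv_mul_X_sub_C hb',
        Multiset.filter_cons_of_neg (p := fun r : 𝕃 => ‖r‖ ≤ 1) _ hb, C_mul]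
      ring

/-- The reduction of a polynomial of Gauss norm one, in terms of its roots. -/
theorem exists_reducePoly_eq {F : 𝕃[X]} (hF : gaussValuation 𝕃 F = 1) : ∃ w : ℂ, w ≠ 0 ∧
    reducePoly F = C w * (((F.roots.filter (‖·‖ ≤ 1)).map residue).map (X - C ·)).prod := by
  obtain ⟨u, hu, hg, w, hw, hr⟩ := exists_reducePoly_prod F.roots
  have hsp := (IsAlgClosed.splits F).eq_prod_roots
  set G := C u * (F.roots.map (X - C ·)).prod with hG
  have e : F = C (F.leadingCoeff * u⁻¹) * G := by
    rw [hG, ← mul_assoc, ← C_mul, mul_assoc, inv_mul_cancel₀ hu, mul_one]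
    exact hsp
  have hn : ‖F.leadingCoeff * u⁻¹‖ = 1 := by
    have := hF
    rw [e, gauss_C_mul, hg, mul_one] at this
    exact congrArg NNReal.toReal this
  refine ⟨residue (F.leadingCoeff * u⁻¹) * w, mul_ne_zero (norm_residue_ne_zero hn) hw, ?_⟩
  conv_lhs => rw [e]
  rw [reducePoly_C_mul hn.le hg.le, hr, C_mul, mul_assoc]

/-- The number of zeros with reduction `x` of the form of degree `n` with dehomogenization `F`. -/
def zeroCount (n : ℕ) (F : 𝕃[X]) (x : OnePoint ℂ) : ℕ :=
  (if x = OnePoint.infty then n - F.natDegree else 0) +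
    (F.roots.filter fun r : 𝕃 => redPt (r : OnePoint 𝕃) = x).card

theorem redPt_coe_eq_coe {r : 𝕃} {c : ℂ} :
    redPt (r : OnePoint 𝕃) = (c : OnePoint ℂ) ↔ ‖r‖ ≤ 1 ∧ residue r = c := by
  simp only [redPt, OnePoint.elim_some]
  split_ifs with h
  · simp [h]
  · simp [h]

theorem redPt_coe_eq_infty {r : 𝕃} : redPt (r : OnePoint 𝕃) = OnePoint.infty ↔ ¬‖r‖ ≤ 1 := by
  simp only [redPt, OnePoint.elim_some]
  split_ifs with h
  · simp [h]
  · simp [h]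

theorem card_roots_eq (F : 𝕃[X]) : F.roots.card = F.natDegree :=
  (splits_iff_card_roots.1 (IsAlgClosed.splits F))

theorem zeroCount_le {n : ℕ} {F : 𝕃[X]} (hn : F.natDegree ≤ n) (x : OnePoint ℂ) :
    zeroCount n F x ≤ n := by
  have h1 := Multiset.card_le_card
    (Multiset.filter_le (fun r : 𝕃 => redPt (r : OnePoint 𝕃) = x) F.roots)
  rw [card_roots_eq] at h1
  rw [zeroCount]
  split_ifs <;> omega

/-- Roots that are not integral disappear under reduction, and the resulting drop of the degree is
the order at `∞`. -/
theorem formOrder_reducePoly {n : ℕ} {F : 𝕃[X]} (hF : gaussValuation 𝕃 F = 1)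
    (hn : F.natDegree ≤ n) (x : OnePoint ℂ) : formOrder n (reducePoly F) x = zeroCount n F x := by
  obtain ⟨w, hw, hr⟩ := exists_reducePoly_eq hF
  set t := (F.roots.filter (‖·‖ ≤ 1)).map residue with ht
  have hroots : (reducePoly F).roots = t := by
    rw [hr, roots_C_mul _ hw, roots_multiset_prod_X_sub_C]
  have hdeg : (reducePoly F).natDegree = t.card := by
    rw [hr, natDegree_C_mul hw, natDegree_multiset_prod_X_sub_C_eq_card]
  induction x using OnePoint.rec with
  | infty =>
    simp only [formOrder, OnePoint.elim_infty, zeroCount, if_true, redPt_coe_eq_infty]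
    rw [hdeg, ht, Multiset.card_map]
    have h1 := Multiset.card_add (F.roots.filter (‖·‖ ≤ 1)) (F.roots.filter fun r => ¬‖r‖ ≤ 1)
    rw [Multiset.filter_add_not, card_roots_eq] at h1
    omega
  | coe c =>
    simp only [formOrder, OnePoint.elim_some, zeroCount, OnePoint.coe_ne_infty, if_false, zero_add]
    rw [← count_roots, hroots, ht, Multiset.count_map, Multiset.filter_filter]
    congr 1
    refine Multiset.filter_congr fun r _ => ?_
    rw [redPt_coe_eq_coe, and_comm, eq_comm]

theorem finsum_rootMultiplicity (F : 𝕃[X]) (T : Set 𝕃) :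
    ∑ᶠ r ∈ T, F.rootMultiplicity r = (F.roots.filter (· ∈ T)).card := by
  rw [finsum_mem_eq_sum_of_inter_support_eq (t := (F.roots.filter (· ∈ T)).toFinset),
    ← Multiset.toFinset_sum_count_eq]
  · refine Finset.sum_congr rfl fun r hr => ?_
    rw [Multiset.mem_toFinset, Multiset.mem_filter] at hr
    rw [Multiset.count_filter_of_pos hr.2, count_roots]
  · ext r
    simp only [mem_inter_iff, Function.mem_support, Finset.mem_coe, Multiset.mem_toFinset,
      Multiset.mem_filter]
    rw [← count_roots, Multiset.count_ne_zero]
    tauto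

theorem finsum_formOrder (n : ℕ) (F : 𝕃[X]) (x : OnePoint ℂ) :
    ∑ᶠ b ∈ {b : OnePoint 𝕃 | classical b ∈ residueDisc x}, formOrder n F b = zeroCount n F x := by
  have hinj : InjOn ((↑) : 𝕃 → OnePoint 𝕃) {r : 𝕃 | redPt (r : OnePoint 𝕃) = x} :=
    OnePoint.coe_injective.injOn
  have himg : ∑ᶠ b ∈ ((↑) : 𝕃 → OnePoint 𝕃) '' {r : 𝕃 | redPt (r : OnePoint 𝕃) = x},
      formOrder n F b = (F.roots.filter fun r : 𝕃 => redPt (r : OnePoint 𝕃) = x).card := by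
    rw [finsum_mem_image hinj]
    exact finsum_rootMultiplicity F _
  by_cases hx : x = OnePoint.infty
  · have hset : {b : OnePoint 𝕃 | classical b ∈ residueDisc x} = insert OnePoint.infty
        (((↑) : 𝕃 → OnePoint 𝕃) '' {r : 𝕃 | redPt (r : OnePoint 𝕃) = x}) := by
      ext b
      rw [mem_ofPred_eq, classical_mem_residueDisc_iff]
      induction b using OnePoint.rec with
      | infty => simpa [redPt] using hx.symm
      | coe b => simp
    rw [hset, finsum_mem_insert', himg, zeroCount, if_pos hx]
    · rfl
    · rintro ⟨r, -, hr⟩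
      exact OnePoint.coe_ne_infty r hr
    · have hfin : (((↑) : 𝕃 → OnePoint 𝕃) '' (F.roots.toFinset : Set 𝕃)).Finite :=
        (Finset.finite_toSet _).image _
      refine hfin.subset ?_
      rintro _ ⟨⟨r, -, rfl⟩, hr⟩
      refine ⟨r, ?_, rfl⟩
      rw [Finset.mem_coe, Multiset.mem_toFinset, ← Multiset.count_ne_zero, count_roots]
      exact hr
  · have hset : {b : OnePoint 𝕃 | classical b ∈ residueDisc x} =
        (((↑) : 𝕃 → OnePoint 𝕃) '' {r : 𝕃 | redPt (r : OnePoint 𝕃) = x}) := by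
      ext b
      rw [mem_ofPred_eq, classical_mem_residueDisc_iff]
      induction b using OnePoint.rec with
      | infty => simpa [redPt] using fun h => hx h.symm
      | coe b => simp
    rw [hset, himg, zeroCount, if_neg hx, zero_add]

/-! ### Values of forms near the Gauss point -/

/-- The coefficients of the linear form `X - r`, normalized. -/
theorem exists_normalize_linear (b : OnePoint 𝕃) : ∃ u w : 𝕃, ∃ e : ℂ, e ≠ 0 ∧ ‖u‖ ≤ 1 ∧ ‖w‖ ≤ 1 ∧
    residue u = e * (ell (redPt b)).1 ∧ residue w = e * (ell (redPt b)).2 ∧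
    ∃ c : 𝕃, c ≠ 0 ∧ u = c * (b.elim 0 fun _ => 1) ∧ w = c * (b.elim 1 fun r => -r) ∧
      ‖c‖₊ * (b.elim 1 fun r => max 1 ‖r‖₊) = 1 := by
  induction b using OnePoint.rec with
  | infty =>
    refine ⟨0, 1, 1, one_ne_zero, by simp, by simp, ?_, ?_, 1, one_ne_zero, by simp, by simp, by simp⟩
    · simp [redPt, ell, residue_zero]
    · simp [redPt, ell, residue_one]
  | coe r =>
    by_cases hr : ‖r‖ ≤ 1
    · have hred : redPt (r : OnePoint 𝕃) = (residue r : OnePoint ℂ) := redPt_coe_eq_coe.2 ⟨hr, rfl⟩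
      refine ⟨1, -r, 1, one_ne_zero, by simp, by simpa using hr, ?_, ?_, 1, one_ne_zero, by simp,
        by simp, ?_⟩
      · simp [hred, ell, residue_one]
      · rw [hred]
        simp only [ell, OnePoint.elim_some, one_mul]
        refine residue_eq ?_
        rw [map_neg, ← neg_sub', norm_neg]
        exact norm_sub_residue_lt hr
      · rw [nnnorm_one, one_mul, OnePoint.elim_some]
        exact max_eq_left hr
    · have hr' : 1 < ‖r‖ := not_le.1 hr
      have hr0 : r ≠ 0 := by
        rintro rfl
        simp at hr
      have hinv : ‖r⁻¹‖ < 1 := by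
        rw [norm_inv]
        exact inv_lt_one_of_one_lt₀ hr'
      have hred : redPt (r : OnePoint 𝕃) = OnePoint.infty := redPt_coe_eq_infty.2 hr
      refine ⟨r⁻¹, -1, -1, by simp, hinv.le, by simp, ?_, ?_, r⁻¹, inv_ne_zero hr0, by simp, ?_, ?_⟩
      · rw [hred, (residue_eq_zero_iff hinv.le).2 hinv]
        simp [ell]
      · rw [hred]
        simp only [ell, OnePoint.elim_infty, mul_one]
        exact residue_eq (by simp)
      · simp [hr0]
      · rw [OnePoint.elim_some, max_eq_right (show 1 ≤ ‖r‖₊ from hr'.le), ← nnnorm_mul,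
          inv_mul_cancel₀ hr0, nnnorm_one]

/-- The quotient of the two values is continuous in `S` and equals one at the Gauss point. -/
theorem eventually_lt_lin {δ : ℝ≥0} (hδ : δ < 1) (x : OnePoint ℂ) : ∀ᶠ S in 𝓝 gauss,
    δ * size S < lin S (ofComplex (ell x).1) (ofComplex (ell x).2) := by
  have e : Continuous fun S : BerkovichP1 𝕃 => coords S (ofComplex (ell x).1, ofComplex (ell x).2) :=
    (continuous_apply _).comp coords_continuous
  have h1 : coords gauss (ofComplex (ell x).1, ofComplex (ell x).2) = 1 := by
    have := gauss_notMem_residueDisc x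
    have h2 := lin_le_size gauss (norm_ofComplex_le (ell x).1) (norm_ofComplex_le (ell x).2)
    have h3 := le_antisymm h2 (not_lt.1 this)
    rw [coords, h3, div_self (size_pos gauss).ne']
  have h2 : ∀ᶠ S in 𝓝 gauss, δ < coords S (ofComplex (ell x).1, ofComplex (ell x).2) :=
    e.continuousAt.eventually (lt_mem_nhds (hδ.trans_eq h1.symm))
  filter_upwards [h2] with S hS
  rwa [coords, lt_div_iff₀ (size_pos S)] at hS

/-- Near the Gauss point, linear forms take the values predicted by their reductions. -/
theorem eventually_lin_eq (r : 𝕃) (x : OnePoint ℂ) : ∀ᶠ S in 𝓝[residueDisc x] gauss,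
    lin S 1 (-r) = max 1 ‖r‖₊ * (if redPt (r : OnePoint 𝕃) = x then
      lin S (ofComplex (ell x).1) (ofComplex (ell x).2) else size S) := by
  obtain ⟨u, w, e, he, hu, hw, hue, hwe, c, hc, huc, hwc, hcn⟩ :=
    exists_normalize_linear (r : OnePoint 𝕃)
  simp only [OnePoint.elim_some, mul_one] at huc hwc hcn
  have hlin : ∀ S, lin S 1 (-r) = max 1 ‖r‖₊ * lin S u w := by
    intro S
    have : lin S u w = ‖c‖₊ * lin S 1 (-r) := by rw [← lin_mul, huc, hwc, mul_one]
    rw [this, ← mul_assoc, mul_comm _ ‖c‖₊, hcn, one_mul]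
  have hne : ¬(residue u = 0 ∧ residue w = 0) := by
    rw [hue, hwe]
    simpa [he] using ell_ne_zero (redPt (r : OnePoint 𝕃))
  simp only [hlin]
  split_ifs with hx
  -- The difference between the normalized form and its reduction has coefficients of norm at most
  -- some `δ < 1`. Near the Gauss point it is therefore smaller than `ell x`, and the ultrametric
  -- inequality becomes an equality.
  · rw [hx] at hue hwe
    have hδ : max ‖u - ofComplex (residue u)‖₊ ‖w - ofComplex (residue w)‖₊ < 1 :=
      max_lt (norm_sub_residue_lt hu) (norm_sub_residue_lt hw)
    filter_upwards [nhdsWithin_le_nhds (eventually_lt_lin hδ x)] with S hS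
    congr 1
    have h1 := lin_le S (u - ofComplex (residue u)) (w - ofComplex (residue w))
    have h2 : lin S (ofComplex (residue u)) (ofComplex (residue w)) =
        lin S (ofComplex (ell x).1) (ofComplex (ell x).2) := by
      rw [hue, hwe, lin_ofComplex_mul S he]
    have h3 := h1.trans_lt hS
    rw [← h2] at h3 ⊢
    have h4 := lin_add_le S (u - ofComplex (residue u)) (w - ofComplex (residue w))
      (ofComplex (residue u)) (ofComplex (residue w))
    rw [sub_add_cancel, sub_add_cancel, max_eq_right h3.le] at h4
    refine le_antisymm h4 ?_
    have h5 := lin_sub_le S u w (u - ofComplex (residue u)) (w - ofComplex (residue w))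
    rw [sub_sub_cancel, sub_sub_cancel] at h5
    rcases le_max_iff.1 h5 with h | h
    · exact h
    · exact absurd h3 (not_lt.2 h)
  -- A value below `size` would place `S` in the disc of the root as well as in the disc of `x`.
  · filter_upwards [self_mem_nhdsWithin] with S hS
    congr 1
    refine le_antisymm (lin_le_size S hu hw) (not_lt.1 fun hlt => hx ?_)
    have h1 := (lin_lt_size_iff hu hw hne).1 hlt
    rw [hue, hwe, rootPt_mul_ell he] at h1
    exact residueDisc_disjoint h1 hS

theorem eventually_prod_lin_eq (s : Multiset 𝕃) (x : OnePoint ℂ) :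
    ∀ᶠ S in 𝓝[residueDisc x] gauss, (s.map fun r => lin S 1 (-r)).prod =
      gaussValuation 𝕃 (s.map (X - C ·)).prod *
        (lin S (ofComplex (ell x).1) (ofComplex (ell x).2) ^
            (s.filter fun r : 𝕃 => redPt (r : OnePoint 𝕃) = x).card *
          size S ^ (s.card - (s.filter fun r : 𝕃 => redPt (r : OnePoint 𝕃) = x).card)) := by
  induction s using Multiset.induction_on with
  | empty => simp
  | cons r s ih =>
    have hle : (s.filter fun r : 𝕃 => redPt (r : OnePoint 𝕃) = x).card ≤ s.card :=
      Multiset.card_le_card (Multiset.filter_le _ _)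
    filter_upwards [ih, eventually_lin_eq r x] with S h1 h2
    rw [Multiset.map_cons, Multiset.prod_cons, h1, h2, Multiset.map_cons, Multiset.prod_cons,
      map_mul, gauss_X_sub_C]
    split_ifs with hx
    · rw [Multiset.filter_cons_of_pos (p := fun r : 𝕃 => redPt (r : OnePoint 𝕃) = x) _ hx, Multiset.card_cons, Multiset.card_cons,
        Nat.add_sub_add_right]
      ring
    · rw [Multiset.filter_cons_of_neg (p := fun r : 𝕃 => redPt (r : OnePoint 𝕃) = x) _ hx, Multiset.card_cons, Nat.succ_sub hle, pow_succ]
      ring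

/-- Near the Gauss point, in the direction `x`, the value of a form is determined by its Gauss norm
and its number of zeros in this direction. -/
theorem eventually_formVal_eq {n : ℕ} {F : 𝕃[X]} (hn : F.natDegree ≤ n) (x : OnePoint ℂ) :
    ∀ᶠ S in 𝓝[residueDisc x] gauss, formVal n S F = gaussValuation 𝕃 F *
      (lin S (ofComplex (ell x).1) (ofComplex (ell x).2) ^ zeroCount n F x *
        size S ^ (n - zeroCount n F x)) := by
  have hfin : ∀ᶠ S in 𝓝[residueDisc x] gauss, S ∈ range ((↑) : BerkovichLine 𝕃 → BerkovichP1 𝕃) :=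
    nhdsWithin_le_nhds (OnePoint.isOpen_range_coe.mem_nhds ⟨_, rfl⟩)
  filter_upwards [hfin, eventually_prod_lin_eq F.roots x, self_mem_nhdsWithin] with S h1 h2 hS
  obtain ⟨v, rfl⟩ := h1
  have hsp := (IsAlgClosed.splits F).eq_prod_roots
  have hgF : gaussValuation 𝕃 F = ‖F.leadingCoeff‖₊ * gaussValuation 𝕃 (F.roots.map (X - C ·)).prod := by
    conv_lhs => rw [hsp]
    rw [gauss_C_mul]
  have hvF : formVal n (v : BerkovichP1 𝕃) F =
      ‖F.leadingCoeff‖₊ * (F.roots.map fun r => lin (v : BerkovichP1 𝕃) 1 (-r)).prod := by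
    change v.1 F = _
    conv_lhs => rw [hsp]
    rw [map_mul, v.map_C, map_multiset_prod, Multiset.map_map]
    congr 3
    ext1 r
    simp [lin_coe, sub_eq_add_neg]
  rw [hvF, h2, hgF, card_roots_eq, mul_assoc]
  congr 2
  have hle : (F.roots.filter fun r : 𝕃 => redPt (r : OnePoint 𝕃) = x).card ≤ F.natDegree := by
    rw [← card_roots_eq]
    exact Multiset.card_le_card (Multiset.filter_le _ _)
  set k := (F.roots.filter fun r : 𝕃 => redPt (r : OnePoint 𝕃) = x).card
  have h01 : lin (v : BerkovichP1 𝕃) 0 1 = 1 := by simp [lin_coe]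
  -- The form of degree `n` has `n - deg F` extra zeros at `∞`. In the direction of `∞` one has
  -- `|ell x| = 1`, so only the exponent of `size` must be right; in a finite direction `size = 1`,
  -- so only the exponent of `|ell x|` matters.
  by_cases hx : x = OnePoint.infty
  · have hl : lin (v : BerkovichP1 𝕃) (ofComplex (ell x).1) (ofComplex (ell x).2) = 1 := by
      rw [hx]
      simpa [ell] using h01
    rw [hl, one_pow, one_pow, zeroCount, if_pos hx]
    congr 2
    change F.natDegree - k = n - (n - F.natDegree + k)
    omega
  · have hs : size (v : BerkovichP1 𝕃) = 1 := by
      obtain ⟨c, rfl⟩ := OnePoint.ne_infty_iff_exists.1 hx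
      have h3 := mem_residueDisc_coe.1 hS
      have h4 := lin_add_le (v : BerkovichP1 𝕃) 1 (-ofComplex c) (ofComplex c * 0) (ofComplex c * 1)
      rw [lin_mul, mul_zero, mul_one, add_zero, neg_add_cancel] at h4
      rw [size, max_eq_right, h01]
      refine h4.trans (max_le h3.le ?_)
      exact mul_le_of_le_one_left (zero_le) (nnnorm_ofComplex_le c)
    rw [hs, one_pow, one_pow, zeroCount, if_neg hx, zero_add]

/-! ### Orders of binary forms -/

section Forms

variable {F : Type} [Field F]

theorem formOrder_C_mul (n : ℕ) {u : F} (hu : u ≠ 0) (g : F[X]) (x : OnePoint F) :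
    formOrder n (C u * g) x = formOrder n g x := by
  induction x using OnePoint.rec with
  | infty => simp [formOrder, natDegree_C_mul hu]
  | coe a =>
    simp only [formOrder, OnePoint.elim_some]
    rw [← count_roots, ← count_roots, roots_C_mul _ hu]

theorem formOrder_mul {m n : ℕ} {f g : F[X]} (hf : f ≠ 0) (hg : g ≠ 0) (hm : f.natDegree ≤ m)
    (hn : g.natDegree ≤ n) (x : OnePoint F) :
    formOrder (m + n) (f * g) x = formOrder m f x + formOrder n g x := by
  induction x using OnePoint.rec with
  | infty =>
    simp only [formOrder, OnePoint.elim_infty, natDegree_mul hf hg]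
    omega
  | coe a => exact rootMultiplicity_mul (mul_ne_zero hf hg)

/-- A positive order means that the form of the fibre over `y` vanishes at `x`; at `x = ∞` this is a
drop of its degree below `pairDegree`. Coprimality excludes common zeros of `p` and `q`, where
`pairEval` would return `∞` whatever the numerator. -/
theorem fibreMult_pos_iff {p q : F[X]} (hpq : IsCoprime p q) (hd : pairDegree p q ≠ 0)
    (y x : OnePoint F) : 0 < fibreMult p q y x ↔ pairEval p q x = y := by
  have hq : q ≠ 0 := fun h0 => by
    have := eq_zero_of_linear_relation hpq hd (a := 0) (b := 1) (by simp [h0])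
    simp at this
  have hG : ∀ c, p - C c * q ≠ 0 := fun c h0 => by
    have := eq_zero_of_linear_relation hpq hd (a := 1) (b := -c) (by simpa [sub_eq_add_neg] using h0)
    simp at this
  have hGd : ∀ c, (p - C c * q).natDegree ≤ pairDegree p q := fun c => by
    simpa [sub_eq_add_neg] using natDegree_linear_comb_le p q 1 (-c)
  have hlt : ∀ G : F[X], G ≠ 0 → G.natDegree ≤ pairDegree p q →
      (0 < pairDegree p q - G.natDegree ↔ G.coeff (pairDegree p q) = 0) := by
    intro G hG0 hle
    constructor
    · intro h
      exact coeff_eq_zero_of_natDegree_lt (by omega)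
    · intro h
      refine Nat.sub_pos_of_lt (lt_of_le_of_ne hle fun h1 => hG0 ?_)
      rw [← h1] at h
      exact leadingCoeff_eq_zero.1 h
  induction x using OnePoint.rec with
  | infty =>
    set n := pairDegree p q with hn
    have hcases : p.coeff n ≠ 0 ∨ q.coeff n ≠ 0 := by
      by_contra! h
      have h1 := (hlt q hq (le_max_right _ _)).2 h.2
      have h2 := (hlt (p - C 0 * q) (hG 0) (hGd 0)).2 (by simpa using h.1)
      simp only [C_0, zero_mul, sub_zero] at h2
      rw [hn, pairDegree] at h1 h2
      omega
    simp only [pairEval, OnePoint.elim_infty, fibreMult, formOrder, ← hn]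
    induction y using OnePoint.rec with
    | infty =>
      rw [OnePoint.elim_infty, hlt q hq (le_max_right _ _)]
      split_ifs with h
      · simp [h]
      · simp [h]
    | coe c =>
      rw [OnePoint.elim_some, hlt _ (hG c) (hGd c), coeff_sub, coeff_C_mul]
      split_ifs with h
      · simp only [h, mul_zero, sub_zero, OnePoint.infty_ne_coe, iff_false]
        exact hcases.resolve_right (not_not.2 h)
      · rw [OnePoint.coe_eq_coe, div_eq_iff h, sub_eq_zero]
  | coe a =>
    have hcases : p.eval a ≠ 0 ∨ q.eval a ≠ 0 := by
      by_contra! h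
      obtain ⟨r, s, hrs⟩ := hpq
      have := congrArg (eval a) hrs
      simp [h.1, h.2] at this
    simp only [pairEval, OnePoint.elim_some, fibreMult, formOrder]
    induction y using OnePoint.rec with
    | infty =>
      rw [OnePoint.elim_infty, rootMultiplicity_pos hq, IsRoot.def]
      split_ifs with h
      · simp [h]
      · simp [h]
    | coe c =>
      rw [OnePoint.elim_some, rootMultiplicity_pos (hG c), IsRoot.def, eval_sub, eval_mul, eval_C]
      split_ifs with h
      · simp only [h, mul_zero, sub_zero, OnePoint.infty_ne_coe, iff_false]
        exact hcases.resolve_right (not_not.2 h)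
      · rw [OnePoint.coe_eq_coe, div_eq_iff h, sub_eq_zero]

theorem fibreMult_eq_ite {p q : F[X]} (hpq : IsCoprime p q) (hd : pairDegree p q ≠ 0)
    (y x : OnePoint F) :
    fibreMult p q y x = if y = pairEval p q x then localDegree p q x else 0 := by
  split_ifs with h
  · rw [h]
    rfl
  · by_contra h0
    exact h ((fibreMult_pos_iff hpq hd y x).1 (Nat.pos_of_ne_zero h0)).symm

end Forms

theorem fibreMult_eq_ell (p q : ℂ[X]) (y x : OnePoint ℂ) : fibreMult p q y x =
    formOrder (pairDegree p q) (C (ell y).1 * p + C (ell y).2 * q) x := by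
  rw [fibreMult]
  congr 1
  induction y using OnePoint.rec with
  | infty => simp [ell]
  | coe c => simp [ell, sub_eq_add_neg]

/-! ### The reduction of a rational function -/

/-- The normalized numerator of `h`. -/
def normNum (h : RatFunc 𝕃) : 𝕃[X] := C (scaling h) * h.num

/-- The normalized denominator of `h`. -/
def normDenom (h : RatFunc 𝕃) : 𝕃[X] := C (scaling h) * h.denom

/-- The largest norm of a coefficient is the norm of an element `c`, and `c⁻¹` is a legitimate
choice for `scaling`. -/
theorem max_gauss_norm (h : RatFunc 𝕃) :
    max (gaussValuation 𝕃 (normNum h)) (gaussValuation 𝕃 (normDenom h)) = 1 := by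
  have hex : ∃ c : 𝕃, max (gaussValuation 𝕃 (C c * h.num)) (gaussValuation 𝕃 (C c * h.denom)) = 1 := by
    obtain ⟨c, hc⟩ : ∃ c : 𝕃, ‖c‖₊ = max (gaussValuation 𝕃 h.num) (gaussValuation 𝕃 h.denom) := by
      rcases max_choice (gaussValuation 𝕃 h.num) (gaussValuation 𝕃 h.denom) with h1 | h1
      · obtain ⟨i, hi⟩ := exists_eq_gauss h.num
        exact ⟨_, by rw [h1, hi]⟩
      · obtain ⟨i, hi⟩ := exists_eq_gauss h.denom
        exact ⟨_, by rw [h1, hi]⟩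
    have hc0 : c ≠ 0 := by
      rintro rfl
      refine RatFunc.denom_ne_zero h ?_
      ext i
      have h1 := (nnnorm_coeff_le_gauss h.denom i).trans (le_max_right (gaussValuation 𝕃 h.num) _)
      rw [← hc] at h1
      simpa using h1
    refine ⟨c⁻¹, ?_⟩
    rw [gauss_C_mul, gauss_C_mul, ← mul_max_of_nonneg _ _ (zero_le), ← hc, ← nnnorm_mul,
      inv_mul_cancel₀ hc0, nnnorm_one]
  exact Classical.epsilon_spec hex

theorem scaling_ne_zero (h : RatFunc 𝕃) : scaling h ≠ 0 := fun h0 => by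
  have := max_gauss_norm h
  simp [normNum, normDenom, h0] at this

theorem isRep_norm (h : RatFunc 𝕃) : IsRep h (normNum h) (normDenom h) :=
  (isRep_num_denom h).C_mul (scaling_ne_zero h)

theorem gauss_normNum_le (h : RatFunc 𝕃) : gaussValuation 𝕃 (normNum h) ≤ 1 :=
  (le_max_left _ _).trans (max_gauss_norm h).le

theorem gauss_normDenom_le (h : RatFunc 𝕃) : gaussValuation 𝕃 (normDenom h) ≤ 1 :=
  (le_max_right _ _).trans (max_gauss_norm h).le

theorem reducePoly_comb (h : RatFunc 𝕃) {a b : 𝕃} (ha : ‖a‖ ≤ 1) (hb : ‖b‖ ≤ 1) :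
    reducePoly (C a * normNum h + C b * normDenom h) =
      C (residue a) * redNum h + C (residue b) * redDenom h := by
  have e1 : gaussValuation 𝕃 (C a * normNum h) ≤ 1 := by
    rw [gauss_C_mul]
    exact mul_le_one' ha (gauss_normNum_le h)
  have e2 : gaussValuation 𝕃 (C b * normDenom h) ≤ 1 := by
    rw [gauss_C_mul]
    exact mul_le_one' hb (gauss_normDenom_le h)
  rw [reducePoly_add e1 e2, reducePoly_C_mul ha (gauss_normNum_le h),
    reducePoly_C_mul hb (gauss_normDenom_le h)]
  rfl

theorem gauss_comb_le (h : RatFunc 𝕃) {a b : 𝕃} (ha : ‖a‖ ≤ 1) (hb : ‖b‖ ≤ 1) :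
    gaussValuation 𝕃 (C a * normNum h + C b * normDenom h) ≤ 1 := by
  refine ((gaussValuation 𝕃).map_add _ _).trans (max_le ?_ ?_)
  · rw [gauss_C_mul]
    exact mul_le_one' ha (gauss_normNum_le h)
  · rw [gauss_C_mul]
    exact mul_le_one' hb (gauss_normDenom_le h)

theorem redNum_ne_zero_or (h : RatFunc 𝕃) : redNum h ≠ 0 ∨ redDenom h ≠ 0 := by
  by_contra! h0
  have h1 := (reducePoly_eq_zero_iff (gauss_normNum_le h)).1 h0.1
  have h2 := (reducePoly_eq_zero_iff (gauss_normDenom_le h)).1 h0.2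
  exact absurd (max_lt h1 h2) (max_gauss_norm h).not_lt

theorem redGcd_ne_zero (h : RatFunc 𝕃) : redGcd h ≠ 0 := fun h0 => by
  have := EuclideanDomain.gcd_eq_zero_iff.1 h0
  rcases redNum_ne_zero_or h with h1 | h1
  · exact h1 this.1
  · exact h1 this.2

theorem redNum_eq (h : RatFunc 𝕃) : redNum h = redGcd h * phiNum h :=
  (EuclideanDomain.mul_div_cancel' (redGcd_ne_zero h) (EuclideanDomain.gcd_dvd_left _ _)).symm

theorem redDenom_eq (h : RatFunc 𝕃) : redDenom h = redGcd h * phiDenom h :=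
  (EuclideanDomain.mul_div_cancel' (redGcd_ne_zero h) (EuclideanDomain.gcd_dvd_right _ _)).symm

theorem isCoprime_phi (h : RatFunc 𝕃) : IsCoprime (phiNum h) (phiDenom h) := by
  have hg := EuclideanDomain.gcd_eq_gcd_ab (redNum h) (redDenom h)
  refine ⟨EuclideanDomain.gcdA (redNum h) (redDenom h), EuclideanDomain.gcdB (redNum h) (redDenom h), ?_⟩
  refine mul_left_cancel₀ (redGcd_ne_zero h) ?_
  calc _ = (redGcd h * phiNum h) * EuclideanDomain.gcdA (redNum h) (redDenom h) +
        (redGcd h * phiDenom h) * EuclideanDomain.gcdB (redNum h) (redDenom h) := by ring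
    _ = redGcd h * 1 := by
      rw [← redNum_eq, ← redDenom_eq, ← hg, mul_one]
      rfl

theorem pairDegree_red (h : RatFunc 𝕃) : pairDegree (redNum h) (redDenom h) =
    (redGcd h).natDegree + pairDegree (phiNum h) (phiDenom h) := by
  have hH := redGcd_ne_zero h
  have hmul : ∀ p : ℂ[X], p ≠ 0 → (redGcd h * p).natDegree = (redGcd h).natDegree + p.natDegree :=
    fun p hp => natDegree_mul hH hp
  have hle : ∀ p : ℂ[X], (redGcd h * p).natDegree ≤ (redGcd h).natDegree + p.natDegree :=
    fun p => natDegree_mul_le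
  have hcop := isCoprime_phi h
  rw [pairDegree, pairDegree, redNum_eq, redDenom_eq]
  by_cases hp : phiNum h = 0
  · rw [hp] at hcop ⊢
    have h0 := natDegree_eq_zero_of_isUnit (isCoprime_zero_left.1 hcop)
    have h1 := hmul _ (isCoprime_zero_left.1 hcop).ne_zero
    simp [h0, h1]
  by_cases hq : phiDenom h = 0
  · rw [hq] at hcop ⊢
    have h0 := natDegree_eq_zero_of_isUnit (isCoprime_zero_right.1 hcop)
    have h1 := hmul _ hp
    simp [h0, h1]
  rw [hmul _ hp, hmul _ hq]
  omega

theorem pairDegree_red_le (h : RatFunc 𝕃) : pairDegree (redNum h) (redDenom h) ≤ ratDegree h := by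
  rw [(isRep_norm h).ratDegree_eq]
  exact max_le_max (natDegree_reducePoly_le _) (natDegree_reducePoly_le _)

theorem formOrder_red_comb (h : RatFunc 𝕃) {a b : ℂ}
    (hab : C a * phiNum h + C b * phiDenom h ≠ 0) (x : OnePoint ℂ) :
    formOrder (ratDegree h) (C a * redNum h + C b * redDenom h) x = ordH h x +
      formOrder (pairDegree (phiNum h) (phiDenom h)) (C a * phiNum h + C b * phiDenom h) x := by
  have e : C a * redNum h + C b * redDenom h = redGcd h * (C a * phiNum h + C b * phiDenom h) := by
    rw [redNum_eq, redDenom_eq]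
    ring
  have h1 := pairDegree_red h
  have h2 := pairDegree_red_le h
  -- `m` is the degree of `H_h̃` as a binary form: the degree of `redGcd` plus the common zeros at
  -- `∞` that the dehomogenization loses.
  obtain ⟨m, hm⟩ : ∃ m, ratDegree h = m + pairDegree (phiNum h) (phiDenom h) :=
    ⟨ratDegree h - pairDegree (phiNum h) (phiDenom h), by omega⟩
  have hmle : (redGcd h).natDegree ≤ m := by omega
  rw [e, hm, formOrder_mul (redGcd_ne_zero h) hab hmle (natDegree_linear_comb_le _ _ _ _)]
  congr 1
  induction x using OnePoint.rec with
  | infty =>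
    simp only [formOrder, ordH, OnePoint.elim_infty]
    omega
  | coe c => rfl

/-! ### Rational functions fixing the Gauss point -/

section Fix

variable {g : RatFunc 𝕃} (hg : berkMap g gauss = gauss)

include hg

/-- Fixing the Gauss point means that `normNum g` and `normDenom g` are orthonormal for the Gauss
norm; the normalization determines the scalar `N`. Independence of the reductions, and hence
non-constancy of `φ_g̃`, follows. -/
theorem gauss_comb_eq (a b : 𝕃) :
    gaussValuation 𝕃 (C a * normNum g + C b * normDenom g) = max ‖a‖₊ ‖b‖₊ := by
  obtain ⟨N, hN, h⟩ := lin_berkMap (isRep_norm g) gauss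
  simp only [formVal_gauss, hg, lin_gauss] at h
  have h1 := h 1 0
  have h2 := h 0 1
  simp only [C_1, C_0, one_mul, zero_mul, add_zero, zero_add, nnnorm_one, nnnorm_zero,
    max_eq_left (zero_le_one' ℝ≥0), max_eq_right (zero_le_one' ℝ≥0), mul_one] at h1 h2
  have h3 := max_gauss_norm g
  rw [h1, h2, max_self] at h3
  rw [h, h3, one_mul]

theorem eq_zero_of_red_relation {a b : ℂ} (h : C a * redNum g + C b * redDenom g = 0) :
    a = 0 ∧ b = 0 := by
  have h1 := reducePoly_comb g (norm_ofComplex_le a) (norm_ofComplex_le b)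
  rw [residue_ofComplex, residue_ofComplex, h] at h1
  have h2 := (reducePoly_eq_zero_iff
    (gauss_comb_le g (norm_ofComplex_le a) (norm_ofComplex_le b))).1 h1
  rw [gauss_comb_eq hg] at h2
  constructor
  · by_contra h0
    exact absurd ((le_max_left _ _).trans_lt h2) (not_lt.2 (norm_ofComplex h0).ge)
  · by_contra h0
    exact absurd ((le_max_right _ _).trans_lt h2) (not_lt.2 (norm_ofComplex h0).ge)

theorem pairDegree_phi_ne_zero : pairDegree (phiNum g) (phiDenom g) ≠ 0 := by
  intro h0
  have h1 : (phiNum g).natDegree = 0 := by rw [pairDegree] at h0; omega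
  have h2 : (phiDenom g).natDegree = 0 := by rw [pairDegree] at h0; omega
  obtain ⟨a, ha⟩ := natDegree_eq_zero.1 h1
  obtain ⟨b, hb⟩ := natDegree_eq_zero.1 h2
  have h3 := eq_zero_of_red_relation hg (a := b) (b := -a) (by
    rw [redNum_eq, redDenom_eq, ← ha, ← hb, C_neg]
    ring)
  have h4 := isCoprime_phi g
  rw [← ha, ← hb, h3.1, neg_eq_zero.1 h3.2, C_0] at h4
  exact not_isUnit_zero (isCoprime_zero_left.1 h4)

theorem phi_comb_ne_zero {a b : ℂ} (h : ¬(a = 0 ∧ b = 0)) :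
    C a * phiNum g + C b * phiDenom g ≠ 0 := fun h0 =>
  h (eq_zero_of_linear_relation (isCoprime_phi g) (pairDegree_phi_ne_zero hg) h0)

theorem ratDegree_ne_zero_of_fix : ratDegree g ≠ 0 := by
  have h1 := pairDegree_phi_ne_zero hg
  have h2 := pairDegree_red g
  have h3 := pairDegree_red_le g
  omega

/-- The zeros of a form of Gauss norm one in a residue disc are counted by the order of its
reduction, which here is `H_g̃` times a multiple of the form cutting out the fibre of `φ_g̃` over
`y`. -/
theorem zeroCount_comb {a b : 𝕃} {e : ℂ} {y : OnePoint ℂ} (he : e ≠ 0) (ha : ‖a‖ ≤ 1) (hb : ‖b‖ ≤ 1)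
    (hae : residue a = e * (ell y).1) (hbe : residue b = e * (ell y).2) (x : OnePoint ℂ) :
    zeroCount (ratDegree g) (C a * normNum g + C b * normDenom g) x =
      ordH g x + fibreMult (phiNum g) (phiDenom g) y x := by
  have hne : ¬(residue a = 0 ∧ residue b = 0) := by
    rw [hae, hbe]
    simpa [he] using ell_ne_zero y
  have h1 : gaussValuation 𝕃 (C a * normNum g + C b * normDenom g) = 1 := by
    refine le_antisymm (gauss_comb_le g ha hb) (not_lt.1 fun hlt => hne ?_)
    rw [gauss_comb_eq hg] at hlt
    exact ⟨(residue_eq_zero_iff ha).2 ((le_max_left _ _).trans_lt hlt),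
      (residue_eq_zero_iff hb).2 ((le_max_right _ _).trans_lt hlt)⟩
  have h2 : (C a * normNum g + C b * normDenom g).natDegree ≤ ratDegree g := by
    rw [(isRep_norm g).ratDegree_eq]
    exact natDegree_linear_comb_le _ _ _ _
  rw [← formOrder_reducePoly h1 h2, reducePoly_comb g ha hb, formOrder_red_comb g
    (phi_comb_ne_zero hg hne), fibreMult_eq_ell, hae, hbe]
  congr 1
  rw [← formOrder_C_mul _ he (C (ell y).1 * phiNum g + C (ell y).2 * phiDenom g)]
  congr 1
  rw [C_mul, C_mul]
  ring

/-- The preimages of `b` are the zeros of one combination of numerator and denominator, so their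
number in a residue disc depends only on the reduction of `b`. The surplus and the directional
degree are both read off from this formula. -/
theorem preimageCount_eq (x : OnePoint ℂ) (b : OnePoint 𝕃) : preimageCount g (residueDisc x) b =
    ordH g x + fibreMult (phiNum g) (phiDenom g) (redPt b) x := by
  obtain ⟨u, w, e, he, hu, hw, hue, hwe, c, hc, huc, hwc, -⟩ := exists_normalize_linear b
  rw [← zeroCount_comb hg he hu hw hue hwe x, ← finsum_formOrder, preimageCount]
  refine finsum_congr fun z => finsum_congr fun _ => ?_
  rw [fibreMult, ← formOrder_C_mul _ (mul_ne_zero hc (scaling_ne_zero g)), ratDegree]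
  congr 1
  rw [huc, hwc, normNum, normDenom]
  induction b using OnePoint.rec with
  | infty =>
    simp only [OnePoint.elim_infty, mul_zero, C_0, zero_mul, zero_add, mul_one, C_mul]
    ring
  | coe r =>
    simp only [OnePoint.elim_some, mul_one, C_mul, C_neg]
    ring

/-- Compare the pullbacks `F` and `G` of the forms `ell y` and `ell z` for some `z ≠ y`. Both have
Gauss norm one, but `F` has more zeros in the direction `x`, so `|F| < |G|` near the Gauss point in
that direction. -/
theorem eventually_berkMap_mem (x : OnePoint ℂ) :
    ∀ᶠ S in 𝓝[residueDisc x] gauss, berkMap g S ∈ residueDisc (phi g x) := by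
  set y := phi g x with hy
  obtain ⟨z, hz⟩ : ∃ z : OnePoint ℂ, z ≠ y := exists_ne y
  have hcop := isCoprime_phi g
  have hd := pairDegree_phi_ne_zero hg
  have key : ∀ w : OnePoint ℂ, ∃ G : 𝕃[X],
      G = C (ofComplex (ell w).1) * normNum g + C (ofComplex (ell w).2) * normDenom g ∧
      G.natDegree ≤ ratDegree g ∧ gaussValuation 𝕃 G = 1 ∧
      zeroCount (ratDegree g) G x = ordH g x + fibreMult (phiNum g) (phiDenom g) w x := by
    intro w
    refine ⟨_, rfl, ?_, ?_, ?_⟩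
    · rw [(isRep_norm g).ratDegree_eq]
      exact natDegree_linear_comb_le _ _ _ _
    · rw [gauss_comb_eq hg]
      refine le_antisymm (max_le (nnnorm_ofComplex_le _) (nnnorm_ofComplex_le _)) ?_
      by_contra! hlt
      refine ell_ne_zero w ⟨?_, ?_⟩
      · by_contra h0
        exact absurd ((le_max_left _ _).trans_lt hlt) (not_lt.2 (norm_ofComplex h0).ge)
      · by_contra h0
        exact absurd ((le_max_right _ _).trans_lt hlt) (not_lt.2 (norm_ofComplex h0).ge)
    · exact zeroCount_comb hg one_ne_zero (norm_ofComplex_le _) (norm_ofComplex_le _)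
        (by rw [residue_ofComplex, one_mul]) (by rw [residue_ofComplex, one_mul]) x
  obtain ⟨F, hF, hFd, hFg, hFz⟩ := key y
  obtain ⟨G, hG, hGd, hGg, hGz⟩ := key z
  have hpos : 0 < fibreMult (phiNum g) (phiDenom g) y x := (fibreMult_pos_iff hcop hd y x).2 rfl
  have hzero : fibreMult (phiNum g) (phiDenom g) z x = 0 := by
    rw [fibreMult_eq_ite hcop hd, if_neg]
    exact hz
  filter_upwards [eventually_formVal_eq hFd x, eventually_formVal_eq hGd x, self_mem_nhdsWithin,
    nhdsWithin_le_nhds (eventually_lt_lin zero_lt_one x)] with S h1 h2 hS hpS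
  obtain ⟨N, hN, h⟩ := lin_berkMap (isRep_norm g) S
  have hlt : formVal (ratDegree g) S F < formVal (ratDegree g) S G := by
    rw [h1, h2, hFg, hGg, one_mul, one_mul]
    have hle := zeroCount_le hFd x
    set L := lin S (ofComplex (ell x).1) (ofComplex (ell x).2)
    have hL0 : 0 < L := by simpa using hpS
    have hLs : L < size S := hS
    rw [hzero, add_zero] at hGz
    rw [hGz]
    obtain ⟨k, hk⟩ : ∃ k, zeroCount (ratDegree g) F x = ordH g x + (k + 1) :=
      ⟨fibreMult (phiNum g) (phiDenom g) y x - 1, by omega⟩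
    rw [hk] at hle ⊢
    obtain ⟨m, hm⟩ := Nat.exists_eq_add_of_le hle
    have e1 : ratDegree g - (ordH g x + (k + 1)) = m := by omega
    have e2 : ratDegree g - ordH g x = (k + 1) + m := by omega
    rw [e1, e2, pow_add L (ordH g x) (k + 1), pow_add (size S) (k + 1) m, mul_assoc]
    refine mul_lt_mul_of_pos_left ?_ (pow_pos hL0 _)
    exact mul_lt_mul_of_pos_right (pow_lt_pow_left₀ hLs (zero_le) (Nat.succ_ne_zero k))
      (pow_pos (size_pos S) _)
  rw [hF, hG, h, h] at hlt
  exact (lt_of_mul_lt_mul_left hlt (zero_le)).trans_le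
    (lin_le_size _ (norm_ofComplex_le _) (norm_ofComplex_le _))

end Fix

/-! ### Möbius transformations and classical points -/

section Classical

variable {K : Type} [NormedField K] [IsUltrametricDist K]

/-- The coefficients of a linear form which vanishes at `b ∈ ℙ¹(K)`. -/
def vanishingForm (b : OnePoint K) : K × K := b.elim (0, 1) fun r => (1, -r)

theorem lin_classical (b : OnePoint K) (x y : K) :
    lin (classical b) x y = ‖x * (vanishingForm b).2 - y * (vanishingForm b).1‖₊ := by
  induction b using OnePoint.rec with
  | infty => simp [lin_classical_infty, vanishingForm]
  | coe r =>
    rw [lin_classical_coe, ← nnnorm_neg]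
    congr 1
    simp only [vanishingForm, OnePoint.elim_some]
    ring

theorem vanishingForm_ne_zero (b : OnePoint K) :
    ¬((vanishingForm b).1 = 0 ∧ (vanishingForm b).2 = 0) := by
  induction b using OnePoint.rec with
  | infty => simp [vanishingForm]
  | coe r => simp [vanishingForm]

theorem exists_vanishingForm {x y : K} (h : ¬(x = 0 ∧ y = 0)) : ∃ (b : OnePoint K) (t : K), t ≠ 0 ∧
    x = t * (vanishingForm b).1 ∧ y = t * (vanishingForm b).2 := by
  by_cases hx : x = 0
  · exact ⟨OnePoint.infty, y, fun hy => h ⟨hx, hy⟩, by simp [vanishingForm, hx], by simp [vanishingForm]⟩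
  · refine ⟨((-(y / x) : K) : OnePoint K), x, hx, by simp [vanishingForm], ?_⟩
    simp only [vanishingForm, OnePoint.elim_some, neg_neg]
    field_simp

theorem fibreMult_eq_vanishingForm (p q : K[X]) (b x : OnePoint K) : fibreMult p q b x =
    formOrder (pairDegree p q) (C (vanishingForm b).1 * p + C (vanishingForm b).2 * q) x := by
  rw [fibreMult]
  congr 1
  induction b using OnePoint.rec with
  | infty => simp [vanishingForm]
  | coe c => simp [vanishingForm, sub_eq_add_neg]

theorem IsRep.fibreMult_eq {h : RatFunc K} {p q : K[X]} (H : IsRep h p q) (b x : OnePoint K) :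
    fibreMult h.num h.denom b x = fibreMult p q b x := by
  obtain ⟨u, hu, h1, h2⟩ := H
  rw [fibreMult_eq_vanishingForm, fibreMult_eq_vanishingForm, h1, h2, pairDegree_C_mul hu,
    ← formOrder_C_mul _ hu (C _ * p + C _ * q)]
  congr 1
  ring

variable [IsAlgClosed K]

/-- The form vanishing at `z'` must pull back to a multiple of the form vanishing at `z`, so `z'` is
found by applying the adjugate matrix to the latter. The scalar `t` then makes the form of the fibre
of `h` over `z` proportional to that of `B ∘ h` over `z'`. -/
theorem exists_classical_berkMap {B : RatFunc K} {a b c d : K} (H : IsMobius B a b c d)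
    (z : OnePoint K) : ∃ (z' : OnePoint K) (t : K), t ≠ 0 ∧ berkMap B (classical z) = classical z' ∧
      (vanishingForm z').1 * a + (vanishingForm z').2 * c = t * (vanishingForm z).1 ∧
      (vanishingForm z').1 * b + (vanishingForm z').2 * d = t * (vanishingForm z).2 := by
  set D := a * d - b * c with hD
  have hD0 : D ≠ 0 := H.det_ne_zero
  set m := (vanishingForm z).1 with hm
  set n := (vanishingForm z).2 with hn
  have hne : ¬(m * d - n * c = 0 ∧ n * a - m * b = 0) := by
    rintro ⟨h1, h2⟩
    refine vanishingForm_ne_zero z ⟨?_, ?_⟩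
    · have : D * m = 0 := by rw [hD]; linear_combination a * h1 + c * h2
      exact (mul_eq_zero.1 this).resolve_left hD0
    · have : D * n = 0 := by rw [hD]; linear_combination b * h1 + d * h2
      exact (mul_eq_zero.1 this).resolve_left hD0
  obtain ⟨z', s, hs, h1, h2⟩ := exists_vanishingForm hne
  have e1 : (vanishingForm z').1 * a + (vanishingForm z').2 * c = s⁻¹ * D * m := by
    have : s * ((vanishingForm z').1 * a + (vanishingForm z').2 * c) = D * m := by
      rw [hD]; linear_combination -a * h1 - c * h2
    rw [mul_assoc, ← this, inv_mul_cancel_left₀ hs]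
  have e2 : (vanishingForm z').1 * b + (vanishingForm z').2 * d = s⁻¹ * D * n := by
    have : s * ((vanishingForm z').1 * b + (vanishingForm z').2 * d) = D * n := by
      rw [hD]; linear_combination -b * h1 - d * h2
    rw [mul_assoc, ← this, inv_mul_cancel_left₀ hs]
  have ht : s⁻¹ * D ≠ 0 := mul_ne_zero (inv_ne_zero hs) hD0
  refine ⟨z', s⁻¹ * D, ht, ?_, e1, e2⟩
  obtain ⟨N, hN, h⟩ := H.lin_berkMap (classical z)
  have hs' : ‖s‖₊ ≠ 0 := by simpa using hs
  refine eq_of_lin_eq_mul (N := N⁻¹ * ‖s‖₊) (mul_ne_zero (inv_ne_zero hN) hs') fun x y => ?_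
  rw [mul_assoc, eq_inv_mul_iff_mul_eq₀ hN, ← h, lin_classical, lin_classical, ← nnnorm_mul, ← hm,
    ← hn]
  congr 1
  linear_combination x * h2 - y * h1

end Classical

/-! ### Quantized local degrees in terms of reductions -/

theorem preimageCount_ratComp {B h : RatFunc 𝕃} (hB : ratDegree B = 1) (hd : ratDegree h ≠ 0)
    (z : OnePoint 𝕃) : ∃ z' : OnePoint 𝕃, berkMap B (classical z) = classical z' ∧
      ∀ U, preimageCount h U z = preimageCount (ratComp B h) U z' := by
  obtain ⟨a, b, c, d, H⟩ := exists_isMobius hB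
  obtain ⟨z', t, ht, hz', e1, e2⟩ := exists_classical_berkMap H z
  refine ⟨z', hz', fun U => finsum_congr fun x => finsum_congr fun _ => ?_⟩
  rw [(H.comp (isRep_num_denom h) hd).fibreMult_eq, fibreMult_eq_vanishingForm,
    fibreMult_eq_vanishingForm, pairDegree_linear_comb _ _ H.det_ne_zero, ← formOrder_C_mul _ ht]
  congr 1
  have h1 := congrArg (C : 𝕃 → 𝕃[X]) e1
  have h2 := congrArg (C : 𝕃 → 𝕃[X]) e2
  simp only [C_add, C_mul] at h1 h2
  linear_combination -h1 * h.num - h2 * h.denom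

theorem exists_berkMap_classical_mem {B : RatFunc 𝕃} (hB : ratDegree B = 1) (y : OnePoint ℂ) :
    ∃ z : OnePoint 𝕃, berkMap B (classical z) ∈ residueDisc y := by
  obtain ⟨a, b, c, d, H⟩ := exists_isMobius hB
  obtain ⟨z, -, -, hz, -⟩ := exists_classical_berkMap H.adjugate (y.map ofComplex)
  refine ⟨z, ?_⟩
  rw [← hz, berkMap_mobius_inverse H H.adjugate]
  exact classical_mem_residueDisc_iff.2 (redPt_map_ofComplex y)

/-- The components of the complement of a point mapped to the Gauss point by a Möbius
transformation. -/
theorem connectedComponentIn_mobius {B : RatFunc 𝕃} (hB : ratDegree B = 1) {S₀ S : BerkovichP1 𝕃}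
    (hS₀ : berkMap B S₀ = gauss) {y : OnePoint ℂ} (hS : berkMap B S ∈ residueDisc y) :
    connectedComponentIn {S₀}ᶜ S = berkMap B ⁻¹' residueDisc y := by
  obtain ⟨e, he⟩ := exists_homeomorph hB
  have hcont := continuous_berkMap hB
  refine connectedComponentIn_eq_of_isOpen (V := berkMap B ⁻¹' ⋃ z ≠ y, residueDisc z) hS ?_
    ((isOpen_residueDisc y).preimage hcont) ?_
    ((isOpen_biUnion fun z _ => isOpen_residueDisc z).preimage hcont) ?_ ?_
  · rintro T hT rfl
    rw [mem_preimage, hS₀] at hT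
    exact gauss_notMem_residueDisc y hT
  · rw [← he]
    exact e.isPreconnected_preimage.2 (isPreconnected_residueDisc y)
  · intro T hT
    have hne : berkMap B T ≠ gauss := fun h0 =>
      hT ((berkMap_bijective hB).1 (h0.trans hS₀.symm))
    obtain ⟨z, hz⟩ := exists_mem_residueDisc hne
    by_cases hzy : z = y
    · exact Or.inl (hzy ▸ hz)
    · exact Or.inr (mem_biUnion (x := z) hzy hz)
  · rw [Set.disjoint_left]
    intro T hT hT'
    simp only [mem_preimage, mem_iUnion] at hT'
    obtain ⟨z, hz, hTz⟩ := hT'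
    exact hz (residueDisc_disjoint hTz hT)

/-- `B` is a Möbius transformation such that `B ∘ h` fixes the Gauss point. -/
structure Rescales (B h : RatFunc 𝕃) : Prop where
  ratDegree_eq : ratDegree B = 1
  fix : berkMap (ratComp B h) gauss = gauss

namespace Rescales

variable {B h : RatFunc 𝕃} (H : Rescales B h)

include H

theorem ratDegree_ne_zero : ratDegree h ≠ 0 := by
  intro h0
  refine ratDegree_ne_zero_of_fix H.fix ?_
  have h1 : h.num.natDegree = 0 := by rw [ratDegree, pairDegree] at h0; omega
  have h2 : h.denom.natDegree = 0 := by rw [ratDegree, pairDegree] at h0; omega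
  obtain ⟨a, ha⟩ := natDegree_eq_zero.1 h1
  obtain ⟨b, hb⟩ := natDegree_eq_zero.1 h2
  have hc : h = RatFunc.C (a / b) := by
    rw [← RatFunc.num_div_denom h, ← ha, ← hb, RatFunc.algebraMap_C, RatFunc.algebraMap_C, map_div₀]
  have he : ∀ p : 𝕃[X], p.eval₂ RatFunc.C (RatFunc.C (a / b)) = RatFunc.C (p.eval (a / b)) :=
    fun p => (hom_eval₂ p (RingHom.id 𝕃) RatFunc.C (a / b)).symm
  rw [ratComp, RatFunc.eval, hc, he, he, ← map_div₀]
  rw [ratDegree, RatFunc.num_C, RatFunc.denom_C]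
  simp [pairDegree]

theorem berkMap_berkMap (S : BerkovichP1 𝕃) :
    berkMap (ratComp B h) S = berkMap B (berkMap h S) :=
  berkMap_ratComp H.ratDegree_eq H.ratDegree_ne_zero S

theorem berkMap_vertex : berkMap B (berkMap h gauss) = gauss := by
  rw [← H.berkMap_berkMap, H.fix]

theorem dirVia_eq (y : OnePoint ℂ) : dirVia B y = berkMap B ⁻¹' residueDisc y := by
  rw [dirVia, dir_eq_residueDisc]

/-- Near the Gauss point in the direction `x`, the map `B ∘ h` lands in the disc of `φ(x)`, so `h`
lands in its preimage under `B`. No other direction qualifies, since the Gauss point is adherent to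
`residueDisc x`. -/
theorem tangentMap_eq (x : OnePoint ℂ) :
    tangentMap h (residueDisc x) = dirVia B (phi (ratComp B h) x) := by
  rw [H.dirVia_eq]
  have hev := eventually_berkMap_mem H.fix x
  ext T
  constructor
  · rintro ⟨hT, hTev⟩
    have hne : berkMap B T ≠ gauss := fun h0 =>
      hT ((berkMap_bijective H.ratDegree_eq).1 (h0.trans H.berkMap_vertex.symm))
    obtain ⟨z, hz⟩ := exists_mem_residueDisc hne
    rw [connectedComponentIn_mobius H.ratDegree_eq H.berkMap_vertex hz] at hTev
    have : (𝓝[residueDisc x] gauss).NeBot :=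
      mem_closure_iff_nhdsWithin_neBot.1 (gauss_mem_closure_residueDisc x)
    obtain ⟨S, h1, h2⟩ := (hev.and hTev).exists
    rw [H.berkMap_berkMap] at h1
    rw [mem_preimage, residueDisc_disjoint h1 h2]
    exact hz
  · intro hT
    refine ⟨?_, ?_⟩
    · rintro rfl
      rw [mem_preimage, H.berkMap_vertex] at hT
      exact gauss_notMem_residueDisc _ hT
    · rw [connectedComponentIn_mobius H.ratDegree_eq H.berkMap_vertex hT]
      filter_upwards [hev] with S hS
      rwa [H.berkMap_berkMap] at hS

theorem preimageCount_eq_of_notMem {x : OnePoint ℂ} {z : OnePoint 𝕃}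
    (hz : classical z ∉ tangentMap h (residueDisc x)) :
    preimageCount h (residueDisc x) z = ordH (ratComp B h) x := by
  obtain ⟨z', hz', hcount⟩ := preimageCount_ratComp H.ratDegree_eq H.ratDegree_ne_zero z
  rw [H.tangentMap_eq, H.dirVia_eq, mem_preimage, hz', classical_mem_residueDisc_iff] at hz
  rw [phi] at hz
  rw [hcount, preimageCount_eq H.fix, fibreMult_eq_ite (isCoprime_phi _)
    (pairDegree_phi_ne_zero H.fix), if_neg hz, add_zero]

theorem preimageCount_eq_of_mem {x : OnePoint ℂ} {z : OnePoint 𝕃}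
    (hz : classical z ∈ tangentMap h (residueDisc x)) :
    preimageCount h (residueDisc x) z = ordH (ratComp B h) x +
      localDegree (phiNum (ratComp B h)) (phiDenom (ratComp B h)) x := by
  obtain ⟨z', hz', hcount⟩ := preimageCount_ratComp H.ratDegree_eq H.ratDegree_ne_zero z
  rw [H.tangentMap_eq, H.dirVia_eq, mem_preimage, hz', classical_mem_residueDisc_iff] at hz
  rw [phi] at hz
  rw [hcount, preimageCount_eq H.fix, fibreMult_eq_ite (isCoprime_phi _)
    (pairDegree_phi_ne_zero H.fix), if_pos hz]

/-- All points outside the image direction have the same number of preimages, and such points exist,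
so the infimum is taken over a singleton. -/
theorem surplus_eq (x : OnePoint ℂ) : surplus h (residueDisc x) = ordH (ratComp B h) x := by
  have hset : {n | ∃ b : OnePoint 𝕃, classical b ∉ tangentMap h (residueDisc x) ∧
      n = preimageCount h (residueDisc x) b} = {ordH (ratComp B h) x} := by
    ext n
    constructor
    · rintro ⟨b, hb, rfl⟩
      exact H.preimageCount_eq_of_notMem hb
    · rintro rfl
      obtain ⟨y, hy⟩ := exists_ne (phi (ratComp B h) x)
      obtain ⟨z, hz⟩ := exists_berkMap_classical_mem H.ratDegree_eq y
      have hz' : classical z ∉ tangentMap h (residueDisc x) := by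
        rw [H.tangentMap_eq, H.dirVia_eq]
        exact fun h1 => hy (residueDisc_disjoint hz h1)
      exact ⟨z, hz', (H.preimageCount_eq_of_notMem hz').symm⟩
  rw [surplus, hset, csInf_singleton]

theorem rescales_rescaling : Rescales (rescaling h) h := by
  have : ∃ A : RatFunc 𝕃, ratDegree A = 1 ∧ berkMap (ratComp A h) gauss = gauss :=
    ⟨B, H.ratDegree_eq, H.fix⟩
  have h1 := Classical.epsilon_spec this
  exact ⟨h1.1, h1.2⟩

/-- The definition uses the arbitrary choice `rescaling h` in place of `B`. For either one, the
local degree is the number of preimages of a point in the image direction minus the surplus, and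
both numbers are intrinsic to `h`. -/
theorem dirDegree_eq (x : OnePoint ℂ) : dirDegree h (residueDisc x) =
    localDegree (phiNum (ratComp B h)) (phiDenom (ratComp B h)) x := by
  have H' := H.rescales_rescaling
  obtain ⟨z, hz⟩ := exists_berkMap_classical_mem H.ratDegree_eq (phi (ratComp B h) x)
  have hz' : classical z ∈ tangentMap h (residueDisc x) := by
    rw [H.tangentMap_eq, H.dirVia_eq]
    exact hz
  have h1 := H.preimageCount_eq_of_mem hz'
  have h2 := H'.preimageCount_eq_of_mem hz'
  have h3 := H.surplus_eq x
  have h4 := H'.surplus_eq x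
  rw [dirDegree, dirCoord_residueDisc]
  omega

theorem gaussDegree_ne_zero : gaussDegree h ≠ 0 := pairDegree_phi_ne_zero H.rescales_rescaling.fix

end Rescales

/-! ### Möbius transformations fixing the Gauss point -/

section FixMobius

variable {B : RatFunc 𝕃} (hB : ratDegree B = 1) (hfix : berkMap B gauss = gauss)

include hB hfix

/-- Both sides are the component of the complement of the Gauss point through a common point `S`. -/
theorem preimage_residueDisc_phi (x : OnePoint ℂ) :
    berkMap B ⁻¹' residueDisc (phi B x) = residueDisc x := by
  have : (𝓝[residueDisc x] gauss).NeBot :=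
    mem_closure_iff_nhdsWithin_neBot.1 (gauss_mem_closure_residueDisc x)
  obtain ⟨S, h1, h2⟩ := ((eventually_berkMap_mem hfix x).and self_mem_nhdsWithin).exists
  rw [← connectedComponentIn_mobius hB hfix h1, connectedComponentIn_gauss h2]

theorem phi_bijective : Function.Bijective (phi B) := by
  constructor
  · intro x y hxy
    refine residueDisc_injective ?_
    rw [← preimage_residueDisc_phi hB hfix x, hxy, preimage_residueDisc_phi hB hfix]
  · intro y
    obtain ⟨S, hS⟩ := residueDisc_nonempty y
    obtain ⟨T, rfl⟩ := (berkMap_bijective hB).2 S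
    have hT : T ≠ gauss := by
      rintro rfl
      rw [hfix] at hS
      exact gauss_notMem_residueDisc y hS
    obtain ⟨x, hx⟩ := exists_mem_residueDisc hT
    rw [← preimage_residueDisc_phi hB hfix] at hx
    exact ⟨x, residueDisc_disjoint hx hS⟩

/-- The degree of `B` is one, it bounds `deg H_B̃ + deg φ_B̃`, and `φ_B̃` is not constant. -/
theorem degrees_of_fix : (redGcd B).natDegree = 0 ∧ pairDegree (phiNum B) (phiDenom B) = 1 := by
  have h1 := pairDegree_phi_ne_zero hfix
  have h2 := pairDegree_red B
  have h3 := pairDegree_red_le B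
  omega

theorem ordH_eq_zero_of_fix (x : OnePoint ℂ) : ordH B x = 0 := by
  have h1 := degrees_of_fix hB hfix
  induction x using OnePoint.rec with
  | infty =>
    simp only [ordH, OnePoint.elim_infty, pairDegree_red]
    omega
  | coe c =>
    simp only [ordH, OnePoint.elim_some]
    refine Nat.le_zero.1 ?_
    rw [← h1.1, ← count_roots]
    exact (Multiset.count_le_card _ _).trans (card_roots' _)

theorem localDegree_eq_one_of_fix (x : OnePoint ℂ) : localDegree (phiNum B) (phiDenom B) x = 1 := by
  have h1 := (degrees_of_fix hB hfix).2
  have hd := pairDegree_phi_ne_zero hfix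
  refine le_antisymm ?_ ((fibreMult_pos_iff (isCoprime_phi B) hd _ x).2 rfl)
  rw [localDegree, fibreMult_eq_ell, h1]
  have hle := natDegree_linear_comb_le (phiNum B) (phiDenom B)
    (ell (pairEval (phiNum B) (phiDenom B) x)).1 (ell (pairEval (phiNum B) (phiDenom B) x)).2
  rw [h1] at hle
  induction x using OnePoint.rec with
  | infty => exact Nat.sub_le _ _
  | coe c =>
    refine le_trans ?_ hle
    simp only [formOrder, OnePoint.elim_some]
    rw [← count_roots]
    exact (Multiset.count_le_card _ _).trans (card_roots' _)

end FixMobius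

/-! ### Möbius transformations moving the Gauss point -/

/-- An integral basis of linear forms computes the size of a point. -/
theorem size_eq_max_lin {K : Type} [NormedField K] [IsUltrametricDist K] (S : BerkovichP1 K)
    {a b c d : K} (ha : ‖a‖ ≤ 1) (hb : ‖b‖ ≤ 1) (hc : ‖c‖ ≤ 1) (hd : ‖d‖ ≤ 1)
    (hdet : ‖a * d - b * c‖ = 1) : size S = max (lin S a b) (lin S c d) := by
  refine le_antisymm ?_ (max_le (lin_le_size S ha hb) (lin_le_size S hc hd))
  set D := a * d - b * c with hD
  have hD' : ‖D‖₊ = 1 := NNReal.eq hdet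
  have key : ∀ s t : K, ‖s‖ ≤ 1 → ‖t‖ ≤ 1 →
      lin S (s * a + t * c) (s * b + t * d) ≤ max (lin S a b) (lin S c d) := by
    intro s t hs ht
    refine (lin_add_le _ _ _ _ _).trans (max_le_max ?_ ?_)
    · rw [lin_mul]
      exact mul_le_of_le_one_left (zero_le) hs
    · rw [lin_mul]
      exact mul_le_of_le_one_left (zero_le) ht
  refine max_le ?_ ?_
  · have h := key d (-b) hd (by simpa using hb)
    have e : lin S (d * a + -b * c) (d * b + -b * d) = ‖D‖₊ * lin S 1 0 := by
      rw [← lin_mul, hD]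
      congr 1 <;> ring
    rwa [e, hD', one_mul] at h
  · have h := key (-c) a (by simpa using hc) ha
    have e : lin S (-c * a + a * c) (-c * b + a * d) = ‖D‖₊ * lin S 0 1 := by
      rw [← lin_mul, hD]
      congr 1 <;> ring
    rwa [e, hD', one_mul] at h

theorem mul_lin_lt_iff {K : Type} [NormedField K] [IsUltrametricDist K] (S : BerkovichP1 K)
    {s t a b c d : K} (hs : ‖s‖ < 1) (hpos : 0 < lin S a b) :
    lin S (s * a + t * c) (s * b + t * d) < lin S a b ↔ ‖t‖₊ * lin S c d < lin S a b := by
  have hsm : lin S (s * a) (s * b) < lin S a b := by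
    rw [lin_mul]
    exact mul_lt_of_lt_one_left hpos hs
  constructor
  · intro h
    have h1 := lin_sub_le S (s * a + t * c) (s * b + t * d) (s * a) (s * b)
    rw [add_sub_cancel_left, add_sub_cancel_left, lin_mul] at h1
    exact h1.trans_lt (max_lt h hsm)
  · intro h
    refine (lin_add_le _ _ _ _ _).trans_lt (max_lt hsm ?_)
    rwa [lin_mul]

theorem exists_lin_div_eq {a b c d : 𝕃} (hdet : a * d - b * c ≠ 0) (t : ℝ≥0) :
    ∃ S : BerkovichP1 𝕃, lin S c d ≠ 0 ∧ lin S a b / lin S c d = t := by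
  have H := isMobius_div hdet
  obtain ⟨S, hS⟩ := (berkMap_bijective H.ratDegree_eq).2 ((discPoint t : BerkovichLine 𝕃) : BerkovichP1 𝕃)
  obtain ⟨N, hN, h⟩ := H.lin_berkMap S
  have h1 := h 1 0
  have h2 := h 0 1
  simp only [one_mul, zero_mul, add_zero, zero_add, hS, lin_coe] at h1 h2
  simp only [C_0, one_mul, zero_mul, add_zero, zero_add, discPoint_X, map_one, mul_one] at h1 h2
  refine ⟨S, by rwa [h2], ?_⟩
  rw [h1, h2, mul_div_cancel_left₀ _ hN]

/-- If `m` is a primitive linear form and `k` is a linear form of norm less than one, the locus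
`|k| < |m| < 1` is an annulus. -/
theorem isPreconnected_annulus {m₁ m₂ k₁ k₂ : 𝕃} (hm₁ : ‖m₁‖ ≤ 1) (hm₂ : ‖m₂‖ ≤ 1)
    (hm : ¬(residue m₁ = 0 ∧ residue m₂ = 0)) (hk₁ : ‖k₁‖ < 1) (hk₂ : ‖k₂‖ < 1) :
    IsPreconnected {S : BerkovichP1 𝕃 | lin S m₁ m₂ < size S ∧ lin S k₁ k₂ < lin S m₁ m₂} ∧
      {S : BerkovichP1 𝕃 | lin S m₁ m₂ < size S ∧ lin S k₁ k₂ < lin S m₁ m₂}.Nonempty := by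
  -- Some coefficient of `m` is a unit, so a coordinate form completes `m` to an integral basis with
  -- unit determinant.
  obtain ⟨n₁, n₂, hn₁, hn₂, hdet⟩ : ∃ n₁ n₂ : 𝕃, ‖n₁‖ ≤ 1 ∧ ‖n₂‖ ≤ 1 ∧ ‖m₁ * n₂ - m₂ * n₁‖ = 1 := by
    by_cases h1 : residue m₁ = 0
    · have h2 : residue m₂ ≠ 0 := fun h2 => hm ⟨h1, h2⟩
      rw [Ne, residue_eq_zero_iff hm₂, not_lt] at h2
      exact ⟨1, 0, by simp, by simp, by simpa using le_antisymm hm₂ h2⟩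
    · rw [residue_eq_zero_iff hm₁, not_lt] at h1
      exact ⟨0, 1, by simp, by simp, by simpa using le_antisymm hm₁ h1⟩
  set D := m₁ * n₂ - m₂ * n₁ with hD
  have hD0 : D ≠ 0 := by
    intro h0
    rw [h0, norm_zero] at hdet
    exact zero_ne_one hdet
  set s := D⁻¹ * (k₁ * n₂ - k₂ * n₁) with hs
  set t := D⁻¹ * (m₁ * k₂ - m₂ * k₁) with ht
  have hlt : ∀ {p q u w : 𝕃}, ‖p‖ < 1 → ‖u‖ < 1 → ‖q‖ ≤ 1 → ‖w‖ ≤ 1 → ‖D⁻¹ * (p * q - u * w)‖ < 1 := by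
    intro p q u w hp hu hq hw
    rw [norm_mul, norm_inv, hdet, inv_one, one_mul]
    refine (norm_sub_le_max_norm _ _).trans_lt (max_lt ?_ ?_)
    · rw [norm_mul]
      exact mul_lt_one_of_nonneg_of_lt_one_left (norm_nonneg _) hp hq
    · rw [norm_mul]
      exact mul_lt_one_of_nonneg_of_lt_one_left (norm_nonneg _) hu hw
  have hs1 : ‖s‖ < 1 := hlt hk₁ hk₂ hn₂ hn₁
  have ht1 : ‖t‖ < 1 := by
    have := hlt hk₂ hk₁ hm₁ hm₂
    rwa [mul_comm k₂, mul_comm k₁] at this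
  have e1 : k₁ = s * m₁ + t * n₁ := by
    rw [hs, ht]
    field_simp
    rw [hD]
    ring
  have e2 : k₂ = s * m₂ + t * n₂ := by
    rw [hs, ht]
    field_simp
    rw [hD]
    ring
  -- By Cramer's rule `k = s m + t n` with `|s|, |t| < 1`. The term `s m` is always smaller than
  -- `m`, so in the coordinate `m / n` the locus is the annulus `|t| < |m / n| < 1`.
  have hset : {S : BerkovichP1 𝕃 | lin S m₁ m₂ < size S ∧ lin S k₁ k₂ < lin S m₁ m₂} =
      {S | lin S n₁ n₂ ≠ 0 ∧ lin S m₁ m₂ / lin S n₁ n₂ ∈ Ioo ‖t‖₊ 1} := by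
    ext S
    simp only [mem_ofPred_eq, mem_Ioo]
    rw [size_eq_max_lin S hm₁ hm₂ hn₁ hn₂ hdet]
    have hiff : lin S m₁ m₂ < max (lin S m₁ m₂) (lin S n₁ n₂) ↔ lin S m₁ m₂ < lin S n₁ n₂ := by simp
    rw [hiff, e1, e2]
    constructor
    · rintro ⟨h1, h2⟩
      have hn : 0 < lin S n₁ n₂ := lt_of_le_of_lt (zero_le) h1
      have hmp : 0 < lin S m₁ m₂ := lt_of_le_of_lt (zero_le) h2
      refine ⟨hn.ne', ?_, (div_lt_one hn).2 h1⟩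
      rw [lt_div_iff₀ hn]
      exact (mul_lin_lt_iff S hs1 hmp).1 h2
    · rintro ⟨h0, h1, h2⟩
      have hn : 0 < lin S n₁ n₂ := pos_iff_ne_zero.2 h0
      rw [div_lt_one hn] at h2
      rw [lt_div_iff₀ hn] at h1
      exact ⟨h2, (mul_lin_lt_iff S hs1 (lt_of_le_of_lt (zero_le) h1)).2 h1⟩
  rw [hset]
  refine ⟨isPreconnected_lin_div_mem hD0 ordConnected_Ioo, ?_⟩
  obtain ⟨r, hr⟩ := exists_between (show ‖t‖₊ < 1 from ht1)
  obtain ⟨S, h1, h2⟩ := exists_lin_div_eq hD0 r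
  exact ⟨S, h1, by rw [h2]; exact hr⟩

theorem exists_isMobius_norm {B : RatFunc 𝕃} (hB : ratDegree B = 1) : ∃ a b c d,
    IsMobius B a b c d ∧ normNum B = C a * X + C b ∧ normDenom B = C c * X + C d := by
  obtain ⟨a, b, c, d, H⟩ := exists_isMobius hB
  obtain ⟨u, hu, h1, h2⟩ := H.isRep
  set t := scaling B * u with ht
  have ht0 : t ≠ 0 := mul_ne_zero (scaling_ne_zero B) hu
  have e1 : normNum B = C (t * a) * X + C (t * b) := by
    rw [normNum, h1, ht]
    simp only [C_mul]
    ring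
  have e2 : normDenom B = C (t * c) * X + C (t * d) := by
    rw [normDenom, h2, ht]
    simp only [C_mul]
    ring
  refine ⟨t * a, t * b, t * c, t * d, ⟨?_, ?_⟩, e1, e2⟩
  · rw [← e1, ← e2]
    exact isRep_norm B
  · have : t * a * (t * d) - t * b * (t * c) = t * t * (a * d - b * c) := by ring
    rw [this]
    exact mul_ne_zero (mul_ne_zero ht0 ht0) H.det_ne_zero

/-- Converse of `eq_zero_of_red_relation`: if the reductions are independent, a combination with
coefficients of maximal norm one cannot have Gauss norm below one, so the image takes the values of
the Gauss point on linear forms, up to a scalar. -/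
theorem berkMap_gauss_of_indep {g : RatFunc 𝕃}
    (h : ∀ a b : ℂ, C a * redNum g + C b * redDenom g = 0 → a = 0 ∧ b = 0) :
    berkMap g gauss = gauss := by
  have key : ∀ a b : 𝕃, max ‖a‖₊ ‖b‖₊ = 1 →
      gaussValuation 𝕃 (C a * normNum g + C b * normDenom g) = 1 := by
    intro a b hab
    have ha : ‖a‖ ≤ 1 := (le_max_left ‖a‖₊ ‖b‖₊).trans hab.le
    have hb : ‖b‖ ≤ 1 := (le_max_right ‖a‖₊ ‖b‖₊).trans hab.le
    refine le_antisymm (gauss_comb_le g ha hb) (not_lt.1 fun hlt => ?_)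
    have h1 := (reducePoly_eq_zero_iff (gauss_comb_le g ha hb)).2 hlt
    rw [reducePoly_comb g ha hb] at h1
    have h2 := h _ _ h1
    rw [residue_eq_zero_iff ha, residue_eq_zero_iff hb] at h2
    exact absurd (max_lt (show ‖a‖₊ < 1 from h2.1) (show ‖b‖₊ < 1 from h2.2)) hab.not_lt
  obtain ⟨N, hN, hlin⟩ := lin_berkMap (isRep_norm g) gauss
  refine eq_of_lin_eq_mul (N := N⁻¹) (inv_ne_zero hN) fun a b => ?_
  rw [eq_inv_mul_iff_mul_eq₀ hN, ← hlin, formVal_gauss, lin_gauss]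
  by_cases h0 : max ‖a‖₊ ‖b‖₊ = 0
  · have ha : a = 0 := by simpa using (le_max_left ‖a‖₊ ‖b‖₊).trans h0.le
    have hb : b = 0 := by simpa using (le_max_right ‖a‖₊ ‖b‖₊).trans h0.le
    simp [ha, hb]
  · obtain ⟨c, hc⟩ : ∃ c : 𝕃, ‖c‖₊ = max ‖a‖₊ ‖b‖₊ := by
      rcases max_choice ‖a‖₊ ‖b‖₊ with h | h
      · exact ⟨a, h.symm⟩
      · exact ⟨b, h.symm⟩
    have hc0 : c ≠ 0 := by
      rintro rfl
      exact h0 (by rw [← hc, nnnorm_zero])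
    have h1 := key (c⁻¹ * a) (c⁻¹ * b) (by
      rw [nnnorm_mul, nnnorm_mul, ← mul_max_of_nonneg _ _ (zero_le), ← hc, ← nnnorm_mul,
        inv_mul_cancel₀ hc0, nnnorm_one])
    have e : C a * normNum g + C b * normDenom g =
        C c * (C (c⁻¹ * a) * normNum g + C (c⁻¹ * b) * normDenom g) := by
      rw [mul_add, ← mul_assoc, ← mul_assoc, ← C_mul, ← C_mul, mul_inv_cancel_left₀ hc0,
        mul_inv_cancel_left₀ hc0]
    rw [e, gauss_C_mul, h1, mul_one, hc]

/-- The reduction of a Möbius transformation moving the Gauss point is degenerate. -/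
theorem exists_degenerate_reduction {B : RatFunc 𝕃} (hB : ratDegree B = 1)
    (hne : berkMap B gauss ≠ gauss) : ∃ (x y : OnePoint ℂ) (u₁ u₂ : ℂ), ¬(u₁ = 0 ∧ u₂ = 0) ∧
      (ell y).1 * u₁ + (ell y).2 * u₂ = 0 ∧
      redNum B = C u₁ * (C (ell x).1 * X + C (ell x).2) ∧
      redDenom B = C u₂ * (C (ell x).1 * X + C (ell x).2) := by
  -- The two reductions are dependent by `berkMap_gauss_of_indep`, hence multiples `u₁ L`, `u₂ L` of
  -- one linear form `L`. The root of `L` is `x`, and `y` is the ratio `u₁ / u₂`.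
  obtain ⟨s, t, hst, hst0⟩ : ∃ s t : ℂ, C s * redNum B + C t * redDenom B = 0 ∧ ¬(s = 0 ∧ t = 0) := by
    by_contra! hcon
    exact hne (berkMap_gauss_of_indep hcon)
  have hlin : ∀ p : ℂ[X], p ≠ 0 → p.natDegree ≤ 1 → ∃ (x : OnePoint ℂ) (u : ℂ), u ≠ 0 ∧
      p = C u * (C (ell x).1 * X + C (ell x).2) := by
    intro p hp hdeg
    obtain ⟨a, b, rfl⟩ := exists_eq_X_add_C_of_natDegree_le_one hdeg
    have hab : ¬(a = 0 ∧ b = 0) := by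
      rintro ⟨rfl, rfl⟩
      simp at hp
    obtain ⟨u, hu, h1, h2⟩ := exists_smul_ell_rootPt hab
    refine ⟨rootPt a b, u, hu, ?_⟩
    rw [mul_add, ← mul_assoc, ← C_mul, ← C_mul, ← h1, ← h2]
  have hdeg := pairDegree_red_le B
  rw [hB] at hdeg
  have hdN : (redNum B).natDegree ≤ 1 := (le_max_left _ _).trans hdeg
  have hdD : (redDenom B).natDegree ≤ 1 := (le_max_right _ _).trans hdeg
  by_cases hs : s = 0
  · have ht : t ≠ 0 := fun ht => hst0 ⟨hs, ht⟩
    have hD : redDenom B = 0 := by simpa [hs, ht] using hst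
    have hN : redNum B ≠ 0 := (redNum_ne_zero_or B).resolve_right (not_not.2 hD)
    obtain ⟨x, u, hu, hx⟩ := hlin _ hN hdN
    exact ⟨x, OnePoint.infty, u, 0, by simp [hu], by simp [ell], hx, by simp [hD]⟩
  · have hN : redNum B = C (-(t / s)) * redDenom B := by
      have h1 : C s⁻¹ * (C s * redNum B + C t * redDenom B) = 0 := by rw [hst, mul_zero]
      rw [mul_add, ← mul_assoc, ← mul_assoc, ← C_mul, ← C_mul, inv_mul_cancel₀ hs, C_1, one_mul] at h1
      rw [eq_neg_of_add_eq_zero_left h1, div_eq_inv_mul, C_neg, neg_mul]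
    have hD : redDenom B ≠ 0 := by
      intro h0
      rcases redNum_ne_zero_or B with h1 | h1
      · exact h1 (by rw [hN, h0, mul_zero])
      · exact h1 h0
    obtain ⟨x, u, hu, hx⟩ := hlin _ hD hdD
    refine ⟨x, ((-(t / s) : ℂ) : OnePoint ℂ), -(t / s) * u, u, by simp [hu], ?_, ?_, hx⟩
    · simp only [ell, OnePoint.elim_some]
      ring
    · rw [hN, hx, C_mul, mul_assoc]

theorem redGcd_eq_of_degenerate {B : RatFunc 𝕃} {L : ℂ[X]} {u₁ u₂ : ℂ} (hu : ¬(u₁ = 0 ∧ u₂ = 0))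
    (h₁ : redNum B = C u₁ * L) (h₂ : redDenom B = C u₂ * L) :
    ∃ e : ℂ, e ≠ 0 ∧ redGcd B = C e * L := by
  have hdvd : ∀ {u : ℂ} {p q : ℂ[X]}, u ≠ 0 → q ∣ C u * p → q ∣ p := by
    intro u p q hu0 h
    exact (isUnit_C.2 (isUnit_iff_ne_zero.2 hu0)).dvd_mul_left.1 h
  have h3 : L ∣ redGcd B := EuclideanDomain.dvd_gcd (by rw [h₁]; exact dvd_mul_left _ _)
    (by rw [h₂]; exact dvd_mul_left _ _)
  have h4 : redGcd B ∣ L := by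
    by_cases hu1 : u₁ = 0
    · refine hdvd (u := u₂) (fun hu2 => hu ⟨hu1, hu2⟩) ?_
      rw [← h₂]
      exact EuclideanDomain.gcd_dvd_right _ _
    · refine hdvd (u := u₁) hu1 ?_
      rw [← h₁]
      exact EuclideanDomain.gcd_dvd_left _ _
  obtain ⟨e, he⟩ := associated_of_dvd_dvd h3 h4
  obtain ⟨c, hc, hce⟩ := isUnit_iff.1 e.isUnit
  exact ⟨c, hc.ne_zero, by rw [← he, ← hce, mul_comm]⟩

section Degenerate

variable {B : RatFunc 𝕃} (hB : ratDegree B = 1) {x y : OnePoint ℂ} {u₁ u₂ : ℂ}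
  (hu : ¬(u₁ = 0 ∧ u₂ = 0)) (hy : (ell y).1 * u₁ + (ell y).2 * u₂ = 0)
  (h₁ : redNum B = C u₁ * (C (ell x).1 * X + C (ell x).2))
  (h₂ : redDenom B = C u₂ * (C (ell x).1 * X + C (ell x).2))

include hu h₁ h₂

theorem natDegree_redGcd_of_degenerate : pairDegree (phiNum B) (phiDenom B) = 0 ∧
    ∃ e : ℂ, e ≠ 0 ∧ redGcd B = C e * (C (ell x).1 * X + C (ell x).2) ∧
      phiNum B = C (e⁻¹ * u₁) ∧ phiDenom B = C (e⁻¹ * u₂) := by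
  obtain ⟨e, he, hg⟩ := redGcd_eq_of_degenerate hu h₁ h₂
  have hL : C (ell x).1 * X + C (ell x).2 ≠ (0 : ℂ[X]) := fun h0 => by
    refine redGcd_ne_zero B ?_
    rw [hg, h0, mul_zero]
  have key : ∀ {p : ℂ[X]} {u : ℂ}, C u * (C (ell x).1 * X + C (ell x).2) = redGcd B * p →
      p = C (e⁻¹ * u) := by
    intro p u hp
    rw [hg] at hp
    have h3 : C u = C e * p := mul_right_cancel₀ hL (by rw [hp]; ring)
    rw [C_mul, h3, ← mul_assoc, ← C_mul, inv_mul_cancel₀ he, C_1, one_mul]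
  have e1 := key (h₁.symm.trans (redNum_eq B))
  have e2 := key (h₂.symm.trans (redDenom_eq B))
  refine ⟨?_, e, he, hg, e1, e2⟩
  rw [e1, e2, pairDegree, natDegree_C, natDegree_C, max_self]

include hB

theorem hPoint_eq_of_degenerate : hPoint B = x := by
  obtain ⟨h3, e, he, hg, -⟩ := natDegree_redGcd_of_degenerate hu h₁ h₂
  have hord : ∀ z, 0 < ordH B z ↔ z = x := by
    intro z
    have hr : pairDegree (redNum B) (redDenom B) = (C (ell x).1 * X + C (ell x).2 : ℂ[X]).natDegree := by
      rw [pairDegree_red, h3, add_zero, hg, natDegree_C_mul he]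
    induction z using OnePoint.rec with
    | infty =>
      simp only [ordH, OnePoint.elim_infty, hr, hB]
      induction x using OnePoint.rec with
      | infty => simp [ell]
      | coe c =>
        have : (X + -C c : ℂ[X]).natDegree = 1 := by rw [← sub_eq_add_neg, natDegree_X_sub_C]
        simp [ell, this]
    | coe a =>
      simp only [ordH, OnePoint.elim_some]
      rw [← count_roots, hg, roots_C_mul _ he]
      induction x using OnePoint.rec with
      | infty => simp [ell]
      | coe c =>
        have : (X + -C c : ℂ[X]).roots = {c} := by rw [← sub_eq_add_neg, roots_X_sub_C]
        by_cases h : a = c <;> simp [ell, this, h]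
  have hex : ∃ z, 0 < ordH B z := ⟨x, (hord x).2 rfl⟩
  exact (hord _).1 (Classical.epsilon_spec hex)

omit hB in
include hy in
theorem aPoint_eq_of_degenerate : aPoint B = y := by
  obtain ⟨h3, e, he, -, e1, e2⟩ := natDegree_redGcd_of_degenerate hu h₁ h₂
  simp only [aPoint, phi, pairEval, OnePoint.elim_infty, h3]
  rw [e1, e2, coeff_C_zero, coeff_C_zero]
  induction y using OnePoint.rec with
  | infty =>
    have : u₂ = 0 := by simpa [ell] using hy
    simp [this]
  | coe c =>
    have h4 : u₁ = c * u₂ := by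
      simp only [ell, OnePoint.elim_some, one_mul] at hy
      linear_combination hy
    have h5 : u₂ ≠ 0 := fun h0 => hu ⟨by rw [h4, h0, mul_zero], h0⟩
    rw [if_neg (mul_ne_zero (inv_ne_zero he) h5), h4]
    congr 1
    field_simp

include hy in
-- Pull back `ell y` to `k` and `ell z`, for some `z ≠ y`, to `m`. The reduction of `k` is zero and
-- that of `m` is a nonzero multiple of `ell x`. Thus `S` lies in the disc of `x` iff `|m| < size`,
-- and `B(S)` lies in the disc of `y` iff `|k| < |m|`. Outside the first disc `|k| < size ≤ |m|`,
-- and the intersection of the two loci is an annulus.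
theorem separation_of_degenerate :
    (∀ S, S ∉ residueDisc x → berkMap B S ∈ residueDisc y) ∧
    IsPreconnected (residueDisc x ∩ berkMap B ⁻¹' residueDisc y) ∧
    (residueDisc x ∩ berkMap B ⁻¹' residueDisc y).Nonempty := by
  obtain ⟨a, b, c, d, H, hN, hD⟩ := exists_isMobius_norm hB
  have hred : ∀ {p : 𝕃[X]} {r s : 𝕃} {u : ℂ}, p = C r * X + C s → gaussValuation 𝕃 p ≤ 1 →
      reducePoly p = C u * (C (ell x).1 * X + C (ell x).2) →
      ‖r‖ ≤ 1 ∧ ‖s‖ ≤ 1 ∧ residue r = u * (ell x).1 ∧ residue s = u * (ell x).2 := by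
    intro p r s u hp hg hr
    have h1 := norm_coeff_le_one hg 1
    have h0 := norm_coeff_le_one hg 0
    have e1 := coeff_reducePoly p 1
    have e0 := coeff_reducePoly p 0
    rw [hr, hp] at e1 e0
    rw [hp] at h1 h0
    simp only [coeff_add, coeff_C_mul, coeff_X_one, coeff_C_succ, add_zero, mul_one, coeff_X_zero,
      mul_zero, coeff_C_zero, zero_add] at h1 h0 e1 e0
    exact ⟨h1, h0, e1.symm, e0.symm⟩
  obtain ⟨ha, hb, hra, hrb⟩ := hred hN (gauss_normNum_le B) h₁
  obtain ⟨hc, hd, hrc, hrd⟩ := hred hD (gauss_normDenom_le B) h₂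
  obtain ⟨z, hz⟩ := exists_ne y
  have hcomb : ∀ {s t p q : 𝕃}, ‖s‖ ≤ 1 → ‖t‖ ≤ 1 → ‖p‖ ≤ 1 → ‖q‖ ≤ 1 → ‖s * p + t * q‖ ≤ 1 ∧
      residue (s * p + t * q) = residue s * residue p + residue t * residue q := by
    intro s t p q hs ht hp hq
    have h1 : ‖s * p‖ ≤ 1 := by rw [norm_mul]; exact mul_le_one₀ hs (norm_nonneg _) hp
    have h2 : ‖t * q‖ ≤ 1 := by rw [norm_mul]; exact mul_le_one₀ ht (norm_nonneg _) hq
    refine ⟨(IsUltrametricDist.norm_add_le_max _ _).trans (max_le h1 h2), ?_⟩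
    rw [residue_add h1 h2, residue_mul hs hp, residue_mul ht hq]
  have hι := norm_ofComplex_le
  obtain ⟨hk₁, hrk₁⟩ := hcomb (hι (ell y).1) (hι (ell y).2) ha hc
  obtain ⟨hk₂, hrk₂⟩ := hcomb (hι (ell y).1) (hι (ell y).2) hb hd
  obtain ⟨hm₁, hrm₁⟩ := hcomb (hι (ell z).1) (hι (ell z).2) ha hc
  obtain ⟨hm₂, hrm₂⟩ := hcomb (hι (ell z).1) (hι (ell z).2) hb hd
  set k₁ := ofComplex (ell y).1 * a + ofComplex (ell y).2 * c
  set k₂ := ofComplex (ell y).1 * b + ofComplex (ell y).2 * d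
  set m₁ := ofComplex (ell z).1 * a + ofComplex (ell z).2 * c
  set m₂ := ofComplex (ell z).1 * b + ofComplex (ell z).2 * d
  set w := (ell z).1 * u₁ + (ell z).2 * u₂ with hw
  have hdet := det_ell_ne_zero hz
  have hw0 : w ≠ 0 := by
    intro h0
    refine hu ⟨?_, ?_⟩
    · refine (mul_eq_zero.1 (?_ : ((ell z).1 * (ell y).2 - (ell z).2 * (ell y).1) * u₁ = 0)).resolve_left hdet
      linear_combination (ell y).2 * h0 - (ell z).2 * hy + (ell y).2 * hw
    · refine (mul_eq_zero.1 (?_ : ((ell z).1 * (ell y).2 - (ell z).2 * (ell y).1) * u₂ = 0)).resolve_left hdet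
      linear_combination (ell z).1 * hy - (ell y).1 * h0 - (ell y).1 * hw
  simp only [residue_ofComplex, hra, hrb, hrc, hrd] at hrk₁ hrk₂ hrm₁ hrm₂
  have hk₁' : ‖k₁‖ < 1 := (residue_eq_zero_iff hk₁).1 (by
    rw [hrk₁]; linear_combination (ell x).1 * hy)
  have hk₂' : ‖k₂‖ < 1 := (residue_eq_zero_iff hk₂).1 (by
    rw [hrk₂]; linear_combination (ell x).2 * hy)
  have hrm₁' : residue m₁ = w * (ell x).1 := by rw [hrm₁, hw]; ring
  have hrm₂' : residue m₂ = w * (ell x).2 := by rw [hrm₂, hw]; ring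
  have hmne : ¬(residue m₁ = 0 ∧ residue m₂ = 0) := by
    rw [hrm₁', hrm₂']
    simpa [hw0] using ell_ne_zero x
  have hx : ∀ S, S ∈ residueDisc x ↔ lin S m₁ m₂ < size S := by
    intro S
    rw [lin_lt_size_iff hm₁ hm₂ hmne, hrm₁', hrm₂', rootPt_mul_ell hw0]
  have hyiff : ∀ S, berkMap B S ∈ residueDisc y ↔ lin S k₁ k₂ < lin S m₁ m₂ := by
    intro S
    obtain ⟨N, hN0, h⟩ := H.lin_berkMap S
    change lin _ _ _ < size _ ↔ _
    have hdet' : ‖ofComplex (ell z).1 * ofComplex (ell y).2 -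
        ofComplex (ell z).2 * ofComplex (ell y).1‖ = 1 := by
      rw [← map_mul, ← map_mul, ← map_sub]
      exact norm_ofComplex hdet
    rw [size_eq_max_lin (berkMap B S) (hι _) (hι _) (hι _) (hι _) hdet', lt_max_iff,
      or_iff_left (lt_irrefl _), h, h]
    exact (mul_lt_mul_iff_right₀ (pos_iff_ne_zero.2 hN0)).symm
  have hW : residueDisc x ∩ berkMap B ⁻¹' residueDisc y =
      {S | lin S m₁ m₂ < size S ∧ lin S k₁ k₂ < lin S m₁ m₂} := by
    ext S
    rw [mem_inter_iff, mem_preimage, hx, hyiff]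
    rfl
  refine ⟨fun S hS => ?_, ?_⟩
  · rw [hyiff]
    rw [hx, not_lt] at hS
    exact (lin_lt_size S hk₁' hk₂').trans_le hS
  · rw [hW]
    exact isPreconnected_annulus hm₁ hm₂ hmne hk₁' hk₂'

end Degenerate

/-- The position of the Gauss point and of its preimage under a Möbius transformation moving it. -/
theorem separation {B : RatFunc 𝕃} (hB : ratDegree B = 1) (hne : berkMap B gauss ≠ gauss) :
    (∀ S, S ∉ residueDisc (hPoint B) → berkMap B S ∈ residueDisc (aPoint B)) ∧
    IsPreconnected (residueDisc (hPoint B) ∩ berkMap B ⁻¹' residueDisc (aPoint B)) ∧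
    (residueDisc (hPoint B) ∩ berkMap B ⁻¹' residueDisc (aPoint B)).Nonempty := by
  obtain ⟨x, y, u₁, u₂, hu, hy, h₁, h₂⟩ := exists_degenerate_reduction hB hne
  rw [hPoint_eq_of_degenerate hB hu h₁ h₂, aPoint_eq_of_degenerate hu hy h₁ h₂]
  exact separation_of_degenerate hB hu hy h₁ h₂

/-! ### Purely atomic measures -/

theorem atomicMeasure_apply (m : OnePoint ℂ → ℝ≥0∞) {s : Set (OnePoint ℂ)} (hs : MeasurableSet s) :
    atomicMeasure m s = ∑' x, if x ∈ s then m x else 0 := by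
  rw [atomicMeasure, Measure.sum_apply _ hs]
  refine tsum_congr fun x => ?_
  rw [Measure.smul_apply, Measure.dirac_apply' _ hs]
  by_cases h : x ∈ s <;> simp [h]

theorem atomicMeasure_singleton (m : OnePoint ℂ → ℝ≥0∞) (x : OnePoint ℂ) :
    atomicMeasure m {x} = m x := by
  rw [atomicMeasure_apply m (measurableSet_singleton x)]
  simp only [mem_singleton_iff]
  exact tsum_ite_eq x m

theorem lintegral_atomicMeasure (m F : OnePoint ℂ → ℝ≥0∞) :
    ∫⁻ z, F z ∂(atomicMeasure m) = ∑' z, m z * F z := by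
  rw [atomicMeasure, lintegral_sum_measure]
  refine tsum_congr fun x => ?_
  rw [lintegral_smul_measure, lintegral_dirac, smul_eq_mul]

theorem atomicProb_atomicMeasure {m : OnePoint ℂ → ℝ≥0∞} (hm : ∑' x, m x = 1) :
    AtomicProb (atomicMeasure m) := by
  refine ⟨⟨?_⟩, Function.support m, Summable.countable_support_ennreal (by simp [hm]), ?_⟩
  · rw [atomicMeasure_apply m MeasurableSet.univ]
    simpa using hm
  · have hc : (Function.support m).Countable := Summable.countable_support_ennreal (by simp [hm])
    rw [atomicMeasure_apply m hc.measurableSet.compl, ENNReal.tsum_eq_zero]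
    intro x
    split_ifs with h
    · simpa using h
    · rfl

namespace AtomicProb

variable {μ ν : Measure (OnePoint ℂ)}

theorem eq_atomicMeasure (hμ : AtomicProb μ) : μ = atomicMeasure fun x => μ {x} := by
  obtain ⟨-, s, hs, h0⟩ := hμ
  refine Measure.ext fun t ht => ?_
  have h1 : μ t = μ (t ∩ s) := by
    have h2 : μ (t \ s) = 0 := measure_mono_null (fun x hx => hx.2) h0
    rw [← measure_inter_add_sdiff t hs.measurableSet, h2, add_zero]
  have hts : (t ∩ s).Countable := hs.mono inter_subset_right
  have h2 : μ (t ∩ s) = ∑' x : ↥(t ∩ s), μ {(x : OnePoint ℂ)} := by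
    rw [← measure_biUnion hts (f := fun x => {x}) ?_ fun x _ => measurableSet_singleton x,
      biUnion_of_singleton]
    exact fun x _ y _ hxy => disjoint_singleton.2 hxy
  rw [h1, h2, atomicMeasure_apply _ ht, tsum_subtype (t ∩ s) fun x => μ {x}]
  refine tsum_congr fun x => ?_
  by_cases hxt : x ∈ t
  · by_cases hxs : x ∈ s
    · simp [hxt, hxs]
    · have : μ {x} = 0 := measure_mono_null (singleton_subset_iff.2 hxs) h0
      simp [hxt, hxs, this]
  · simp [hxt]

theorem tsum_singleton (hμ : AtomicProb μ) : ∑' x, μ {x} = 1 := by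
  have := hμ.1.measure_univ
  rw [hμ.eq_atomicMeasure, atomicMeasure_apply _ MeasurableSet.univ] at this
  simpa using this

theorem diffuseMass_eq_zero (hμ : AtomicProb μ) : diffuseMass μ = 0 := by
  rw [diffuseMass, hμ.tsum_singleton, hμ.1.measure_univ, tsub_self]

theorem ext (hμ : AtomicProb μ) (hν : AtomicProb ν) (h : ∀ x, μ {x} = ν {x}) : μ = ν := by
  rw [hμ.eq_atomicMeasure, hν.eq_atomicMeasure]
  exact congrArg atomicMeasure (funext h)

/-- Making `f` constant off a countable carrier of `μ` renders it measurable, so no regularity of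
`phi` is needed to push measures forward. -/
theorem aemeasurable (hμ : AtomicProb μ) (f : OnePoint ℂ → OnePoint ℂ) : AEMeasurable f μ := by
  obtain ⟨-, s, hs, h0⟩ := hμ
  refine ⟨s.piecewise f fun _ => OnePoint.infty, ?_, ?_⟩
  · intro t ht
    rw [piecewise_preimage, Set.ite]
    exact (hs.mono inter_subset_right).measurableSet.union
      ((measurable_const ht).diff hs.measurableSet)
  · have : ∀ᵐ x ∂μ, x ∈ s := h0
    filter_upwards [this] with x hx
    rw [piecewise_eq_of_mem _ _ _ hx]

theorem map (hμ : AtomicProb μ) (f : OnePoint ℂ → OnePoint ℂ) : AtomicProb (μ.map f) := by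
  have hf := hμ.aemeasurable f
  obtain ⟨hp, s, hs, h0⟩ := hμ
  refine ⟨Measure.isProbabilityMeasure_map hf, f '' s, hs.image f, ?_⟩
  rw [Measure.map_apply_of_aemeasurable hf (hs.image f).measurableSet.compl]
  refine measure_mono_null (fun x hx hxs => hx ⟨x, hxs, rfl⟩) h0

theorem lintegral (hμ : AtomicProb μ) (F : OnePoint ℂ → ℝ≥0∞) :
    ∫⁻ z, F z ∂μ = ∑' z, μ {z} * F z := by
  conv_lhs => rw [hμ.eq_atomicMeasure]
  exact lintegral_atomicMeasure _ F

/-- After exchanging the two sums, each `w` lies over the single point `z = φ_g̃(w)`. -/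
theorem redPullback_eq (hμ : AtomicProb μ) {g : RatFunc 𝕃} (hg : berkMap g gauss = gauss)
    (s : Set (OnePoint ℂ)) :
    redPullback g μ s = ∑' w, if w ∈ s then
      (localDegree (phiNum g) (phiDenom g) w : ℝ≥0∞) * μ {phi g w} + ordH g w else 0 := by
  rw [redPullback, hμ.lintegral]
  simp_rw [← ENNReal.tsum_mul_left]
  rw [ENNReal.tsum_comm, ← ENNReal.tsum_add]
  refine tsum_congr fun w => ?_
  split_ifs with hw
  · congr 1
    rw [tsum_eq_single (phi g w)]
    · rw [fibreMult_eq_ite (isCoprime_phi g) (pairDegree_phi_ne_zero hg), if_pos (by rfl), mul_comm]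
    · intro z hz
      rw [fibreMult_eq_ite (isCoprime_phi g) (pairDegree_phi_ne_zero hg),
        if_neg (show z ≠ pairEval _ _ w from hz)]
      simp
  · simp

/-- Both sides are sums of point masses, so singletons suffice. With `c = deg h` this serves for the
balance relation, with `c = 1` for admissibility when the Gauss point is fixed. -/
theorem redPullback_eq_mul_iff (hμ : AtomicProb μ) (hν : AtomicProb ν) {g : RatFunc 𝕃}
    (hg : berkMap g gauss = gauss) (c : ℝ≥0∞) :
    (∀ s, MeasurableSet s → redPullback g ν s = c * μ s) ↔
      ∀ x, (localDegree (phiNum g) (phiDenom g) x : ℝ≥0∞) * ν {phi g x} + ordH g x = c * μ {x} := by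
  constructor
  · intro h x
    rw [← h {x} (measurableSet_singleton x), hν.redPullback_eq hg]
    simp only [mem_singleton_iff]
    exact (tsum_ite_eq x fun w => (localDegree (phiNum g) (phiDenom g) w : ℝ≥0∞) *
      ν {phi g w} + ordH g w).symm
  · intro h s hs
    rw [hν.redPullback_eq hg]
    conv_rhs => rw [hμ.eq_atomicMeasure, atomicMeasure_apply _ hs, ← ENNReal.tsum_mul_left]
    refine tsum_congr fun w => ?_
    rw [h w]
    split_ifs <;> simp

end AtomicProb

/-- Recovers the masses of `dir (hPoint B)` and `dirVia B (aPoint B)`: these are the only directions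
at the vertices that are not cells. -/
theorem eq_of_tsum_eq_one {α : Type*} {F G : α → ℝ≥0∞} (hF : ∑' x, F x = 1) (hG : ∑' x, G x = 1)
    {a : α} (h : ∀ x, x ≠ a → F x = G x) : F = G := by
  have key : ∀ K : α → ℝ≥0∞, ∑' x, K x = K a + ∑' x, if x = a then 0 else K x := fun K =>
    ENNReal.tsum_eq_add_tsum_ite a
  have h1 : (∑' x, if x = a then 0 else F x) = ∑' x, if x = a then 0 else G x :=
    tsum_congr fun x => by
      split_ifs with hx
      · rfl
      · exact h x hx
  have h2 : F a = G a := by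
    rw [key, h1] at hF
    rw [key] at hG
    have hfin : (∑' x, if x = a then 0 else G x) ≠ ∞ := fun h0 => by simp [h0] at hG
    exact (ENNReal.add_left_inj hfin).1 (hF.trans hG.symm)
  funext x
  by_cases hx : x = a
  · rw [hx, h2]
  · exact h x hx

/-! ### The partition `S(Γ)` -/

section Cells

variable {Γ : Set (BerkovichP1 𝕃)} {U V : Set (BerkovichP1 𝕃)}

theorem cell_nonempty (hV : V ∈ cells Γ) : V.Nonempty := by
  rcases hV with ⟨S, -, rfl⟩ | ⟨S, hS, rfl⟩
  · exact singleton_nonempty S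
  · exact ⟨S, mem_connectedComponentIn hS⟩

theorem cell_eq_of_mem (hU : U ∈ cells Γ) (hV : V ∈ cells Γ) {S : BerkovichP1 𝕃} (hSU : S ∈ U)
    (hSV : S ∈ V) : U = V := by
  rcases hU with ⟨S₁, h₁, rfl⟩ | ⟨S₁, h₁, rfl⟩ <;> rcases hV with ⟨S₂, h₂, rfl⟩ | ⟨S₂, h₂, rfl⟩
  · rw [mem_singleton_iff] at hSU hSV
    rw [← hSU, ← hSV]
  · rw [mem_singleton_iff] at hSU
    exact absurd (hSU ▸ h₁) (connectedComponentIn_subset _ _ hSV)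
  · rw [mem_singleton_iff] at hSV
    exact absurd (hSV ▸ h₂) (connectedComponentIn_subset _ _ hSU)
  · rw [connectedComponentIn_eq hSU, connectedComponentIn_eq hSV]

theorem cell_eq_of_subset (hU : U ∈ cells Γ) (hV : V ∈ cells Γ) (h : V ⊆ U) : V = U := by
  obtain ⟨S, hS⟩ := cell_nonempty hV
  exact cell_eq_of_mem hV hU hS (h hS)

theorem mass_cell (ω : cells Γ → ℝ≥0∞) (hU : U ∈ cells Γ) : mass ω U = ω ⟨U, hU⟩ := by
  rw [mass, tsum_eq_single ⟨U, hU⟩]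
  · exact if_pos Subset.rfl
  · intro V hV
    exact if_neg fun h => hV (Subtype.ext (cell_eq_of_subset hU V.2 h))

theorem cell_subset_connectedComponentIn (hV : V ∈ cells Γ) {S₀ S : BerkovichP1 𝕃} (h₀ : S₀ ∈ Γ)
    (hne : V ≠ {S₀}) (hS : S ∈ V) : V ⊆ connectedComponentIn {S₀}ᶜ S := by
  rcases hV with ⟨S₁, h₁, rfl⟩ | ⟨S₁, h₁, rfl⟩
  · rw [mem_singleton_iff] at hS
    subst hS
    rw [singleton_subset_iff]
    exact mem_connectedComponentIn fun h => hne (by rw [mem_singleton_iff.1 h])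
  · rw [connectedComponentIn_eq hS]
    exact connectedComponentIn_mono _ (compl_subset_compl.2 (singleton_subset_iff.2 h₀))

/-- Every cell other than `{S₀}` lies in a unique direction at `S₀`. -/
theorem existsUnique_cell_subset {B : RatFunc 𝕃} (hB : ratDegree B = 1) {S₀ : BerkovichP1 𝕃}
    (hS₀ : berkMap B S₀ = gauss) (h₀ : S₀ ∈ Γ) (hV : V ∈ cells Γ) (hne : V ≠ {S₀}) :
    ∃! y, V ⊆ dirVia B y := by
  obtain ⟨S, hS⟩ := cell_nonempty hV
  have hsub := cell_subset_connectedComponentIn hV h₀ hne hS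
  have hBS : berkMap B S ≠ gauss := fun h => by
    have := connectedComponentIn_subset _ _ (hsub hS)
    exact this ((berkMap_bijective hB).1 (h.trans hS₀.symm))
  obtain ⟨y, hy⟩ := exists_mem_residueDisc hBS
  rw [connectedComponentIn_mobius hB hS₀ hy] at hsub
  refine ⟨y, ?_, fun z hz => ?_⟩
  · change V ⊆ dirVia B y
    rwa [dirVia, dir_eq_residueDisc]
  · have := hz hS
    rw [dirVia, dir_eq_residueDisc] at this
    exact residueDisc_disjoint this hy

theorem existsUnique_cell_subset_dir (h₀ : gauss ∈ Γ) (hV : V ∈ cells Γ) (hne : V ≠ {gauss}) :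
    ∃! x, V ⊆ dir x := by
  obtain ⟨S, hS⟩ := cell_nonempty hV
  have hsub := cell_subset_connectedComponentIn hV h₀ hne hS
  obtain ⟨x, hx⟩ := exists_mem_residueDisc (connectedComponentIn_subset _ _ (hsub hS) : S ≠ gauss)
  rw [connectedComponentIn_gauss hx] at hsub
  refine ⟨x, ?_, fun z hz => ?_⟩
  · change V ⊆ dir x
    rwa [dir_eq_residueDisc]
  · have := hz hS
    rw [dir_eq_residueDisc] at this
    exact residueDisc_disjoint this hx

/-- The masses of a family of disjoint sets sum up to the total mass, if every cell of positive
mass lies in one of them. -/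
theorem tsum_mass_eq {ω : cells Γ → ℝ≥0∞} {D : OnePoint ℂ → Set (BerkovichP1 𝕃)}
    (h : ∀ V : cells Γ, ω V ≠ 0 → ∃! x, V.1 ⊆ D x) : ∑' x, mass ω (D x) = ∑' V, ω V := by
  simp only [mass]
  rw [ENNReal.tsum_comm]
  refine tsum_congr fun V => ?_
  by_cases hV : ω V = 0
  · simp [hV]
  · obtain ⟨x, hx, hu⟩ := h V hV
    rw [tsum_eq_single x fun z hz => if_neg fun hz' => hz (hu z hz'), if_pos hx]

theorem tsum_mass_dir {ω : cells Γ → ℝ≥0∞} (hω : ω ∈ M1dag Γ) (h₀ : gauss ∈ Γ) :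
    ∑' x, mass ω (dir x) = 1 := by
  rw [tsum_mass_eq, hω.1]
  intro V hV
  exact existsUnique_cell_subset_dir h₀ V.2 fun h => hV (hω.2 V ⟨gauss, h₀, h⟩)

theorem tsum_mass_dirVia {ω : cells Γ → ℝ≥0∞} (hω : ω ∈ M1dag Γ) {B : RatFunc 𝕃}
    (hB : ratDegree B = 1) {S₀ : BerkovichP1 𝕃} (hS₀ : berkMap B S₀ = gauss) (h₀ : S₀ ∈ Γ) :
    ∑' y, mass ω (dirVia B y) = 1 := by
  rw [tsum_mass_eq, hω.1]
  intro V hV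
  exact existsUnique_cell_subset hB hS₀ h₀ V.2 fun h => hV (hω.2 V ⟨S₀, h₀, h⟩)

theorem dir_mem_cells_gauss (x : OnePoint ℂ) : dir x ∈ cells {gauss} := by
  obtain ⟨S, hS⟩ := residueDisc_nonempty x
  refine Or.inr ⟨S, ?_, ?_⟩
  · rintro rfl
    exact gauss_notMem_residueDisc x hS
  · rw [connectedComponentIn_gauss hS, dir_eq_residueDisc]

theorem dir_injective : Function.Injective dir := fun x y h => by
  rw [dir_eq_residueDisc, dir_eq_residueDisc] at h
  exact residueDisc_injective h

theorem dir_ne_singleton_gauss (x : OnePoint ℂ) : dir x ≠ {gauss} := fun h => by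
  rw [dir_eq_residueDisc] at h
  exact gauss_notMem_residueDisc x (h ▸ mem_singleton _)

theorem singleton_gauss_mem_cells (h₀ : gauss ∈ Γ) : {gauss} ∈ cells Γ := Or.inl ⟨gauss, h₀, rfl⟩

theorem cells_gauss_cases (hV : V ∈ cells {gauss}) : V = {gauss} ∨ ∃ x, V = dir x := by
  by_cases h : V = {gauss}
  · exact Or.inl h
  · obtain ⟨x, hx, -⟩ := existsUnique_cell_subset_dir (mem_singleton gauss) hV h
    exact Or.inr ⟨x, cell_eq_of_subset (dir_mem_cells_gauss x) hV hx⟩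

theorem dirCoord_dir (x : OnePoint ℂ) : dirCoord (dir x) = x := by
  rw [dir_eq_residueDisc, dirCoord_residueDisc]

theorem mem_M1dag_gauss {ω : cells {gauss} → ℝ≥0∞} {m : OnePoint ℂ → ℝ≥0∞} (hm : ∑' x, m x = 1)
    (h₀ : ω ⟨{gauss}, singleton_gauss_mem_cells (mem_singleton _)⟩ = 0)
    (h : ∀ x, ω ⟨dir x, dir_mem_cells_gauss x⟩ = m x) : ω ∈ M1dag {gauss} := by
  refine ⟨?_, ?_⟩
  · have hω : ∀ V, ω V = ∑' x, if V = ⟨dir x, dir_mem_cells_gauss x⟩ then m x else 0 := by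
      rintro ⟨V, hV⟩
      rcases cells_gauss_cases hV with rfl | ⟨x, rfl⟩
      · rw [h₀]
        refine (ENNReal.tsum_eq_zero.2 fun x => if_neg fun h => ?_).symm
        exact dir_ne_singleton_gauss x (congrArg Subtype.val h).symm
      · rw [h x, tsum_eq_single x, if_pos rfl]
        intro z hz
        exact if_neg fun h => hz (dir_injective (congrArg Subtype.val h)).symm
    change ∑' V, ω V = 1
    simp_rw [hω]
    rw [ENNReal.tsum_comm, ← hm]
    exact tsum_congr fun x => tsum_ite_eq _ fun _ => m x
  · rintro ⟨V, hV⟩ ⟨S, hS, h⟩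
    rw [mem_singleton_iff] at hS
    subst hS
    obtain rfl : V = {gauss} := h
    exact h₀

end Cells

/-- Identifies the labels of cells that `omegaOf` selects by `epsilon`. -/
theorem epsilon_eq_of_injective {α β : Type*} [Nonempty α] {F : α → β} (hF : Function.Injective F)
    {b : β} {x : α} (hb : b = F x) : (Classical.epsilon fun y => b = F y) = x := by
  have hex : ∃ y, b = F y := ⟨x, hb⟩
  exact hF ((Classical.epsilon_spec hex).symm.trans hb)

theorem gauss_mem_vertices (h : RatFunc 𝕃) : gauss ∈ vertices h := mem_insert _ _

theorem berkMap_gauss_mem_vertices (h : RatFunc 𝕃) : berkMap h gauss ∈ vertices h :=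
  mem_insert_of_mem _ rfl

namespace Rescales

variable {B h : RatFunc 𝕃} (H : Rescales B h)

include H

theorem mem_dirVia {S : BerkovichP1 𝕃} {y : OnePoint ℂ} :
    S ∈ dirVia B y ↔ berkMap B S ∈ residueDisc y := by
  rw [H.dirVia_eq, mem_preimage]

theorem dirVia_injective : Function.Injective (dirVia B) := fun y z hyz => by
  obtain ⟨T, hT⟩ := residueDisc_nonempty y
  obtain ⟨S, rfl⟩ := (berkMap_bijective H.ratDegree_eq).2 T
  exact residueDisc_disjoint hT (H.mem_dirVia.1 (hyz ▸ H.mem_dirVia.2 hT))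

theorem tsum_mass_dirVia {ω : cells (vertices h) → ℝ≥0∞} (hω : ω ∈ M1dag (vertices h)) :
    ∑' y, mass ω (dirVia B y) = 1 :=
  DegLimit.tsum_mass_dirVia hω H.ratDegree_eq H.berkMap_vertex (berkMap_gauss_mem_vertices h)

/-! ### The balanced relations in terms of masses -/

theorem reducedBalanced_iff {μ : Measure (OnePoint ℂ) × Measure (OnePoint ℂ)}
    (h₁ : AtomicProb μ.1) (h₂ : AtomicProb μ.2) :
    ReducedBalanced h B μ ↔ ∀ x,
      (localDegree (phiNum (ratComp B h)) (phiDenom (ratComp B h)) x : ℝ≥0∞) *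
        μ.2 {phi (ratComp B h) x} + ordH (ratComp B h) x = ratDegree h * μ.1 {x} :=
  h₁.redPullback_eq_mul_iff h₂ H.fix _

theorem quantizedPullback_gauss (ω : cells (vertices h) → ℝ≥0∞) :
    quantizedPullback h ω ⟨{gauss}, singleton_gauss_mem_cells (mem_singleton _)⟩ =
      gaussDegree h * ω ⟨{berkMap h gauss}, Or.inl ⟨_, berkMap_gauss_mem_vertices h, rfl⟩⟩ := by
  rw [quantizedPullback, tsum_eq_single ⟨{berkMap h gauss},
    Or.inl ⟨_, berkMap_gauss_mem_vertices h, rfl⟩⟩]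
  · simp [quantizedDegree]
  · rintro ⟨V, hV⟩ hne
    have : V ≠ {berkMap h gauss} := fun h => hne (Subtype.ext h)
    simp [quantizedDegree, this]

/-- The directional degree is counted only for cells in the image direction, which gives the mass of
that direction; the surplus is counted for all cells, whose total mass is one. -/
theorem quantizedPullback_dir {ω : cells (vertices h) → ℝ≥0∞} (hω : ω ∈ M1 (vertices h))
    (x : OnePoint ℂ) : quantizedPullback h ω ⟨dir x, dir_mem_cells_gauss x⟩ =
      (localDegree (phiNum (ratComp B h)) (phiDenom (ratComp B h)) x : ℝ≥0∞) *
        mass ω (dirVia B (phi (ratComp B h) x)) + ordH (ratComp B h) x := by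
  have h1 : ∀ V : cells (vertices h), (quantizedDegree h V.1 (dir x) : ℝ≥0∞) * ω V =
      (localDegree (phiNum (ratComp B h)) (phiDenom (ratComp B h)) x : ℝ≥0∞) *
        (if V.1 ⊆ dirVia B (phi (ratComp B h) x) then ω V else 0) +
      ordH (ratComp B h) x * ω V := by
    intro V
    rw [quantizedDegree, if_neg (dir_ne_singleton_gauss x), dir_eq_residueDisc, H.tangentMap_eq,
      H.dirDegree_eq, H.surplus_eq]
    split_ifs
    · push_cast
      ring
    · simp
  have h2 : ∑' V, ω V = 1 := hω
  rw [quantizedPullback, mass]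
  simp_rw [h1]
  rw [ENNReal.tsum_add, ENNReal.tsum_mul_left, ENNReal.tsum_mul_left, h2, mul_one]

/-- The equation at the cell `{𝒮_G}` is `0 = 0`, since `ω` has no mass at either vertex. What
remains is the system of `reducedBalanced_iff`, with masses of directions in place of masses of
points. -/
theorem quantizedBalanced_iff {ω : cells (vertices h) → ℝ≥0∞} (hω : ω ∈ M1dag (vertices h)) :
    QuantizedBalanced h ω ↔ ∀ x,
      (localDegree (phiNum (ratComp B h)) (phiDenom (ratComp B h)) x : ℝ≥0∞) *
        mass ω (dirVia B (phi (ratComp B h) x)) + ordH (ratComp B h) x =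
          ratDegree h * mass ω (dir x) := by
  constructor
  · intro hb x
    rw [← H.quantizedPullback_dir hω.1]
    exact congrFun hb ⟨dir x, dir_mem_cells_gauss x⟩
  · intro hb
    funext ⟨U, hU⟩
    rcases cells_gauss_cases hU with rfl | ⟨x, rfl⟩
    · rw [H.quantizedPullback_gauss, hω.2 _ ⟨_, berkMap_gauss_mem_vertices h, rfl⟩, proj,
        mass_cell ω (singleton_gauss_mem_cells (gauss_mem_vertices h)),
        hω.2 _ ⟨_, gauss_mem_vertices h, rfl⟩, mul_zero, mul_zero]
    · rw [H.quantizedPullback_dir hω.1, hb]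
      rfl

/-- A balanced `ω` without mass at the Gauss point has no mass at its image. -/
theorem mem_M1dag_of_balanced {ω : cells (vertices h) → ℝ≥0∞} (hω : ω ∈ M1 (vertices h))
    (hb : QuantizedBalanced h ω) (h₀ : mass ω {gauss} = 0) : ω ∈ M1dag (vertices h) := by
  refine ⟨hω, ?_⟩
  rintro ⟨V, hV⟩ ⟨S, hS, h1⟩
  obtain rfl : V = {S} := h1
  rcases hS with rfl | hS
  · rwa [mass_cell ω hV] at h₀
  · rw [mem_singleton_iff] at hS
    subst hS
    -- At the cell `{𝒮_G}` the balance relation equates the mass at `h(𝒮_G)`, times a nonzero local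
    -- degree, with a multiple of the mass at `𝒮_G`.
    have h2 := congrFun hb ⟨{gauss}, singleton_gauss_mem_cells (mem_singleton _)⟩
    rw [H.quantizedPullback_gauss] at h2
    change _ = _ * mass ω {gauss} at h2
    rw [h₀, mul_zero, mul_eq_zero] at h2
    exact h2.resolve_left (Nat.cast_ne_zero.2 H.gaussDegree_ne_zero)

/-! ### The case `h(𝒮_G) = 𝒮_G` -/

section Fixed

variable (hfix : berkMap h gauss = gauss)

include hfix

theorem berkMap_gauss_of_fix : berkMap B gauss = gauss := by
  have := H.berkMap_vertex
  rwa [hfix] at this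

omit H in
theorem vertices_of_fix : vertices h = {gauss} := by
  change {gauss, berkMap h gauss} = _
  rw [hfix, pair_eq_singleton]

theorem dirVia_phi (x : OnePoint ℂ) : dirVia B (phi B x) = dir x := by
  rw [H.dirVia_eq, dir_eq_residueDisc,
    preimage_residueDisc_phi H.ratDegree_eq (H.berkMap_gauss_of_fix hfix)]

/-- Here `H_B̃` has no zeros and `φ_B̃` has local degree one everywhere, so the pullback merely
transports point masses. -/
theorem admissible_iff_of_fix {μ : Measure (OnePoint ℂ) × Measure (OnePoint ℂ)}
    (h₁ : AtomicProb μ.1) (h₂ : AtomicProb μ.2) :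
    Admissible h B μ ↔ ∀ x, μ.2 {phi B x} = μ.1 {x} := by
  have hBfix := H.berkMap_gauss_of_fix hfix
  rw [Admissible, if_pos hfix]
  have := h₁.redPullback_eq_mul_iff h₂ hBfix 1
  simpa only [one_mul, localDegree_eq_one_of_fix H.ratDegree_eq hBfix, Nat.cast_one,
    ordH_eq_zero_of_fix H.ratDegree_eq hBfix, Nat.cast_zero, add_zero] using this

theorem omegaOf_of_fix {μ : Measure (OnePoint ℂ) × Measure (OnePoint ℂ)} (h₂ : AtomicProb μ.2) :
    (∀ V : cells (vertices h), V.1 = {gauss} → omegaOf h B μ V = 0) ∧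
    ∀ (V : cells (vertices h)) x, V.1 = dir x → omegaOf h B μ V = μ.2 {phi B x} := by
  constructor
  · intro V hV
    rw [omegaOf, if_pos hfix, if_pos hV, h₂.diffuseMass_eq_zero]
  · intro V x hV
    rw [omegaOf, if_pos hfix, if_neg (hV ▸ dir_ne_singleton_gauss x)]
    rw [epsilon_eq_of_injective H.dirVia_injective (hV.trans (H.dirVia_phi hfix x).symm)]

theorem omegaOf_spec_of_fix {μ : Measure (OnePoint ℂ) × Measure (OnePoint ℂ)}
    (h₁ : AtomicProb μ.1) (h₂ : AtomicProb μ.2) (ha : Admissible h B μ) :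
    omegaOf h B μ ∈ M1dag (vertices h) ∧ (∀ x, mass (omegaOf h B μ) (dir x) = μ.1 {x}) ∧
      ∀ y, mass (omegaOf h B μ) (dirVia B y) = μ.2 {y} := by
  rw [H.admissible_iff_of_fix hfix h₁ h₂] at ha
  obtain ⟨hω₀, hω⟩ := H.omegaOf_of_fix hfix h₂
  simp_rw [ha] at hω
  have hmass : ∀ x, mass (omegaOf h B μ) (dir x) = μ.1 {x} := by
    intro x
    have hx : dir x ∈ cells (vertices h) := by
      rw [vertices_of_fix hfix]
      exact dir_mem_cells_gauss x
    rw [mass_cell _ hx, hω ⟨dir x, hx⟩ x rfl]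
  refine ⟨?_, hmass, fun y => ?_⟩
  -- The type of `ω` depends on `vertices h`, so `ω` is generalized before that set is rewritten as
  -- `{gauss}`.
  · revert hω₀ hω
    generalize omegaOf h B μ = ω
    revert ω
    rw [vertices_of_fix hfix]
    intro ω hω₀ hω
    exact mem_M1dag_gauss h₁.tsum_singleton (hω₀ _ rfl) fun x => hω _ x rfl
  · obtain ⟨x, rfl⟩ := (phi_bijective H.ratDegree_eq (H.berkMap_gauss_of_fix hfix)).2 y
    rw [H.dirVia_phi hfix, hmass, ha]

theorem muOf_spec_of_fix {ω : cells (vertices h) → ℝ≥0∞} (hω : ω ∈ M1dag (vertices h)) :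
    AtomicProb (muOf h B ω).1 ∧ AtomicProb (muOf h B ω).2 ∧
      (∀ x, (muOf h B ω).1 {x} = mass ω (dir x)) ∧
      (∀ y, (muOf h B ω).2 {y} = mass ω (dirVia B y)) ∧ Admissible h B (muOf h B ω) ∧
      omegaOf h B (muOf h B ω) = ω := by
  have h₁ : AtomicProb (muOf h B ω).1 := by
    rw [muOf, if_pos hfix]
    exact atomicProb_atomicMeasure (tsum_mass_dir hω (gauss_mem_vertices h))
  have h12 : (muOf h B ω).2 = (muOf h B ω).1.map (phi B) := by
    rw [muOf, if_pos hfix]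
  have h₂ : AtomicProb (muOf h B ω).2 := by
    rw [h12]
    exact h₁.map _
  have hm₁ : ∀ x, (muOf h B ω).1 {x} = mass ω (dir x) := by
    intro x
    rw [muOf, if_pos hfix]
    exact atomicMeasure_singleton _ x
  have hphi := phi_bijective H.ratDegree_eq (H.berkMap_gauss_of_fix hfix)
  have hm₂' : ∀ x, (muOf h B ω).2 {phi B x} = (muOf h B ω).1 {x} := by
    intro x
    rw [h12, Measure.map_apply_of_aemeasurable (h₁.aemeasurable _) (measurableSet_singleton _)]
    congr 1
    ext z
    exact hphi.1.eq_iff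
  have hm₂ : ∀ y, (muOf h B ω).2 {y} = mass ω (dirVia B y) := by
    intro y
    obtain ⟨x, rfl⟩ := hphi.2 y
    rw [hm₂', hm₁, H.dirVia_phi hfix]
  have hadm := (H.admissible_iff_of_fix hfix h₁ h₂).2 hm₂'
  refine ⟨h₁, h₂, hm₁, hm₂, hadm, ?_⟩
  obtain ⟨hω₀, hω'⟩ := H.omegaOf_of_fix hfix h₂
  funext ⟨V, hV⟩
  have hV' := hV
  rw [vertices_of_fix hfix] at hV'
  rcases cells_gauss_cases hV' with rfl | ⟨x, rfl⟩
  · rw [hω₀ _ rfl, hω.2 _ ⟨gauss, gauss_mem_vertices h, rfl⟩]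
  · rw [hω' _ x rfl, hm₂', hm₁, mass_cell ω hV]

end Fixed

/-! ### The case `h(𝒮_G) ≠ 𝒮_G` -/

section Moved

variable (hne : berkMap h gauss ≠ gauss)

include hne

theorem berkMap_gauss_ne : berkMap B gauss ≠ gauss := fun h0 =>
  hne ((berkMap_bijective H.ratDegree_eq).1 (H.berkMap_vertex.trans h0.symm))

/-- The directions by which the two vertices face each other cover `𝖯¹`. The positions of the
vertices and the inclusions between directions follow from this. -/
theorem mem_dirVia_of_notMem_dir {S : BerkovichP1 𝕃} (hS : S ∉ dir (hPoint B)) :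
    S ∈ dirVia B (aPoint B) := by
  rw [dir_eq_residueDisc] at hS
  exact H.mem_dirVia.2 ((separation H.ratDegree_eq (H.berkMap_gauss_ne hne)).1 S hS)

theorem berkMap_gauss_mem_dir : berkMap h gauss ∈ dir (hPoint B) := by
  by_contra h0
  have := H.mem_dirVia.1 (H.mem_dirVia_of_notMem_dir hne h0)
  rw [H.berkMap_vertex] at this
  exact gauss_notMem_residueDisc _ this

theorem gauss_mem_dirVia : gauss ∈ dirVia B (aPoint B) :=
  H.mem_dirVia_of_notMem_dir hne (by
    rw [dir_eq_residueDisc]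
    exact gauss_notMem_residueDisc _)

omit H hne in
theorem dir_eq_of_mem {S : BerkovichP1 𝕃} {x y : OnePoint ℂ} (hx : S ∈ dir x) (hy : S ∈ dir y) :
    x = y := by
  rw [dir_eq_residueDisc] at hx hy
  exact residueDisc_disjoint hx hy

omit hne in
theorem dirVia_eq_of_mem {S : BerkovichP1 𝕃} {x y : OnePoint ℂ} (hx : S ∈ dirVia B x)
    (hy : S ∈ dirVia B y) : x = y :=
  residueDisc_disjoint (H.mem_dirVia.1 hx) (H.mem_dirVia.1 hy)

theorem dirVia_subset_dir {y : OnePoint ℂ} (hy : y ≠ aPoint B) : dirVia B y ⊆ dir (hPoint B) := by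
  intro S hS
  by_contra h0
  exact hy (H.dirVia_eq_of_mem hS (H.mem_dirVia_of_notMem_dir hne h0))

theorem dir_subset_dirVia {x : OnePoint ℂ} (hx : x ≠ hPoint B) : dir x ⊆ dirVia B (aPoint B) :=
  fun _ hS => H.mem_dirVia_of_notMem_dir hne fun h0 => hx (dir_eq_of_mem hS h0)

omit hne in
theorem isOpen_dirVia (y : OnePoint ℂ) : IsOpen (dirVia B y) := by
  rw [H.dirVia_eq]
  exact (isOpen_residueDisc y).preimage (continuous_berkMap H.ratDegree_eq)

omit H hne in
theorem isOpen_dir (x : OnePoint ℂ) : IsOpen (dir x) := by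
  rw [dir_eq_residueDisc]
  exact isOpen_residueDisc x

omit hne in
theorem notMem_vertices_iff {S : BerkovichP1 𝕃} :
    S ∉ vertices h ↔ S ≠ gauss ∧ S ≠ berkMap h gauss := by
  rw [vertices, mem_insert_iff, mem_singleton_iff, not_or]

omit hne in
theorem exists_mem_dir_dirVia {S : BerkovichP1 𝕃} (hS : S ∉ vertices h) :
    (∃ x, S ∈ dir x) ∧ ∃ y, S ∈ dirVia B y := by
  rw [H.notMem_vertices_iff] at hS
  constructor
  · obtain ⟨x, hx⟩ := exists_mem_residueDisc hS.1
    exact ⟨x, by rwa [dir_eq_residueDisc]⟩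
  · have h1 : berkMap B S ≠ gauss := fun h0 =>
      hS.2 ((berkMap_bijective H.ratDegree_eq).1 (h0.trans H.berkMap_vertex.symm))
    obtain ⟨y, hy⟩ := exists_mem_residueDisc h1
    exact ⟨y, H.mem_dirVia.2 hy⟩

theorem dir_subset_compl {x : OnePoint ℂ} (hx : x ≠ hPoint B) : dir x ⊆ (vertices h)ᶜ := by
  intro T hT
  refine H.notMem_vertices_iff.2 ⟨?_, ?_⟩
  · rintro rfl
    rw [dir_eq_residueDisc] at hT
    exact gauss_notMem_residueDisc x hT
  · rintro rfl
    exact hx (dir_eq_of_mem hT (H.berkMap_gauss_mem_dir hne))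

theorem dirVia_subset_compl {y : OnePoint ℂ} (hy : y ≠ aPoint B) :
    dirVia B y ⊆ (vertices h)ᶜ := by
  intro T hT
  refine H.notMem_vertices_iff.2 ⟨?_, ?_⟩
  · rintro rfl
    exact hy (H.dirVia_eq_of_mem hT (H.gauss_mem_dirVia hne))
  · rintro rfl
    rw [H.mem_dirVia, H.berkMap_vertex] at hT
    exact gauss_notMem_residueDisc y hT

omit hne in
theorem inter_subset_compl : dir (hPoint B) ∩ dirVia B (aPoint B) ⊆ (vertices h)ᶜ := by
  intro T hT
  refine H.notMem_vertices_iff.2 ⟨?_, ?_⟩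
  · rintro rfl
    have := hT.1
    rw [dir_eq_residueDisc] at this
    exact gauss_notMem_residueDisc _ this
  · rintro rfl
    have := H.mem_dirVia.1 hT.2
    rw [H.berkMap_vertex] at this
    exact gauss_notMem_residueDisc _ this

theorem dir_mem_cells {x : OnePoint ℂ} (hx : x ≠ hPoint B) : dir x ∈ cells (vertices h) := by
  obtain ⟨S, hS⟩ := residueDisc_nonempty x
  have hsub := H.dir_subset_compl hne hx
  rw [← dir_eq_residueDisc] at hS
  refine Or.inr ⟨S, hsub hS, (Eq.symm ?_)⟩
  refine Subset.antisymm ?_ (IsPreconnected.subset_connectedComponentIn ?_ hS hsub)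
  · have := connectedComponentIn_mono S
      (compl_subset_compl.2 (singleton_subset_iff.2 (gauss_mem_vertices h)))
    rw [dir_eq_residueDisc] at hS ⊢
    rwa [connectedComponentIn_gauss hS] at this
  · rw [dir_eq_residueDisc]
    exact isPreconnected_residueDisc x

theorem dirVia_mem_cells {y : OnePoint ℂ} (hy : y ≠ aPoint B) :
    dirVia B y ∈ cells (vertices h) := by
  obtain ⟨T, hT⟩ := residueDisc_nonempty y
  obtain ⟨S, rfl⟩ := (berkMap_bijective H.ratDegree_eq).2 T
  have hsub := H.dirVia_subset_compl hne hy
  have hcomp := connectedComponentIn_mobius H.ratDegree_eq H.berkMap_vertex hT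
  rw [← H.dirVia_eq] at hcomp
  refine Or.inr ⟨S, hsub (H.mem_dirVia.2 hT), (Eq.symm ?_)⟩
  refine Subset.antisymm ?_ (IsPreconnected.subset_connectedComponentIn ?_ (H.mem_dirVia.2 hT) hsub)
  · have := connectedComponentIn_mono S
      (compl_subset_compl.2 (singleton_subset_iff.2 (berkMap_gauss_mem_vertices h)))
    rwa [hcomp] at this
  · rw [← hcomp]
    exact isPreconnected_connectedComponentIn

/-- The component of the complement of `Γ_h` between the two vertices. -/
theorem inter_mem_cells : dir (hPoint B) ∩ dirVia B (aPoint B) ∈ cells (vertices h) := by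
  obtain ⟨-, hconn, hnon⟩ := separation H.ratDegree_eq (H.berkMap_gauss_ne hne)
  rw [← dir_eq_residueDisc (hPoint B), ← H.dirVia_eq (aPoint B)] at hconn hnon
  obtain ⟨S, hS⟩ := hnon
  have hsub := H.inter_subset_compl
  refine Or.inr ⟨S, hsub hS, (Eq.symm ?_)⟩
  refine connectedComponentIn_eq_of_isOpen
    (V := (⋃ x ≠ hPoint B, dir x) ∪ ⋃ y ≠ aPoint B, dirVia B y) hS hsub
    ((isOpen_dir _).inter (H.isOpen_dirVia _)) hconn
    ((isOpen_biUnion fun x _ => isOpen_dir x).union (isOpen_biUnion fun y _ => H.isOpen_dirVia y))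
    ?_ ?_
  · intro T hT
    obtain ⟨⟨x, hx⟩, y, hy⟩ := H.exists_mem_dir_dirVia hT
    by_cases hx' : x = hPoint B
    · by_cases hy' : y = aPoint B
      · exact Or.inl ⟨hx' ▸ hx, hy' ▸ hy⟩
      · exact Or.inr (Or.inr (mem_biUnion (x := y) hy' hy))
    · exact Or.inr (Or.inl (mem_biUnion (x := x) hx' hx))
  · rw [Set.disjoint_left]
    rintro T ⟨h1, h2⟩ (h3 | h3)
    · simp only [mem_iUnion] at h3
      obtain ⟨x, hx, hT⟩ := h3
      exact hx (dir_eq_of_mem hT h1)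
    · simp only [mem_iUnion] at h3
      obtain ⟨y, hy, hT⟩ := h3
      exact hy (H.dirVia_eq_of_mem hT h2)

/-- A point off the vertices lies in one direction at each of them. Either one of these is not a
facing direction, hence is itself a cell, or the point lies in the annulus. -/
theorem cells_cases {V : Set (BerkovichP1 𝕃)} (hV : V ∈ cells (vertices h)) :
    (∃ S ∈ vertices h, V = {S}) ∨ (∃ x ≠ hPoint B, V = dir x) ∨ (∃ y ≠ aPoint B, V = dirVia B y) ∨
      V = dir (hPoint B) ∩ dirVia B (aPoint B) := by
  rcases hV with h1 | ⟨S, hS, h1⟩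
  · exact Or.inl h1
  · have hV : V ∈ cells (vertices h) := Or.inr ⟨S, hS, h1⟩
    have hSV : S ∈ V := h1 ▸ mem_connectedComponentIn hS
    obtain ⟨⟨x, hx⟩, y, hy⟩ := H.exists_mem_dir_dirVia hS
    right
    by_cases hx' : x = hPoint B
    · subst hx'
      by_cases hy' : y = aPoint B
      · subst hy'
        exact Or.inr (Or.inr (cell_eq_of_mem hV (H.inter_mem_cells hne) hSV ⟨hx, hy⟩))
      · exact Or.inr (Or.inl ⟨y, hy', cell_eq_of_mem hV (H.dirVia_mem_cells hne hy') hSV hy⟩)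
    · exact Or.inl ⟨x, hx', cell_eq_of_mem hV (H.dir_mem_cells hne hx') hSV hx⟩

/-- The masses of the two directions which contain the component between the vertices. -/
theorem mass_add_mass {ω : cells (vertices h) → ℝ≥0∞} (hω : ω ∈ M1dag (vertices h)) :
    mass ω (dir (hPoint B)) + mass ω (dirVia B (aPoint B)) =
      1 + ω ⟨_, H.inter_mem_cells hne⟩ := by
  have h1 : ∑' V, ω V = 1 := hω.1
  rw [← mass_cell ω (H.inter_mem_cells hne), ← h1]
  simp only [mass]
  rw [← ENNReal.tsum_add, ← ENNReal.tsum_add]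
  refine tsum_congr fun V => ?_
  by_cases hV : ω V = 0
  · simp [hV]
  -- Inclusion–exclusion, cell by cell: a cell carrying mass lies in at least one of the two
  -- directions, and in both exactly when it lies in their intersection.
  have h2 : V.1 ⊆ dir (hPoint B) ∨ V.1 ⊆ dirVia B (aPoint B) := by
    rcases H.cells_cases hne V.2 with h3 | ⟨x, hx, h3⟩ | ⟨y, hy, h3⟩ | h3
    · exact absurd (hω.2 V h3) hV
    · exact Or.inr (h3 ▸ H.dir_subset_dirVia hne hx)
    · exact Or.inl (h3 ▸ H.dirVia_subset_dir hne hy)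
    · exact Or.inl (h3 ▸ inter_subset_left)
  simp only [subset_inter_iff]
  by_cases ha : V.1 ⊆ dir (hPoint B) <;> by_cases hb : V.1 ⊆ dirVia B (aPoint B)
  · simp [ha, hb]
  · simp [ha, hb]
  · simp [ha, hb]
  · exact absurd h2 (by simp [ha, hb])

section

variable {μ : Measure (OnePoint ℂ) × Measure (OnePoint ℂ)}

theorem omegaOf_vertex (h₁ : AtomicProb μ.1) (h₂ : AtomicProb μ.2) {V : cells (vertices h)}
    (hV : ∃ S ∈ vertices h, V.1 = {S}) : omegaOf h B μ V = 0 := by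
  obtain ⟨S, hS, h3⟩ := hV
  rw [omegaOf, if_neg hne]
  rcases hS with rfl | hS
  · rw [if_pos h3, h₁.diffuseMass_eq_zero]
  · rw [mem_singleton_iff] at hS
    subst hS
    rw [if_neg, if_pos h3, h₂.diffuseMass_eq_zero]
    rw [h3]
    exact fun h0 => hne (singleton_eq_singleton_iff.1 h0)

theorem omegaOf_eq_of_notMem {V : cells (vertices h)} (hV : V.1 ⊆ (vertices h)ᶜ) : omegaOf h B μ V =
      if ∃ x, x ≠ hPoint B ∧ V.1 = dir x then μ.1 {Classical.epsilon fun x => V.1 = dir x}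
      else if ∃ y, y ≠ aPoint B ∧ V.1 = dirVia B y then
        μ.2 {Classical.epsilon fun y => V.1 = dirVia B y}
      else μ.1 {hPoint B} + μ.2 {aPoint B} - 1 := by
  have h₁' : V.1 ≠ {gauss} := fun h0 =>
    hV (h0 ▸ mem_singleton _) (gauss_mem_vertices h)
  have h₂' : V.1 ≠ {berkMap h gauss} := fun h0 =>
    hV (h0 ▸ mem_singleton _) (berkMap_gauss_mem_vertices h)
  rw [omegaOf, if_neg hne, if_neg h₁', if_neg h₂']

theorem omegaOf_dir {V : cells (vertices h)} {x : OnePoint ℂ} (hx : x ≠ hPoint B)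
    (hV : V.1 = dir x) : omegaOf h B μ V = μ.1 {x} := by
  rw [H.omegaOf_eq_of_notMem hne, if_pos ⟨x, hx, hV⟩]
  · rw [epsilon_eq_of_injective dir_injective hV]
  · rw [hV]
    exact H.dir_subset_compl hne hx

theorem omegaOf_dirVia {V : cells (vertices h)} {y : OnePoint ℂ} (hy : y ≠ aPoint B)
    (hV : V.1 = dirVia B y) : omegaOf h B μ V = μ.2 {y} := by
  rw [H.omegaOf_eq_of_notMem hne, if_neg, if_pos ⟨y, hy, hV⟩]
  · rw [epsilon_eq_of_injective H.dirVia_injective hV]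
  · rintro ⟨x, hx, h1⟩
    obtain ⟨S, hS⟩ := cell_nonempty V.2
    exact hx (dir_eq_of_mem (h1 ▸ hS) (H.dirVia_subset_dir hne hy (hV ▸ hS)))
  · rw [hV]
    exact H.dirVia_subset_compl hne hy

theorem omegaOf_inter {V : cells (vertices h)} (hV : V.1 = dir (hPoint B) ∩ dirVia B (aPoint B)) :
    omegaOf h B μ V = μ.1 {hPoint B} + μ.2 {aPoint B} - 1 := by
  obtain ⟨S, hS⟩ := cell_nonempty V.2
  have hS' : S ∈ dir (hPoint B) ∩ dirVia B (aPoint B) := hV ▸ hS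
  rw [H.omegaOf_eq_of_notMem hne, if_neg, if_neg]
  · rintro ⟨y, hy, h1⟩
    exact hy (H.dirVia_eq_of_mem (h1 ▸ hS) hS'.2)
  · rintro ⟨x, hx, h1⟩
    exact hx (dir_eq_of_mem (h1 ▸ hS) hS'.1)
  · rw [hV]
    exact H.inter_subset_compl

/-- The total mass is `(1 - μ_C{h_B}) + (1 - μ_E{a_B}) + (μ_C{h_B} + μ_E{a_B} - 1)`; the auxiliary
formula for `omegaOf` as a sum of indicators separates the three families of cells. -/
theorem tsum_omegaOf (h₁ : AtomicProb μ.1) (h₂ : AtomicProb μ.2) (ha : Admissible h B μ) :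
    ∑' V, omegaOf h B μ V = 1 := by
  have hW := H.inter_mem_cells hne
  have hω : ∀ V : cells (vertices h), omegaOf h B μ V =
      (∑' x, if V.1 = dir x then (if x = hPoint B then 0 else μ.1 {x}) else 0) +
      (∑' y, if V.1 = dirVia B y then (if y = aPoint B then 0 else μ.2 {y}) else 0) +
      if V = ⟨_, hW⟩ then μ.1 {hPoint B} + μ.2 {aPoint B} - 1 else 0 := by
    rintro ⟨V, hV⟩
    have hz₁ : (∀ x, x ≠ hPoint B → V ≠ dir x) →
        (∑' x, if V = dir x then (if x = hPoint B then 0 else μ.1 {x}) else 0) = 0 := by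
      intro h0
      refine ENNReal.tsum_eq_zero.2 fun x => ?_
      by_cases hx : x = hPoint B
      · simp [hx]
      · rw [if_neg (h0 x hx)]
    have hz₂ : (∀ y, y ≠ aPoint B → V ≠ dirVia B y) →
        (∑' y, if V = dirVia B y then (if y = aPoint B then 0 else μ.2 {y}) else 0) = 0 := by
      intro h0
      refine ENNReal.tsum_eq_zero.2 fun y => ?_
      by_cases hy : y = aPoint B
      · simp [hy]
      · rw [if_neg (h0 y hy)]
    have hz₃ : V ≠ dir (hPoint B) ∩ dirVia B (aPoint B) →
        (⟨V, hV⟩ : cells (vertices h)) ≠ ⟨_, hW⟩ := fun h0 h1 => h0 (congrArg Subtype.val h1)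
    obtain ⟨T, hT⟩ := cell_nonempty hV
    rcases H.cells_cases hne hV with ⟨S, hS, rfl⟩ | ⟨x, hx, rfl⟩ | ⟨y, hy, rfl⟩ | h3
    · have hsing : ∀ U, U ⊆ (vertices h)ᶜ → {S} ≠ U := fun U h1 h2 => h1 (h2 ▸ mem_singleton S) hS
      rw [H.omegaOf_vertex hne h₁ h₂ ⟨S, hS, rfl⟩,
        hz₁ fun x hx => hsing _ (H.dir_subset_compl hne hx),
        hz₂ fun y hy => hsing _ (H.dirVia_subset_compl hne hy),
        if_neg (hz₃ (hsing _ H.inter_subset_compl)), add_zero, add_zero]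
    · rw [H.omegaOf_dir hne hx rfl, tsum_eq_single x, if_pos rfl, if_neg hx, hz₂, if_neg (hz₃ _),
        add_zero, add_zero]
      · exact fun h0 => hx (dir_eq_of_mem hT (h0 ▸ hT : T ∈ dir (hPoint B) ∩ _).1)
      · exact fun y hy h0 => hx (dir_eq_of_mem hT (H.dirVia_subset_dir hne hy (h0 ▸ hT)))
      · exact fun z hz => if_neg fun h0 => hz (dir_injective h0).symm
    · rw [H.omegaOf_dirVia hne hy rfl, hz₁, tsum_eq_single y, if_pos rfl, if_neg hy, if_neg (hz₃ _),
        zero_add, add_zero]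
      · exact fun h0 => hy (H.dirVia_eq_of_mem hT (h0 ▸ hT : T ∈ _ ∩ dirVia B (aPoint B)).2)
      · exact fun z hz => if_neg fun h0 => hz (H.dirVia_injective h0).symm
      · exact fun x hx h0 => hx (dir_eq_of_mem (h0 ▸ hT) (H.dirVia_subset_dir hne hy hT))
    · subst h3
      rw [H.omegaOf_inter hne rfl, hz₁, hz₂, if_pos rfl, zero_add, zero_add]
      · exact fun y hy h0 => hy (H.dirVia_eq_of_mem (h0 ▸ hT) hT.2)
      · exact fun x hx h0 => hx (dir_eq_of_mem (h0 ▸ hT) hT.1)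
  have hS₁ : ∀ x, (∑' V : cells (vertices h),
      if V.1 = dir x then (if x = hPoint B then 0 else μ.1 {x}) else 0) =
        if x = hPoint B then 0 else μ.1 {x} := by
    intro x
    by_cases hx : x = hPoint B
    · simp [hx]
    · rw [tsum_eq_single ⟨dir x, H.dir_mem_cells hne hx⟩, if_pos rfl]
      exact fun V hV => if_neg fun h0 => hV (Subtype.ext h0)
  have hS₂ : ∀ y, (∑' V : cells (vertices h),
      if V.1 = dirVia B y then (if y = aPoint B then 0 else μ.2 {y}) else 0) =
        if y = aPoint B then 0 else μ.2 {y} := by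
    intro y
    by_cases hy : y = aPoint B
    · simp [hy]
    · rw [tsum_eq_single ⟨dirVia B y, H.dirVia_mem_cells hne hy⟩, if_pos rfl]
      exact fun V hV => if_neg fun h0 => hV (Subtype.ext h0)
  simp_rw [hω]
  rw [ENNReal.tsum_add, ENNReal.tsum_add, ENNReal.tsum_comm, tsum_congr hS₁, ENNReal.tsum_comm,
    tsum_congr hS₂, tsum_ite_eq]
  have e₁ := h₁.tsum_singleton
  have e₂ := h₂.tsum_singleton
  rw [ENNReal.tsum_eq_add_tsum_ite (hPoint B)] at e₁
  rw [ENNReal.tsum_eq_add_tsum_ite (aPoint B)] at e₂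
  rw [Admissible, if_neg hne] at ha
  -- Adding one to both sides removes the truncated subtraction, which is exact by admissibility.
  refine (ENNReal.add_left_inj ENNReal.one_ne_top).1 ?_
  rw [add_assoc, tsub_add_cancel_of_le ha]
  refine Eq.trans ?_ (congrArg₂ (fun a b => a + b) e₁ e₂)
  ring

theorem omegaOf_spec_of_ne (h₁ : AtomicProb μ.1) (h₂ : AtomicProb μ.2) (ha : Admissible h B μ) :
    omegaOf h B μ ∈ M1dag (vertices h) ∧ (∀ x, mass (omegaOf h B μ) (dir x) = μ.1 {x}) ∧
      ∀ y, mass (omegaOf h B μ) (dirVia B y) = μ.2 {y} := by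
  have hω : omegaOf h B μ ∈ M1dag (vertices h) :=
    ⟨H.tsum_omegaOf hne h₁ h₂ ha, fun V hV => H.omegaOf_vertex hne h₁ h₂ hV⟩
  refine ⟨hω, congrFun ?_, congrFun ?_⟩
  -- All directions at `𝒮_G` other than `h_B` are cells; the mass of the last one is forced by the
  -- total mass.
  · refine eq_of_tsum_eq_one (a := hPoint B) (tsum_mass_dir hω (gauss_mem_vertices h))
      h₁.tsum_singleton fun x hx => ?_
    rw [mass_cell _ (H.dir_mem_cells hne hx), H.omegaOf_dir hne hx rfl]
  · refine eq_of_tsum_eq_one (a := aPoint B) (H.tsum_mass_dirVia hω)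
      h₂.tsum_singleton fun y hy => ?_
    rw [mass_cell _ (H.dirVia_mem_cells hne hy), H.omegaOf_dirVia hne hy rfl]

end

theorem muOf_spec_of_ne {ω : cells (vertices h) → ℝ≥0∞} (hω : ω ∈ M1dag (vertices h)) :
    AtomicProb (muOf h B ω).1 ∧ AtomicProb (muOf h B ω).2 ∧
      (∀ x, (muOf h B ω).1 {x} = mass ω (dir x)) ∧
      (∀ y, (muOf h B ω).2 {y} = mass ω (dirVia B y)) ∧ Admissible h B (muOf h B ω) ∧
      omegaOf h B (muOf h B ω) = ω := by
  have h₁ : AtomicProb (muOf h B ω).1 := by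
    rw [muOf, if_neg hne]
    exact atomicProb_atomicMeasure (tsum_mass_dir hω (gauss_mem_vertices h))
  have h₂ : AtomicProb (muOf h B ω).2 := by
    rw [muOf, if_neg hne]
    exact atomicProb_atomicMeasure (H.tsum_mass_dirVia hω)
  have hm₁ : ∀ x, (muOf h B ω).1 {x} = mass ω (dir x) := by
    intro x
    rw [muOf, if_neg hne]
    exact atomicMeasure_singleton _ x
  have hm₂ : ∀ y, (muOf h B ω).2 {y} = mass ω (dirVia B y) := by
    intro y
    rw [muOf, if_neg hne]
    exact atomicMeasure_singleton _ y
  have hsum := H.mass_add_mass hne hω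
  refine ⟨h₁, h₂, hm₁, hm₂, ?_, ?_⟩
  -- The sum in the admissibility condition is one plus the mass of the annulus.
  · rw [Admissible, if_neg hne, hm₁, hm₂, hsum]
    exact le_self_add
  · funext ⟨V, hV⟩
    rcases H.cells_cases hne hV with h3 | ⟨x, hx, rfl⟩ | ⟨y, hy, rfl⟩ | h3
    · rw [H.omegaOf_vertex hne h₁ h₂ h3, hω.2 _ h3]
    · rw [H.omegaOf_dir hne hx rfl, hm₁, mass_cell ω hV]
    · rw [H.omegaOf_dirVia hne hy rfl, hm₂, mass_cell ω hV]
    · subst h3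
      rw [H.omegaOf_inter hne rfl, hm₁, hm₂, hsum, ENNReal.add_sub_cancel_left ENNReal.one_ne_top]

end Moved

/-! ### The bijection -/

theorem omegaOf_spec {μ : Measure (OnePoint ℂ) × Measure (OnePoint ℂ)}
    (h₁ : AtomicProb μ.1) (h₂ : AtomicProb μ.2) (ha : Admissible h B μ) :
    omegaOf h B μ ∈ M1dag (vertices h) ∧ (∀ x, mass (omegaOf h B μ) (dir x) = μ.1 {x}) ∧
      ∀ y, mass (omegaOf h B μ) (dirVia B y) = μ.2 {y} := by
  by_cases hfix : berkMap h gauss = gauss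
  · exact H.omegaOf_spec_of_fix hfix h₁ h₂ ha
  · exact H.omegaOf_spec_of_ne hfix h₁ h₂ ha

theorem muOf_spec {ω : cells (vertices h) → ℝ≥0∞} (hω : ω ∈ M1dag (vertices h)) :
    AtomicProb (muOf h B ω).1 ∧ AtomicProb (muOf h B ω).2 ∧
      (∀ x, (muOf h B ω).1 {x} = mass ω (dir x)) ∧
      (∀ y, (muOf h B ω).2 {y} = mass ω (dirVia B y)) ∧ Admissible h B (muOf h B ω) ∧
      omegaOf h B (muOf h B ω) = ω := by
  by_cases hfix : berkMap h gauss = gauss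
  · exact H.muOf_spec_of_fix hfix hω
  · exact H.muOf_spec_of_ne hfix hω

theorem omegaOf_mem {μ : Measure (OnePoint ℂ) × Measure (OnePoint ℂ)}
    (hμ : μ ∈ balancedPairs h B) : omegaOf h B μ ∈ balancedQuantized h := by
  obtain ⟨h₁, h₂, ha, hb⟩ := hμ
  obtain ⟨hω, hm₁, hm₂⟩ := H.omegaOf_spec h₁ h₂ ha
  refine ⟨hω, (H.quantizedBalanced_iff hω).2 fun x => ?_⟩
  rw [hm₁, hm₂]
  exact (H.reducedBalanced_iff h₁ h₂).1 hb x

theorem muOf_mem {ω : cells (vertices h) → ℝ≥0∞} (hω : ω ∈ balancedQuantized h) :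
    muOf h B ω ∈ balancedPairs h B := by
  obtain ⟨h₁, h₂, hm₁, hm₂, ha, -⟩ := H.muOf_spec hω.1
  refine ⟨h₁, h₂, ha, (H.reducedBalanced_iff h₁ h₂).2 fun x => ?_⟩
  rw [hm₁, hm₂]
  exact (H.quantizedBalanced_iff hω.1).1 hω.2 x

theorem invOn : InvOn (muOf h B) (omegaOf h B) (balancedPairs h B) (balancedQuantized h) := by
  constructor
  · intro μ hμ
    obtain ⟨hω, hm₁, hm₂⟩ := H.omegaOf_spec hμ.1 hμ.2.1 hμ.2.2.1
    obtain ⟨h₁, h₂, hm₁', hm₂', -⟩ := H.muOf_spec hω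
    refine Prod.ext (h₁.ext hμ.1 fun x => ?_) (h₂.ext hμ.2.1 fun y => ?_)
    · rw [hm₁', hm₁]
    · rw [hm₂', hm₂]
  · intro ω hω
    exact (H.muOf_spec hω.1).2.2.2.2.2

theorem bijOn : BijOn (omegaOf h B) (balancedPairs h B) (balancedQuantized h) :=
  H.invOn.bijOn (fun _ hμ => H.omegaOf_mem hμ) fun _ hω => H.muOf_mem hω

end Rescales

/-! ### Projection to `Γ_G` and the limit sets -/

/-- The element of `M¹(Γ_G)` with the masses of the atoms of `μ`. -/
def gaussProj (μ : Measure (OnePoint ℂ)) : cells {gauss} → ℝ≥0∞ := fun U =>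
  if U.1 = {gauss} then 0 else μ {dirCoord U.1}

theorem gaussProj_gauss (μ : Measure (OnePoint ℂ)) :
    gaussProj μ ⟨{gauss}, singleton_gauss_mem_cells (mem_singleton _)⟩ = 0 := if_pos rfl

theorem gaussProj_dir (μ : Measure (OnePoint ℂ)) (x : OnePoint ℂ) :
    gaussProj μ ⟨dir x, dir_mem_cells_gauss x⟩ = μ {x} := by
  rw [gaussProj, if_neg (dir_ne_singleton_gauss x), dirCoord_dir]

theorem cells_gauss_funext {ω ω' : cells {gauss} → ℝ≥0∞}
    (h₀ : ω ⟨{gauss}, singleton_gauss_mem_cells (mem_singleton _)⟩ =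
      ω' ⟨{gauss}, singleton_gauss_mem_cells (mem_singleton _)⟩)
    (h : ∀ x, ω ⟨dir x, dir_mem_cells_gauss x⟩ = ω' ⟨dir x, dir_mem_cells_gauss x⟩) : ω = ω' := by
  funext ⟨V, hV⟩
  rcases cells_gauss_cases hV with rfl | ⟨x, rfl⟩
  · exact h₀
  · exact h x

/-- Since `gaussProj` sees only `μ_C`, this equality contains the independence of the projected
measure from `n` and from the choice of `μ_E`. -/
theorem Rescales.gaussProj_eq {B h : RatFunc 𝕃} (H : Rescales B h)
    {μ : Measure (OnePoint ℂ) × Measure (OnePoint ℂ)} (hμ : μ ∈ balancedPairs h B) :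
    gaussProj μ.1 = proj (vertices h) {gauss} (omegaOf h B μ) := by
  obtain ⟨hω, hm, -⟩ := H.omegaOf_spec hμ.1 hμ.2.1 hμ.2.2.1
  refine cells_gauss_funext ?_ fun x => ?_
  · rw [gaussProj_gauss, proj, mass_cell _ (singleton_gauss_mem_cells (gauss_mem_vertices h)),
      hω.2 _ ⟨gauss, gauss_mem_vertices h, rfl⟩]
  · rw [gaussProj_dir, proj, hm]

theorem bijOn_gaussProj {f : RatFunc 𝕃} {A : ℕ → RatFunc 𝕃}
    (H : ∀ n, 1 ≤ n → Rescales (A n) (ratIter f n)) :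
    BijOn gaussProj (DeltaZeroDag f A) (DeltaDag f) := by
  refine ⟨?_, ?_, ?_⟩
  · rintro μ ⟨⟨-, hev⟩, hμ⟩
    have hdag : gaussProj μ ∈ M1dag {gauss} :=
      mem_M1dag_gauss hμ.tsum_singleton (gaussProj_gauss μ) (gaussProj_dir μ)
    refine ⟨⟨hdag.1, ?_⟩, hdag⟩
    filter_upwards [hev, eventually_ge_atTop 1] with n ⟨ν, hν, ha, hb⟩ hn
    have hmem : (μ, ν) ∈ balancedPairs (ratIter f n) (A n) := ⟨hμ, hν, ha, hb⟩
    have hω := (H n hn).omegaOf_mem hmem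
    exact ⟨_, hω.1.1, hω.2, ((H n hn).gaussProj_eq hmem).symm⟩
  · rintro μ ⟨-, hμ⟩ ν ⟨-, hν⟩ h
    refine hμ.ext hν fun x => ?_
    rw [← gaussProj_dir, h, gaussProj_dir]
  · rintro ω ⟨⟨-, hev⟩, hω⟩
    have hsum : ∑' x, ω ⟨dir x, dir_mem_cells_gauss x⟩ = 1 := by
      rw [← tsum_mass_dir hω (mem_singleton gauss)]
      exact tsum_congr fun x => (mass_cell ω _).symm
    have hμ := atomicProb_atomicMeasure hsum
    refine ⟨_, ⟨⟨hμ.1, ?_⟩, hμ⟩, cells_gauss_funext ?_ fun x => ?_⟩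
    · filter_upwards [hev, eventually_ge_atTop 1] with n ⟨ω', hω', hb, hproj⟩ hn
      -- In `Delta` the measure `ω'` may a priori charge the vertices. Its mass at the Gauss point
      -- is that of its projection `ω`, namely zero, and balance then excludes mass at the other
      -- vertex.
      have h₀ : mass ω' {gauss} = 0 := by
        rw [← hω.2 ⟨{gauss}, singleton_gauss_mem_cells (mem_singleton _)⟩
          ⟨gauss, mem_singleton _, rfl⟩, ← hproj]
        rfl
      have hdag := (H n hn).mem_M1dag_of_balanced hω' hb h₀
      have hmem := (H n hn).muOf_mem ⟨hdag, hb⟩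
      have h1 : (muOf (ratIter f n) (A n) ω').1 =
          atomicMeasure fun x => ω ⟨dir x, dir_mem_cells_gauss x⟩ := by
        refine hmem.1.ext hμ fun x => ?_
        rw [((H n hn).muOf_spec hdag).2.2.1, atomicMeasure_singleton, ← hproj]
        rfl
      rw [← h1]
      exact ⟨_, hmem.2.1, hmem.2.2.1, hmem.2.2.2⟩
    · rw [gaussProj_gauss, hω.2 _ ⟨gauss, mem_singleton _, rfl⟩]
    · rw [gaussProj_dir, atomicMeasure_singleton]

/-! ### Meromorphic families of Möbius transformations -/

/-- Only finitely many terms are nonzero, because the supports of Laurent series are bounded below.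
-/
theorem tsum_coeff_mul (a b : Laurent) (n : ℤ) :
    ∑' i : ℤ, a.coeff i * b.coeff (n - i) = (a * b).coeff n := by
  set D := Finset.antidiagonal a.isPWO_support b.isPWO_support n with hD
  have hinj : Set.InjOn Prod.fst (D : Set (ℤ × ℤ)) := by
    rintro ⟨i, j⟩ hp ⟨i', j'⟩ hq h
    have hp' := (Finset.mem_antidiagonal.1 hp).2.2
    have hq' := (Finset.mem_antidiagonal.1 hq).2.2
    simp only at h hp' hq'
    ext <;> simp only <;> omega
  rw [tsum_eq_sum (s := D.image Prod.fst), Finset.sum_image hinj, HahnSeries.coeff_mul]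
  · refine Finset.sum_congr rfl fun p hp => ?_
    rw [← (Finset.mem_antidiagonal.1 hp).2.2, add_sub_cancel_left]
  · intro i hi
    by_contra h0
    refine hi (Finset.mem_image.2 ⟨(i, n - i), Finset.mem_antidiagonal.2 ⟨?_, ?_, ?_⟩, rfl⟩)
    · exact left_ne_zero_of_mul h0
    · exact right_ne_zero_of_mul h0
    · simp

theorem laurentEval_mul {a b : Laurent} (ha : ConvergesOnDisk a) (hb : ConvergesOnDisk b) {t : ℂ}
    (ht : t ≠ 0) (ht' : ‖t‖ < 1) :
    laurentEval (a * b) t = laurentEval a t * laurentEval b t := by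
  have h1 := (ha t ht ht').norm
  have h2 := (hb t ht ht').norm
  -- Reindexes the double series by the total exponent `n = i + j` and by `i`, so that summing over
  -- `i` first gives the coefficients of the product.
  let e : ℤ × ℤ ≃ ℤ × ℤ :=
    { toFun := fun q => (q.2, q.1 - q.2)
      invFun := fun p => (p.1 + p.2, p.1)
      left_inv := fun q => by simp
      right_inv := fun p => by simp }
  have hs := (e.summable_iff).2 (summable_mul_of_summable_norm h1 h2)
  rw [laurentEval, laurentEval, laurentEval, tsum_mul_tsum_of_summable_norm h1 h2, ← e.tsum_eq]
  refine Eq.trans (tsum_congr fun n => ?_) (hs.tsum_prod).symm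
  rw [← tsum_coeff_mul, ← tsum_mul_right]
  refine tsum_congr fun i => ?_
  change _ = a.coeff i * t ^ i * (b.coeff (n - i) * t ^ (n - i))
  rw [show t ^ n = t ^ i * t ^ (n - i) by rw [← zpow_add₀ ht]; congr 1; ring]
  ring

/-- Identity theorem at the puncture: if `s_n` is the lowest coefficient, vanishing at a real `t =
r` makes `s_n rⁿ` cancel the terms of higher order. These are `O(rⁿ⁺¹)` by comparison with the
series at `1/2`, so `s_n = 0` as `r → 0`. -/
theorem eq_zero_of_laurentEval_eq_zero {s : Laurent} (hs : ConvergesOnDisk s)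
    (h : ∀ t : ℂ, t ≠ 0 → ‖t‖ < 1 → laurentEval s t = 0) : s = 0 := by
  by_contra hne
  set n := s.order with hn
  have hc : s.coeff n ≠ 0 := HahnSeries.coeff_order_eq_zero.not.2 hne
  have hlow : ∀ k, k < n → s.coeff k = 0 := fun k hk => HahnSeries.coeff_eq_zero_of_lt_order hk
  have hM := (hs (1 / 2) (by norm_num) (by norm_num)).norm
  set M := ∑' k : ℤ, ‖s.coeff k * (1 / 2 : ℂ) ^ k‖ with hMdef
  have key : ∀ r : ℝ, 0 < r → r ≤ 1 / 2 → ‖s.coeff n‖ ≤ r * (2 ^ (n + 1) * M) := by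
    intro r hr hr'
    have hr0 : (r : ℂ) ≠ 0 := by exact_mod_cast hr.ne'
    have hr1 : ‖(r : ℂ)‖ < 1 := by
      rw [Complex.norm_real, Real.norm_of_nonneg hr.le]
      linarith
    have hsum := hs r hr0 hr1
    have h0 := h r hr0 hr1
    rw [laurentEval, hsum.tsum_eq_add_tsum_ite n] at h0
    -- For `k > n` write `r ^ k = (2r) ^ k * (1/2) ^ k` and use `2r ≤ 1`.
    have hterm : ∀ k, ‖(if k = n then 0 else s.coeff k * (r : ℂ) ^ k)‖ ≤
        (2 * r) ^ (n + 1) * ‖s.coeff k * (1 / 2 : ℂ) ^ k‖ := by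
      intro k
      have hnn : 0 ≤ (2 * r) ^ (n + 1) * ‖s.coeff k * (1 / 2 : ℂ) ^ k‖ := by positivity
      split_ifs with hk
      · simpa using hnn
      · rcases lt_or_gt_of_ne hk with hlt | hgt
        · simp [hlow k hlt]
        · rw [norm_mul, norm_mul, norm_zpow, norm_zpow, Complex.norm_real,
            Real.norm_of_nonneg hr.le]
          have e1 : r ^ k = (2 * r) ^ k * (1 / 2) ^ k := by
            rw [← mul_zpow]
            congr 1
            ring
          have e2 : (2 * r) ^ k ≤ (2 * r) ^ (n + 1) :=
            zpow_le_zpow_right_of_le_one₀ (by positivity) (by linarith) hgt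
          have e3 : ‖(1 / 2 : ℂ)‖ = 1 / 2 := by norm_num
          rw [e1, e3]
          calc ‖s.coeff k‖ * ((2 * r) ^ k * (1 / 2) ^ k)
              = (2 * r) ^ k * (‖s.coeff k‖ * (1 / 2) ^ k) := by ring
            _ ≤ _ := by gcongr
    have hbound : ‖∑' k, (if k = n then 0 else s.coeff k * (r : ℂ) ^ k)‖ ≤ (2 * r) ^ (n + 1) * M := by
      rw [hMdef, ← tsum_mul_left]
      exact tsum_of_norm_bounded (hM.mul_left _).hasSum hterm
    have h1 : ‖s.coeff n‖ * r ^ n ≤ (2 * r) ^ (n + 1) * M := by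
      rw [eq_neg_of_add_eq_zero_right h0, norm_neg, norm_mul, norm_zpow, Complex.norm_real,
        Real.norm_of_nonneg hr.le] at hbound
      exact hbound
    have hrn : 0 < r ^ n := zpow_pos hr n
    refine le_of_mul_le_mul_right (h1.trans (le_of_eq ?_)) hrn
    rw [mul_zpow, zpow_add₀ hr.ne', zpow_one]
    ring
  have hlim : Tendsto (fun r : ℝ => r * (2 ^ (n + 1) * M)) (𝓝[>] 0) (𝓝 (0 * (2 ^ (n + 1) * M))) :=
    ((continuous_id.mul continuous_const).tendsto 0).mono_left nhdsWithin_le_nhds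
  have hle : ‖s.coeff n‖ ≤ 0 * (2 ^ (n + 1) * M) := by
    refine ge_of_tendsto hlim ?_
    filter_upwards [Ioc_mem_nhdsGT (show (0 : ℝ) < 1 / 2 by norm_num)] with r hr
    exact key r hr.1 hr.2
  rw [zero_mul] at hle
  exact hc (norm_le_zero_iff.1 hle)

theorem coeff_specialize (P : Laurent[X]) (t : ℂ) (j : ℕ) :
    (specialize P t).coeff j = laurentEval (P.coeff j) t := by
  simp only [specialize, finsetSum_coeff, coeff_monomial]
  rw [Finset.sum_ite_eq' (Finset.range _) j]
  split_ifs with hj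
  · rfl
  · rw [Finset.mem_range, not_lt] at hj
    rw [coeff_eq_zero_of_natDegree_lt hj]
    simp [laurentEval]

/-- The family prescribes degrees only after specialization. Coefficients of index above one vanish
at every `t`, hence identically. If the determinant were zero, its value at `t = 1/2` would make
that specialization constant. -/
theorem IsMeromorphicFamily.ratDegree_eq_one {A : RatFunc 𝕃} (hA : IsMeromorphicFamily 1 A) :
    ratDegree A = 1 := by
  obtain ⟨P, Q, hP, hQ, rfl, hPQ⟩ := hA
  have hlin : ∀ R : Laurent[X], (∀ j, ConvergesOnDisk (R.coeff j)) →
      (∀ t : ℂ, t ≠ 0 → ‖t‖ < 1 → (specialize R t).natDegree ≤ 1) →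
      R = C (R.coeff 1) * X + C (R.coeff 0) := by
    intro R hR hdeg
    refine eq_X_add_C_of_natDegree_le_one (natDegree_le_iff_coeff_eq_zero.2 fun j hj => ?_)
    refine eq_zero_of_laurentEval_eq_zero (hR j) fun t ht ht' => ?_
    rw [← coeff_specialize]
    exact coeff_eq_zero_of_natDegree_lt ((hdeg t ht ht').trans_lt hj)
  have hP' := hlin P hP fun t ht ht' => (hPQ t ht ht').2 ▸ le_max_left _ _
  have hQ' := hlin Q hQ fun t ht ht' => (hPQ t ht ht').2 ▸ le_max_right _ _
  have hdet : P.coeff 1 * Q.coeff 0 - P.coeff 0 * Q.coeff 1 ≠ 0 := by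
    intro h0
    have ht : (1 / 2 : ℂ) ≠ 0 := by norm_num
    have ht' : ‖(1 / 2 : ℂ)‖ < 1 := by norm_num
    obtain ⟨hcop, hdeg⟩ := hPQ _ ht ht'
    have h1 : laurentEval (P.coeff 1) (1 / 2) * laurentEval (Q.coeff 0) (1 / 2) =
        laurentEval (P.coeff 0) (1 / 2) * laurentEval (Q.coeff 1) (1 / 2) := by
      rw [← laurentEval_mul (hP 1) (hQ 0) ht ht', ← laurentEval_mul (hP 0) (hQ 1) ht ht',
        sub_eq_zero.1 h0]
    have hp := eq_X_add_C_of_natDegree_le_one ((le_max_left _ _).trans hdeg.le :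
      (specialize P (1 / 2)).natDegree ≤ 1)
    have hq := eq_X_add_C_of_natDegree_le_one ((le_max_right _ _).trans hdeg.le :
      (specialize Q (1 / 2)).natDegree ≤ 1)
    simp only [coeff_specialize] at hp hq
    have h2 := eq_zero_of_linear_relation hcop (by rw [hdeg]; exact one_ne_zero)
      (a := laurentEval (Q.coeff 1) (1 / 2)) (b := -laurentEval (P.coeff 1) (1 / 2)) (by
        rw [hp, hq]
        have h3 := congrArg (C : ℂ → ℂ[X]) h1
        simp only [C_mul, C_neg] at h3 ⊢
        linear_combination -h3)
    rw [neg_eq_zero] at h2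
    rw [hp, hq, h2.1, h2.2] at hdeg
    simp [pairDegree] at hdeg
  have hdet' : ofLaurent (P.coeff 1) * ofLaurent (Q.coeff 0) -
      ofLaurent (P.coeff 0) * ofLaurent (Q.coeff 1) ≠ 0 := by
    rw [← map_mul, ← map_mul, ← map_sub]
    exact (map_ne_zero ofLaurent).2 hdet
  have e : ∀ a b : Laurent, (C a * X + C b).map ofLaurent = C (ofLaurent a) * X + C (ofLaurent b) := by
    intro a b
    simp
  rw [hP', hQ', e, e]
  exact (isMobius_div hdet').ratDegree_eq

theorem ratIter_one (f : RatFunc 𝕃) : ratIter f 1 = f := by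
  have h : ∀ p : 𝕃[X], p.eval₂ RatFunc.C (RatFunc.X : RatFunc 𝕃) = algebraMap 𝕃[X] (RatFunc 𝕃) p := by
    intro p
    conv_rhs => rw [← eval₂_C_X (p := p), hom_eval₂, RatFunc.algebraMap_X]
    rfl
  change RatFunc.eval RatFunc.C RatFunc.X f = f
  rw [RatFunc.eval, h, h, RatFunc.num_div_denom]

end DegLimit

end

theorem mainTheorem4 (d : ℕ) (hd : 1 < d) (f : RatFunc 𝕃) (hf : IsMeromorphicFamily d f)
    (hgood : berkMap f ⁻¹' {gauss} ≠ {gauss})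
    (A : ℕ → RatFunc 𝕃) (hA : ∀ n, 1 ≤ n → IsMeromorphicFamily 1 (A n))
    (hAf : ∀ n, 1 ≤ n → berkMap (ratComp (A n) (ratIter f n)) gauss = gauss) :
    (BijOn (omegaOf f (A 1)) (balancedPairs f (A 1)) (balancedQuantized f) ∧
      InvOn (muOf f (A 1)) (omegaOf f (A 1)) (balancedPairs f (A 1)) (balancedQuantized f)) ∧
    ∃ Φ : Measure (OnePoint ℂ) → (cells {gauss} → ℝ≥0∞),
      BijOn Φ (DeltaZeroDag f A) (DeltaDag f) ∧
      ∀ μC ∈ DeltaZeroDag f A, ∀ n, 1 ≤ n → ∀ μE,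
        (μC, μE) ∈ balancedPairs (ratIter f n) (A n) →
          Φ μC = proj (vertices (ratIter f n)) {gauss}
            (omegaOf (ratIter f n) (A n) (μC, μE)) := by
  have H : ∀ n, 1 ≤ n → Rescales (A n) (ratIter f n) := fun n hn =>
    ⟨(hA n hn).ratDegree_eq_one, hAf n hn⟩
  have H₁ : Rescales (A 1) f := by
    have := H 1 le_rfl
    rwa [ratIter_one] at this
  exact ⟨⟨H₁.bijOn, H₁.invOn⟩, gaussProj, bijOn_gaussProj H,
    fun μC _ n hn μE hμ => (H n hn).gaussProj_eq hμ⟩
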